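/- Let $(W_i)_{i\ge 1}$ be i.i.d. copies of a random variable $W$ with essential supremum $1$, i.e. $\sup\{x\in\mathbb R:\mathbb P(W\le x)<1\}=1$, with an atom at one, $\mathbb P(W=1)>0$, and with $\mathbb P(W\ge w^*)=1$ for some $w^*\in(0,1)$. Let $(T_n)_{n\ge1}$ be the weighted recursive tree with these weights: $T_1$ is the single vertex $1$, and, given the weights and $T_n$, the tree $T_{n+1}$ is obtained by adding a vertex $n+1$ and one edge directed from it to a vertex chosen from $\{1,\dots,n\}$, vertex $i$ being chosen with probability $W_i/\sum_{j=1}^n W_j$. Let $\mathcal Z_n(i)$ be the in-degree of vertex $i$ in $T_n$ and let $\theta:=1+\mathbb E[W]$. Fix $k\in\mathbb N$ and, for each $n\ge k$, let $v_1,\dots,v_k$ be $k$ vertices selected uniformly at random without replacement from $\{1,\dots,n\}$, independently of the weights and of $T_n$. Fix $c\in(0,\theta/(\theta-1))$ and let $d_1,\dots,d_k$ be integer-valued sequences $d_i=d_i(n)$ that diverge to $+\infty$ as $n\to\infty$ and satisfy $d_i\le c\log n$ for all $i\in\{1,\dots,k\}$ and all sufficiently large $n$. Assume moreover that for each $i\in\{1,\dots,k\}$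 there is an $a_i\in(0,\theta/(\theta-1))$ such that, as $n\to\infty$, $$\Big|\frac{d_i}{\log n}-a_i\Big|=o\Big(\frac1{\sqrt{\log n}}\Big).$$ Then the event $\{\mathcal Z_n(v_i)\ge d_i\text{ for all }i\in\{1,\dots,k\}\}$ has positive probability for all sufficiently large $n$ and, conditionally on this event, the tuple $$\left(\frac{\log v_i-(1-a_i(1-\theta^{-1}))\log n}{\sqrt{a_i(1-\theta^{-1})^2\log n}}\right)_{i\in\{1,\dots,k\}}$$ converges in distribution, as $n\to\infty$, to $(M_i)_{i\in\{1,\dots,k\}}$, where $M_1,\dots,M_k$ are independent standard normal random variables. -/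

import Mathlib

namespace WRT

open MeasureTheory ProbabilityTheory

/-- The total weight `S_n = W_1 + ... + W_n` of the vertices `1, ..., n`. -/
noncomputable def totalWeight {Ω : Type*} (W : ℕ → Ω → ℝ) (n : ℕ) (ω : Ω) : ℝ :=
  ∑ i ∈ Finset.Icc 1 n, W i ω

/-- The σ-algebra generated by all vertex-weights `W_1, W_2, ...` and by the tree on the vertices
`1, ..., n`, i.e. by the parents of the vertices `2, ..., n`. -/
abbrev history {Ω : Type*} (W : ℕ → Ω → ℝ) (parent : ℕ → Ω → ℕ) (n : ℕ) : MeasurableSpace Ω :=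
  (⨆ i : ℕ, MeasurableSpace.comap (W (i + 1)) inferInstance) ⊔
    ⨆ j ∈ Finset.Icc 2 n, MeasurableSpace.comap (parent j) inferInstance

/-- `(W, parent)` is a weighted recursive tree on the probability space `(Ω, μ)`.
Vertices are labelled `1, 2, 3, ...`, `W i` is the weight of vertex `i`, and for `n ≥ 1` the vertex
`parent (n + 1)` in `{1, ..., n}` is the one to which the new vertex `n + 1` connects; the values
`W 0`, `parent 0` and `parent 1` play no role. The weights are i.i.d. and almost surely positive,
and, given the weights and the tree on `1, ..., n`, vertex `n + 1` connects to vertex `i` with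
probability `W i / S_n`. -/
structure IsWeightedRecursiveTree {Ω : Type*} [MeasurableSpace Ω] (μ : Measure Ω)
    (W : ℕ → Ω → ℝ) (parent : ℕ → Ω → ℕ) : Prop where
  measurable_weight : ∀ i, 1 ≤ i → Measurable (W i)
  measurable_parent : ∀ j, 2 ≤ j → Measurable (parent j)
  indep_weight : iIndepFun (fun i : ℕ => W (i + 1)) μ
  identDistrib_weight : ∀ i, 1 ≤ i → IdentDistrib (W i) (W 1) μ μ
  weight_pos : ∀ᵐ ω ∂μ, 0 < W 1 ω
  attach : ∀ n, 1 ≤ n → ∀ i ∈ Finset.Icc 1 n,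
    μ[Set.indicator {ω | parent (n + 1) ω = i} (fun _ => (1 : ℝ)) | history W parent n]
      =ᵐ[μ] fun ω => W i ω / totalWeight W n ω

/-- The in-degree `Z_n(i)` of vertex `i` in the tree on `1, ..., n`
(edges point from the new vertex to its parent). -/
def inDegree {Ω : Type*} (parent : ℕ → Ω → ℕ) (n i : ℕ) (ω : Ω) : ℕ :=
  ((Finset.Icc 2 n).filter (fun j => parent j ω = i)).card

/-- `v = (v_1, ..., v_k)` is a tuple of vertices selected uniformly at random without replacement
from `{1, ..., n}`: each of the `n (n - 1) ⋯ (n - k + 1)` tuples of distinct vertices is equally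
likely. (Meaningful for `k ≤ n`; there is no such tuple, hence no condition on the law, if
`n < k`.) -/
structure IsUniformSample {Ω : Type*} [MeasurableSpace Ω] (μ : Measure Ω) (n : ℕ) {k : ℕ}
    (v : Ω → Fin k → ℕ) : Prop where
  measurable : Measurable v
  law : ∀ u : Fin k → ℕ, Function.Injective u → (∀ i, u i ∈ Finset.Icc 1 n) →
    μ.real {ω | v ω = u} = 1 / (n.descFactorial k : ℝ)

/-- The vertex-weight assumptions: the essential supremum of `W` is one, `W` has an atom at one, and
`W` is almost surely bounded away from zero by some `w* ∈ (0, 1)`. -/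
structure WeightAssumption {Ω : Type*} [MeasurableSpace Ω] (μ : Measure Ω) (W : Ω → ℝ) :
    Prop where
  sup_eq_one : IsLUB {x : ℝ | μ {ω | W ω ≤ x} < 1} 1
  atom : 0 < μ {ω | W ω = 1}
  bounded_below : ∃ w : ℝ, 0 < w ∧ w < 1 ∧ ∀ᵐ ω ∂μ, w ≤ W ω

/-- The event `{Z_n(v_i) ≥ d_i for all i}`. -/
def degreeEvent {Ω : Type*} (parent : ℕ → Ω → ℕ) (n : ℕ) {k : ℕ} (v : Ω → Fin k → ℕ)
    (d : Fin k → ℤ) : Set Ω :=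
  {ω | ∀ i, d i ≤ (inDegree parent n (v ω i) ω : ℤ)}

/-- The rescaled labels
`(log v_i - (1 - a_i (1 - θ⁻¹)) log n) / √(a_i (1 - θ⁻¹)² log n)`. -/
noncomputable def rescaledLabels {Ω : Type*} (θ : ℝ) (n : ℕ) {k : ℕ} (a : Fin k → ℝ)
    (v : Ω → Fin k → ℕ) (ω : Ω) : Fin k → ℝ :=
  fun i => (Real.log (v ω i) - (1 - a i * (1 - θ⁻¹)) * Real.log n) /
    Real.sqrt (a i * (1 - θ⁻¹) ^ 2 * Real.log n)

end WRT

/-! Write b = E[W], so θ = 1 + b. Given the weights, the in-degree of vertex v is a sum of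
independent indicators with success probabilities W_v / S_m for v ≤ m < n. Since S_m ≈ m b, it is
nearly Poisson with mean (W_v / b) log(n/v), and distinct vertices are nearly independent. For a
uniform vertex, s = log(n/v) is nearly exponential of rate one. The unnormalised characteristic
function of the label on {degree ≥ d} is therefore close to the mean, with x = W / b and q = 1 - iτ,
of the Laplace transform ∫ exp(-q s) P(Poisson(x s) ≥ d) ds = q⁻¹ (x / (x + q))^d
(`integral_exp_neg_mul_mul_poissonTail`).

At τ = 0 the base x / (x + 1) equals 1/θ when W = 1 and is strictly smaller when W < 1. After
multiplication by θ^d only the atom at one survives (`tendsto_integral_exp_mul_pow`). On the atom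
there remains the characteristic function of a Gamma variable of shape d, mean d (1 - θ⁻¹) and
variance d (1 - θ⁻¹)². Because d = a log n + o(√log n), centring at a (1 - θ⁻¹) log n is accurate to
o(standard deviation), and the limit is P(W = 1) exp(-t²/2) (`tendsto_exp_mul_inv_pow`,
`tendsto_oneVertexSum`).

The events have polynomially small probability, so every approximation error must be small relative
to θ^(-d). All comparisons are thus made in the weighted norm sup_d ∏ r_i^(d_i) |f(d)|. Poisson
tails satisfy f_d' = f_{d-1} - f_d, and the degree tails satisfy a discrete analogue
(`condExp_tailEvent_eq`). Lowering an index costs only a factor r_i in this norm, which yields a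
tilted Poisson approximation (`tilt_mul_abs_counterTail_sub_le`). With r = θ the price is exp((θ -
1) · mean) = (n/v)^W ≤ n/v up to a constant, and its average over v is only of order log n. Relative
errors that are negative powers of n therefore suffice.

Labels below n^ε escape this argument, because the early total weights are not concentrated. They
are handled with a smaller tilt r < θ. A suitable r exists precisely because a < θ/(θ - 1)
(`exists_tilting_parameter`), and the same r cuts off the Laplace integral. The event that the total
weights deviate has stretched-exponentially small probability, which beats the polynomial size of
θ^d.

Independence of the weights of distinct vertices factorises the k-vertex sum, coinciding labels
being negligible (`tendsto_sum_distinctTuples_sub_prod`). Lévy's continuity theorem concludes: t = 0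
supplies the normalisation and the positivity of the conditioning event
(`tendsto_integral_cond_gaussian`). -/

namespace WRT

open MeasureTheory ProbabilityTheory

/-! ### Tails of the Poisson distribution -/

/-- The probability that a Poisson variable of mean `x` is at least `d`. -/
noncomputable def poissonTail (d : ℤ) (x : ℝ) : ℝ :=
  1 - ∑ l ∈ Finset.range d.toNat, Real.exp (-x) * x ^ l / l.factorial

lemma poissonTail_of_nonpos {d : ℤ} (hd : d ≤ 0) (x : ℝ) : poissonTail d x = 1 := by
  simp [poissonTail, Int.toNat_of_nonpos hd]

lemma poissonTail_succ (d : ℕ) (x : ℝ) :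
    poissonTail ((d : ℤ) + 1) x = poissonTail d x - Real.exp (-x) * x ^ d / d.factorial := by
  have h : ((d : ℤ) + 1).toNat = d + 1 := by omega
  simp only [poissonTail, h, Finset.sum_range_succ, Int.toNat_natCast]
  ring

lemma poissonTail_zero_right {d : ℤ} (hd : 0 < d) : poissonTail d 0 = 0 := by
  obtain ⟨m, hm⟩ : ∃ m : ℕ, d.toNat = m + 1 := ⟨d.toNat - 1, by omega⟩
  simp [poissonTail, hm, Finset.sum_range_succ']

lemma hasDerivAt_poissonTail_succ (d : ℕ) (x : ℝ) :
    HasDerivAt (poissonTail ((d : ℤ) + 1)) (Real.exp (-x) * x ^ d / d.factorial) x := by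
  have hexp : HasDerivAt (fun x : ℝ => Real.exp (-x)) (-Real.exp (-x)) x := by
    simpa using (hasDerivAt_neg x).exp
  induction d with
  | zero =>
    have h : poissonTail (((0 : ℕ) : ℤ) + 1) = fun x => 1 - Real.exp (-x) := by
      funext x; simp [poissonTail]
    rw [h]
    simpa using hexp.const_sub 1
  | succ d ih =>
    have h : poissonTail (((d + 1 : ℕ) : ℤ) + 1) = fun x =>
        poissonTail ((d : ℤ) + 1) x - Real.exp (-x) * x ^ (d + 1) / (d + 1).factorial := by
      funext x; rw [poissonTail_succ]; push_cast; rfl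
    rw [h]
    have h2 := ih.sub ((hexp.mul (hasDerivAt_pow (d + 1) x)).div_const ((d + 1).factorial : ℝ))
    convert! h2 using 1
    have : (d.factorial : ℝ) ≠ 0 := by positivity
    have : ((d : ℝ) + 1) ≠ 0 := by positivity
    simp only [Nat.factorial_succ, Nat.add_sub_cancel]
    push_cast
    field_simp
    ring

/-- The forward equation of the Poisson process. Thresholds are integers, with tail one at every
nonpositive threshold, so the equation has no exceptional case when an index is lowered. -/
lemma hasDerivAt_poissonTail (d : ℤ) (x : ℝ) :
    HasDerivAt (poissonTail d) (poissonTail (d - 1) x - poissonTail d x) x := by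
  rcases le_or_gt d 0 with hd | hd
  · have h : poissonTail d = fun _ => 1 := funext fun x => poissonTail_of_nonpos hd x
    rw [poissonTail_of_nonpos hd, poissonTail_of_nonpos (by omega), h]
    simpa using hasDerivAt_const x (1 : ℝ)
  · obtain ⟨m, rfl⟩ : ∃ m : ℕ, d = (m : ℤ) + 1 := ⟨(d - 1).toNat, by omega⟩
    convert! hasDerivAt_poissonTail_succ m x using 1
    rw [poissonTail_succ, add_sub_cancel_right]
    ring

lemma continuous_poissonTail (d : ℤ) : Continuous (poissonTail d) :=
  continuous_iff_continuousAt.2 fun x => (hasDerivAt_poissonTail d x).continuousAt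

/-- The function exp(x) u_{d+1}(x) has derivative exp(x) u_d(x), so nonnegativity passes from d to d
+ 1. This is the comparison principle behind both the positivity of Poisson tails and their
exponential Markov inequality. -/
lemma nonneg_of_hasDerivAt_sub {u : ℕ → ℝ → ℝ} (h0 : ∀ x, 0 ≤ x → 0 ≤ u 0 x)
    (hz : ∀ d, 0 ≤ u (d + 1) 0)
    (hd : ∀ d x, HasDerivAt (u (d + 1)) (u d x - u (d + 1) x) x) :
    ∀ d x, 0 ≤ x → 0 ≤ u d x := by
  intro d
  induction d with
  | zero => exact h0
  | succ d ih =>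
    intro x hx
    have hD : ∀ y, HasDerivAt (fun y => Real.exp y * u (d + 1) y) (Real.exp y * u d y) y := by
      intro y
      convert! (Real.hasDerivAt_exp y).mul (hd d y) using 1
      ring
    have hmono : MonotoneOn (fun y => Real.exp y * u (d + 1) y) (Set.Ici 0) := by
      refine monotoneOn_of_deriv_nonneg (convex_Ici 0)
        (fun y _ => (hD y).continuousAt.continuousWithinAt)
        (fun y _ => (hD y).differentiableAt.differentiableWithinAt) fun y hy => ?_
      rw [interior_Ici] at hy
      rw [(hD y).deriv]
      exact mul_nonneg (Real.exp_pos y).le (ih y (le_of_lt hy))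
    have h := hmono (Set.self_mem_Ici) (Set.mem_Ici.2 hx) hx
    have h2 : 0 ≤ Real.exp x * u (d + 1) x := le_trans (by simpa using hz d) h
    exact nonneg_of_mul_nonneg_right h2 (Real.exp_pos x)

lemma poissonTail_nonneg (d : ℤ) {x : ℝ} (hx : 0 ≤ x) : 0 ≤ poissonTail d x := by
  rcases le_or_gt d 0 with hd | hd
  · simp [poissonTail_of_nonpos hd]
  · lift d to ℕ using hd.le
    refine nonneg_of_hasDerivAt_sub (u := fun d x => poissonTail d x) ?_ ?_ ?_ d x hx
    · intro x _; simp [poissonTail]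
    · intro d; simp [poissonTail_zero_right (d := (d : ℤ) + 1) (by omega)]
    · intro d x
      simpa using hasDerivAt_poissonTail ((d : ℤ) + 1) x

/-- The exponential Markov inequality for the Poisson distribution. -/
lemma zpow_mul_poissonTail_le (d : ℤ) {x r : ℝ} (hx : 0 ≤ x) (hr : 1 ≤ r) :
    r ^ d * poissonTail d x ≤ Real.exp ((r - 1) * x) := by
  have hr0 : 0 < r := by linarith
  rcases le_or_gt d 0 with hd | hd
  · rw [poissonTail_of_nonpos hd, mul_one]
    exact (zpow_le_one_of_nonpos₀ hr hd).trans (Real.one_le_exp (by nlinarith))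
  · lift d to ℕ using hd.le
    -- The majorant r^(-d) exp((r - 1) x) solves the same system of differential equations as the
    -- tails, hence so does the difference.
    have h := nonneg_of_hasDerivAt_sub
      (u := fun d x => (r ^ d)⁻¹ * Real.exp ((r - 1) * x) - poissonTail d x) ?_ ?_ ?_ d x hx
    · rw [zpow_natCast]
      have h2 : poissonTail d x ≤ (r ^ d)⁻¹ * Real.exp ((r - 1) * x) := by linarith
      calc r ^ d * poissonTail d x ≤ r ^ d * ((r ^ d)⁻¹ * Real.exp ((r - 1) * x)) := by gcongr
        _ = Real.exp ((r - 1) * x) := by field_simp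
    · intro x hx
      simp only [pow_zero, inv_one, one_mul, Nat.cast_zero, poissonTail_of_nonpos le_rfl]
      linarith [Real.one_le_exp (x := (r - 1) * x) (by nlinarith)]
    · intro d
      simp [poissonTail_zero_right (d := (d : ℤ) + 1) (by omega)]
      positivity
    · intro d x
      have h1 := hasDerivAt_poissonTail ((d : ℤ) + 1) x
      have h2 : HasDerivAt (fun x : ℝ => (r ^ (d + 1))⁻¹ * Real.exp ((r - 1) * x))
          ((r ^ (d + 1))⁻¹ * (Real.exp ((r - 1) * x) * (r - 1))) x := by
        refine HasDerivAt.const_mul _ (HasDerivAt.exp ?_)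
        simpa using (hasDerivAt_id x).const_mul (r - 1)
      convert! h2.sub h1 using 1
      rw [add_sub_cancel_right]
      push_cast
      field_simp
      ring

lemma poissonTail_le_one (d : ℤ) {x : ℝ} (hx : 0 ≤ x) : poissonTail d x ≤ 1 := by
  simpa using zpow_mul_poissonTail_le d hx le_rfl

/-! ### Comparison of counting recursions with products of Poisson tails -/

section Comparison

variable {ι : Type*} [Fintype ι]

/-- The exponential weight `∏ r_i ^ d_i` of a multi-index. -/
noncomputable def tilt (r : ι → ℝ) (d : ι → ℤ) : ℝ := ∏ i, r i ^ d i

lemma tilt_pos {r : ι → ℝ} (hr : ∀ i, 0 < r i) (d : ι → ℤ) : 0 < tilt r d :=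
  Finset.prod_pos fun i _ => zpow_pos (hr i) _

/-- The product of the Poisson tails with means `x_i`. -/
noncomputable def poissonTails (d : ι → ℤ) (x : ι → ℝ) : ℝ := ∏ i, poissonTail (d i) (x i)

lemma poissonTails_nonneg (d : ι → ℤ) {x : ι → ℝ} (hx : ∀ i, 0 ≤ x i) :
    0 ≤ poissonTails d x :=
  Finset.prod_nonneg fun i _ => poissonTail_nonneg _ (hx i)

lemma poissonTails_le_one (d : ι → ℤ) {x : ι → ℝ} (hx : ∀ i, 0 ≤ x i) :
    poissonTails d x ≤ 1 :=
  Finset.prod_le_one (fun i _ => poissonTail_nonneg _ (hx i))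
    fun i _ => poissonTail_le_one _ (hx i)

lemma tilt_mul_poissonTails_le (d : ι → ℤ) {x r : ι → ℝ} (hx : ∀ i, 0 ≤ x i)
    (hr : ∀ i, 1 ≤ r i) :
    tilt r d * poissonTails d x ≤ Real.exp (∑ i, (r i - 1) * x i) := by
  rw [tilt, poissonTails, ← Finset.prod_mul_distrib, Real.exp_sum]
  refine Finset.prod_le_prod (fun i _ => ?_) fun i _ => zpow_mul_poissonTail_le _ (hx i) (hr i)
  exact mul_nonneg (zpow_nonneg (by linarith [hr i]) _) (poissonTail_nonneg _ (hx i))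

variable [DecidableEq ι]

/-- The multi-index `d` with its `i`-th entry lowered by one. -/
def lower (d : ι → ℤ) (i : ι) : ι → ℤ := Function.update d i (d i - 1)

lemma tilt_eq_mul_lower {r : ι → ℝ} (hr : ∀ i, 0 < r i) (d : ι → ℤ) (i : ι) :
    tilt r d = r i * tilt r (lower d i) := by
  simp only [tilt, lower]
  rw [← Finset.mul_prod_erase _ _ (Finset.mem_univ i),
    ← Finset.mul_prod_erase _ (fun j => r j ^ (Function.update d i (d i - 1)) j)
      (Finset.mem_univ i), ← mul_assoc]
  congr 1
  · rw [Function.update_self, ← zpow_one_add₀ (hr i).ne']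
    congr 1; ring
  · refine Finset.prod_congr rfl fun j hj => ?_
    rw [Function.update_of_ne (Finset.ne_of_mem_erase hj)]

/-- By the product rule, moving the means along a line acts on the family indexed by d as a
difference operator. This is the hypothesis `hu` of the Taylor estimates below. -/
lemma hasDerivAt_poissonTails_line (d : ι → ℤ) (x y : ι → ℝ) (s : ℝ) :
    HasDerivAt (fun s => poissonTails d fun i => x i + s * y i)
      (∑ i, y i * (poissonTails (lower d i) (fun j => x j + s * y j) -
        poissonTails d fun j => x j + s * y j)) s := by
  have h1 : ∀ i, HasDerivAt (fun s => poissonTail (d i) (x i + s * y i))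
      ((poissonTail (d i - 1) (x i + s * y i) - poissonTail (d i) (x i + s * y i)) * y i) s := by
    intro i
    refine HasDerivAt.comp (h₂ := poissonTail (d i)) s (hasDerivAt_poissonTail (d i) (x i + s * y i)) ?_
    simpa using ((hasDerivAt_id s).mul_const (y i)).const_add (x i)
  have h2 := HasDerivAt.fun_finsetProd (u := Finset.univ) fun i _ => h1 i
  convert! h2 using 1
  refine Finset.sum_congr rfl fun i _ => ?_
  rw [poissonTails, poissonTails, ← Finset.mul_prod_erase _ _ (Finset.mem_univ i),
    ← Finset.mul_prod_erase Finset.univ (fun j => poissonTail (d j) (x j + s * y j))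
      (Finset.mem_univ i)]
  have h3 : ∏ j ∈ Finset.univ.erase i, poissonTail (lower d i j) (x j + s * y j)
      = ∏ j ∈ Finset.univ.erase i, poissonTail (d j) (x j + s * y j) := by
    refine Finset.prod_congr rfl fun j hj => ?_
    rw [lower, Function.update_of_ne (Finset.ne_of_mem_erase hj)]
  rw [h3, lower, Function.update_self, smul_eq_mul]
  ring

/-! ### Taylor estimates in the tilted sup norm. -/

section Taylor

variable {u : (ι → ℤ) → ℝ → ℝ} {y r : ι → ℝ} {B : ℝ}

/-- Lowering the i-th index changes the tilt by a factor r i, so the difference operator is bounded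
on the tilted sup norm, with norm at most ∑ |y i| (r i + 1). -/
lemma tilt_mul_abs_shift_sum_le (hr : ∀ i, 0 < r i) {f : (ι → ℤ) → ℝ}
    (hB : ∀ d, tilt r d * |f d| ≤ B) (d : ι → ℤ) :
    tilt r d * |∑ i, y i * (f (lower d i) - f d)| ≤ B * ∑ i, |y i| * (r i + 1) := by
  have ht := tilt_pos hr d
  calc tilt r d * |∑ i, y i * (f (lower d i) - f d)|
      ≤ tilt r d * ∑ i, |y i| * (|f (lower d i)| + |f d|) := by
        gcongr
        refine (Finset.abs_sum_le_sum_abs _ _).trans (Finset.sum_le_sum fun i _ => ?_)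
        rw [abs_mul]
        gcongr
        exact abs_sub _ _
    _ = ∑ i, |y i| * (r i * (tilt r (lower d i) * |f (lower d i)|) + tilt r d * |f d|) := by
        rw [Finset.mul_sum]
        refine Finset.sum_congr rfl fun i _ => ?_
        rw [← mul_assoc (r i), ← tilt_eq_mul_lower hr]
        ring
    _ ≤ ∑ i, |y i| * (r i * B + B) := by
        refine Finset.sum_le_sum fun i _ => ?_
        have := hr i
        gcongr
        · exact hB _
        · exact hB _
    _ = B * ∑ i, |y i| * (r i + 1) := by
        rw [Finset.mul_sum]
        exact Finset.sum_congr rfl fun i _ => by ring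

lemma tilt_mul_abs_sub_le (hr : ∀ i, 0 < r i)
    (hu : ∀ d s, HasDerivAt (u d) (∑ i, y i * (u (lower d i) s - u d s)) s)
    (hB : ∀ d, ∀ s ∈ Set.Icc (0 : ℝ) 1, tilt r d * |u d s| ≤ B)
    (d : ι → ℤ) {s : ℝ} (hs : s ∈ Set.Icc (0 : ℝ) 1) :
    tilt r d * |u d s - u d 0| ≤ B * ∑ i, |y i| * (r i + 1) := by
  have ht := tilt_pos hr d
  have hB0 : 0 ≤ B := le_trans (by positivity) (hB d s hs)
  have hP : 0 ≤ ∑ i, |y i| * (r i + 1) :=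
    Finset.sum_nonneg fun i _ => mul_nonneg (abs_nonneg _) (by linarith [hr i])
  have h := Convex.norm_image_sub_le_of_norm_hasDerivWithin_le
    (f := u d) (C := B * (∑ i, |y i| * (r i + 1)) / tilt r d)
    (fun x _ => (hu d x).hasDerivWithinAt) (fun x hx => ?_) (convex_Icc (0 : ℝ) 1)
    (Set.left_mem_Icc.2 zero_le_one) hs
  · have hs1 : ‖s - 0‖ ≤ 1 := by
      rw [sub_zero, Real.norm_eq_abs, abs_of_nonneg hs.1]; exact hs.2
    rw [Real.norm_eq_abs (u d s - u d 0)] at h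
    calc tilt r d * |u d s - u d 0|
        ≤ tilt r d * (B * (∑ i, |y i| * (r i + 1)) / tilt r d * 1) := by
          gcongr
          exact h.trans (by gcongr)
      _ = B * ∑ i, |y i| * (r i + 1) := by field_simp
  · rw [le_div_iff₀ ht, mul_comm, Real.norm_eq_abs]
    exact tilt_mul_abs_shift_sum_le hr (f := fun d => u d x) (fun d => hB d x hx) d

/-- The first derivative is the difference operator applied to u, so it solves the same equation.
Applying the operator bound twice controls the remainder after the linear term. -/
lemma tilt_mul_abs_taylor_le (hr : ∀ i, 0 < r i)
    (hu : ∀ d s, HasDerivAt (u d) (∑ i, y i * (u (lower d i) s - u d s)) s)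
    (hB : ∀ d, ∀ s ∈ Set.Icc (0 : ℝ) 1, tilt r d * |u d s| ≤ B) (d : ι → ℤ) :
    tilt r d * |u d 1 - (u d 0 + ∑ i, y i * (u (lower d i) 0 - u d 0))|
      ≤ B * (∑ i, |y i| * (r i + 1)) ^ 2 := by
  have ht := tilt_pos hr d
  set P := ∑ i, |y i| * (r i + 1) with hP
  set v : (ι → ℤ) → ℝ → ℝ := fun d s => ∑ i, y i * (u (lower d i) s - u d s) with hv
  have hvd : ∀ d s, HasDerivAt (v d) (∑ i, y i * (v (lower d i) s - v d s)) s := fun d s =>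
    HasDerivAt.fun_sum fun i _ => ((hu (lower d i) s).sub (hu d s)).const_mul (y i)
  have hvB : ∀ d, ∀ s ∈ Set.Icc (0 : ℝ) 1, tilt r d * |v d s| ≤ B * P := fun d s hs =>
    tilt_mul_abs_shift_sum_le hr (f := fun d => u d s) (fun d => hB d s hs) d
  have hv0 := fun s hs => tilt_mul_abs_sub_le hr hvd hvB d (s := s) hs
  have h := Convex.norm_image_sub_le_of_norm_hasDerivWithin_le
    (f := fun s => u d s - s * v d 0) (f' := fun s => v d s - v d 0)
    (C := B * P * P / tilt r d)
    (fun x _ => ((hu d x).sub (by simpa using (hasDerivAt_id x).mul_const (v d 0))).hasDerivWithinAt)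
    (fun x hx => ?_) (convex_Icc (0 : ℝ) 1)
    (Set.left_mem_Icc.2 zero_le_one) (Set.right_mem_Icc.2 zero_le_one)
  · have h2 : u d 1 - (u d 0 + ∑ i, y i * (u (lower d i) 0 - u d 0))
        = u d 1 - 1 * v d 0 - (u d 0 - 0 * v d 0) := by simp only [hv]; ring
    rw [h2]
    rw [Real.norm_eq_abs (_ - _)] at h
    calc tilt r d * _ ≤ tilt r d * (B * P * P / tilt r d * ‖(1 : ℝ) - 0‖) := by gcongr
      _ = B * P ^ 2 := by simp; field_simp
  · rw [le_div_iff₀ ht, mul_comm, Real.norm_eq_abs]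
    exact hv0 x hx

end Taylor

/-- The recursion of `m ↦ ℙ(Z_m(i) ≥ d_i for all i)` for counters `Z` that start at zero and, in
step `m`, increase at most one of their entries, the `i`-th one with probability `p m i`. -/
noncomputable def counterTail (p : ℕ → ι → ℝ) : ℕ → (ι → ℤ) → ℝ
  | 0, d => if ∀ i, d i ≤ 0 then 1 else 0
  | m + 1, d => (1 - ∑ i, p m i) * counterTail p m d
      + ∑ i, p m i * counterTail p m (lower d i)

variable {p : ℕ → ι → ℝ} {r : ι → ℝ}

lemma counterTail_nonneg (hp : ∀ m i, 0 ≤ p m i) (hp1 : ∀ m, ∑ i, p m i ≤ 1) (m : ℕ)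
    (d : ι → ℤ) : 0 ≤ counterTail p m d := by
  induction m generalizing d with
  | zero => simp only [counterTail]; split_ifs <;> norm_num
  | succ m ih =>
    simp only [counterTail]
    exact add_nonneg (mul_nonneg (by linarith [hp1 m]) (ih d))
      (Finset.sum_nonneg fun i _ => mul_nonneg (hp m i) (ih _))

/-- One step of the counter recursion is a convex combination of f and its lowered versions, and
each lowering costs r i. Its norm is therefore at most 1 + ∑ (r i - 1) q i. Linearity in f lets the
bound serve both the tails and the approximation error. -/
lemma step_tilt_le (hr : ∀ i, 1 ≤ r i) {q : ι → ℝ} (hq : ∀ i, 0 ≤ q i) (hq1 : ∑ i, q i ≤ 1)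
    {f : (ι → ℤ) → ℝ} {B : ℝ} (hB : ∀ d, tilt r d * |f d| ≤ B) (d : ι → ℤ) :
    tilt r d * |(1 - ∑ i, q i) * f d + ∑ i, q i * f (lower d i)|
      ≤ B * Real.exp (∑ i, (r i - 1) * q i) := by
  have hr0 : ∀ i, 0 < r i := fun i => by linarith [hr i]
  have ht := tilt_pos hr0 d
  have hB0 : 0 ≤ B := le_trans (by positivity) (hB d)
  calc tilt r d * |(1 - ∑ i, q i) * f d + ∑ i, q i * f (lower d i)|
      ≤ tilt r d * ((1 - ∑ i, q i) * |f d| + ∑ i, q i * |f (lower d i)|) := by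
        gcongr
        refine (abs_add_le _ _).trans (add_le_add ?_ ?_)
        · rw [abs_mul, abs_of_nonneg (by linarith)]
        · refine (Finset.abs_sum_le_sum_abs _ _).trans (Finset.sum_le_sum fun i _ => ?_)
          rw [abs_mul, abs_of_nonneg (hq i)]
    _ = (1 - ∑ i, q i) * (tilt r d * |f d|)
        + ∑ i, q i * (r i * (tilt r (lower d i) * |f (lower d i)|)) := by
        rw [mul_add, Finset.mul_sum]
        congr 1
        · ring
        · refine Finset.sum_congr rfl fun i _ => ?_
          rw [← mul_assoc (r i), ← tilt_eq_mul_lower hr0]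
          ring
    _ ≤ (1 - ∑ i, q i) * B + ∑ i, q i * (r i * B) := by
        refine add_le_add (mul_le_mul_of_nonneg_left (hB d) (by linarith))
          (Finset.sum_le_sum fun i _ => ?_)
        have := hr0 i
        have := hq i
        gcongr
        exact hB _
    _ = B * (∑ i, (r i - 1) * q i + 1) := by
        rw [mul_add, Finset.mul_sum, mul_one, sub_mul, one_mul, Finset.sum_mul, sub_add_eq_add_sub,
          add_sub_assoc, ← Finset.sum_sub_distrib, add_comm]
        congr 1
        exact Finset.sum_congr rfl fun i _ => by ring
    _ ≤ B * Real.exp (∑ i, (r i - 1) * q i) := by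
        gcongr
        exact Real.add_one_le_exp _

/-- The exponential Markov inequality for the counters. -/
lemma tilt_mul_counterTail_le (hr : ∀ i, 1 ≤ r i) (hp : ∀ m i, 0 ≤ p m i)
    (hp1 : ∀ m, ∑ i, p m i ≤ 1) (m : ℕ) (d : ι → ℤ) :
    tilt r d * |counterTail p m d|
      ≤ Real.exp (∑ i, (r i - 1) * ∑ l ∈ Finset.range m, p l i) := by
  induction m generalizing d with
  | zero =>
    simp only [counterTail, Finset.range_zero, Finset.sum_empty, mul_zero, Finset.sum_const_zero,
      Real.exp_zero]
    split_ifs with h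
    · rw [abs_one, mul_one]
      exact Finset.prod_le_one (fun i _ => zpow_nonneg (by linarith [hr i]) _)
        fun i _ => zpow_le_one_of_nonpos₀ (hr i) (h i)
    · simp
  | succ m ih =>
    refine (step_tilt_le hr (hp m) (hp1 m) ih d).trans (le_of_eq ?_)
    rw [← Real.exp_add, ← Finset.sum_add_distrib]
    congr 1
    exact Finset.sum_congr rfl fun i _ => by rw [Finset.sum_range_succ, mul_add]

/-- The counters are close to independent Poisson variables, even after exponential tilting. -/
lemma tilt_mul_abs_counterTail_sub_le (hr : ∀ i, 1 ≤ r i) (hp : ∀ m i, 0 ≤ p m i)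
    (hp1 : ∀ m, ∑ i, p m i ≤ 1) (m : ℕ) (d : ι → ℤ) :
    tilt r d * |counterTail p m d - poissonTails d fun i => ∑ l ∈ Finset.range m, p l i|
      ≤ (∑ l ∈ Finset.range m, (∑ i, p l i * (r i + 1)) ^ 2)
        * Real.exp (∑ i, (r i - 1) * ∑ l ∈ Finset.range m, p l i) := by
  have hr0 : ∀ i, 0 < r i := fun i => by linarith [hr i]
  induction m generalizing d with
  | zero =>
    have h : counterTail p 0 d = poissonTails d fun i => ∑ l ∈ Finset.range 0, p l i := by
      simp only [counterTail, poissonTails, Finset.range_zero, Finset.sum_empty]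
      split_ifs with h
      · exact (Finset.prod_eq_one fun i _ => poissonTail_of_nonpos (h i) 0).symm
      · push Not at h
        obtain ⟨i, hi⟩ := h
        exact (Finset.prod_eq_zero (Finset.mem_univ i) (poissonTail_zero_right hi)).symm
    rw [h]
    simp
  | succ m ih =>
    set x : ι → ℝ := fun i => ∑ l ∈ Finset.range m, p l i with hx
    have hx0 : ∀ i, 0 ≤ x i := fun i => Finset.sum_nonneg fun l _ => hp l i
    have hx' : (fun i => ∑ l ∈ Finset.range (m + 1), p l i) = fun i => x i + p m i := by
      funext i; rw [Finset.sum_range_succ]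
    have hE : Real.exp (∑ i, (r i - 1) * ∑ l ∈ Finset.range (m + 1), p l i)
        = Real.exp (∑ i, (r i - 1) * x i) * Real.exp (∑ i, (r i - 1) * p m i) := by
      rw [← Real.exp_add, ← Finset.sum_add_distrib]
      congr 1
      exact Finset.sum_congr rfl fun i _ => by rw [Finset.sum_range_succ, mul_add]
    -- Lindeberg-type telescoping: h1 propagates the error already made, and h2 is the second-order
    -- error from replacing the m-th step of the counters by Poisson increments of means p m i.
    have h1 := step_tilt_le hr (hp m) (hp1 m) ih d
    have h2 := tilt_mul_abs_taylor_le (u := fun d s => poissonTails d fun i => x i + s * p m i)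
      (y := p m) (r := r) (B := Real.exp (∑ i, (r i - 1) * x i) * Real.exp (∑ i, (r i - 1) * p m i))
      hr0 (fun d s => hasDerivAt_poissonTails_line d x (p m) s) ?_ d
    · simp only [one_mul, zero_mul, add_zero] at h2
      rw [hx', hE, Finset.sum_range_succ, add_mul]
      have habs : ∑ i, |p m i| * (r i + 1) = ∑ i, p m i * (r i + 1) :=
        Finset.sum_congr rfl fun i _ => by rw [abs_of_nonneg (hp m i)]
      rw [habs] at h2
      have ht := tilt_pos hr0 d
      refine le_trans ?_ (add_le_add (h1.trans_eq (by ring)) (h2.trans_eq (mul_comm _ _)))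
      rw [← mul_add]
      gcongr
      simp only [counterTail]
      have hs : ∑ i, p m i * (poissonTails (lower d i) x - poissonTails d x)
          = ∑ i, p m i * poissonTails (lower d i) x - (∑ i, p m i) * poissonTails d x := by
        rw [Finset.sum_mul, ← Finset.sum_sub_distrib]
        exact Finset.sum_congr rfl fun i _ => by ring
      have hs2 : ∑ i, p m i * (counterTail p m (lower d i) - poissonTails (lower d i) x)
          = ∑ i, p m i * counterTail p m (lower d i)
            - ∑ i, p m i * poissonTails (lower d i) x := by
        rw [← Finset.sum_sub_distrib]
        exact Finset.sum_congr rfl fun i _ => by ring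
      change _ ≤ |(1 - ∑ i, p m i) * (counterTail p m d - poissonTails d x)
        + ∑ i, p m i * (counterTail p m (lower d i) - poissonTails (lower d i) x)|
        + |(poissonTails d fun i => x i + p m i) - (poissonTails d x
          + ∑ i, p m i * (poissonTails (lower d i) x - poissonTails d x))|
      rw [hs, hs2]
      refine le_trans (le_of_eq ?_) (abs_sub _ _)
      congr 1
      ring
    · intro d s hs
      have hy : ∀ i, 0 ≤ x i + s * p m i := fun i =>
        add_nonneg (hx0 i) (mul_nonneg hs.1 (hp m i))
      rw [abs_of_nonneg (poissonTails_nonneg d hy)]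
      refine (tilt_mul_poissonTails_le d hy hr).trans ?_
      rw [← Real.exp_add, ← Finset.sum_add_distrib]
      refine Real.exp_le_exp.2 (Finset.sum_le_sum fun i _ => ?_)
      rw [← mul_add]
      refine mul_le_mul_of_nonneg_left ?_ (by linarith [hr i])
      linarith [mul_le_of_le_one_left (hp m i) hs.2]

/-- Products of Poisson tails are Lipschitz in the means, even after exponential tilting. -/
lemma tilt_mul_abs_poissonTails_sub_le (hr : ∀ i, 1 ≤ r i) {x y z : ι → ℝ}
    (hx : ∀ i, 0 ≤ x i) (hy : ∀ i, 0 ≤ y i) (hxz : ∀ i, x i ≤ z i) (hyz : ∀ i, y i ≤ z i)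
    (d : ι → ℤ) :
    tilt r d * |poissonTails d y - poissonTails d x|
      ≤ Real.exp (∑ i, (r i - 1) * z i) * ∑ i, |y i - x i| * (r i + 1) := by
  have hr0 : ∀ i, 0 < r i := fun i => by linarith [hr i]
  have h := tilt_mul_abs_sub_le
    (u := fun d s => poissonTails d fun i => x i + s * (y i - x i))
    (y := fun i => y i - x i) (r := r) (B := Real.exp (∑ i, (r i - 1) * z i))
    hr0 (fun d s => hasDerivAt_poissonTails_line d x _ s) ?_ d (s := 1) (by simp)
  · simpa using h
  · intro d s hs
    have h0 : ∀ i, 0 ≤ x i + s * (y i - x i) := fun i => by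
      nlinarith [hx i, hy i, hs.1, hs.2, mul_nonneg hs.1 (hy i),
        mul_nonneg (sub_nonneg.2 hs.2) (hx i)]
    rw [abs_of_nonneg (poissonTails_nonneg d h0)]
    refine (tilt_mul_poissonTails_le d h0 hr).trans ?_
    refine Real.exp_le_exp.2 (Finset.sum_le_sum fun i _ => ?_)
    refine mul_le_mul_of_nonneg_left ?_ (by linarith [hr i])
    nlinarith [mul_nonneg hs.1 (sub_nonneg.2 (hyz i)),
        mul_nonneg (sub_nonneg.2 hs.2) (sub_nonneg.2 (hxz i))]

end Comparison

end WRT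

namespace WRT

open MeasureTheory ProbabilityTheory

/-! ### Laplace transforms of Poisson tails and Riemann sums -/

lemma norm_exp_neg_mul_mul_poissonTail_le {q : ℂ} (hq : q.re = 1) {x : ℝ} (hx : 0 ≤ x) (d : ℤ)
    {s : ℝ} (hs : 0 ≤ s) :
    ‖Complex.exp (-q * s) * (poissonTail d (x * s) : ℂ)‖ ≤ Real.exp (-s) := by
  have h0 := poissonTail_nonneg d (mul_nonneg hx hs)
  have h1 := poissonTail_le_one d (mul_nonneg hx hs)
  rw [norm_mul, Complex.norm_exp, Complex.norm_real, Real.norm_eq_abs, abs_of_nonneg h0]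
  have : (-q * (s : ℂ)).re = -s := by simp [hq]
  rw [this]
  exact mul_le_of_le_one_right (Real.exp_pos _).le h1

lemma continuous_exp_neg_mul_mul_poissonTail (q : ℂ) (x : ℝ) (d : ℤ) :
    Continuous fun s : ℝ => Complex.exp (-q * s) * (poissonTail d (x * s) : ℂ) := by
  have := continuous_poissonTail d
  fun_prop

lemma integrableOn_exp_neg_mul_mul_poissonTail {q : ℂ} (hq : q.re = 1) {x : ℝ} (hx : 0 ≤ x)
    (d : ℤ) :
    IntegrableOn (fun s : ℝ => Complex.exp (-q * s) * (poissonTail d (x * s) : ℂ))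
      (Set.Ioi 0) := by
  refine Integrable.mono' (g := fun s => Real.exp (-s)) (integrableOn_exp_neg_Ioi 0)
    (continuous_exp_neg_mul_mul_poissonTail q x d).aestronglyMeasurable ?_
  refine (ae_restrict_mem measurableSet_Ioi).mono fun s hs => ?_
  exact norm_exp_neg_mul_mul_poissonTail_le hq hx d (le_of_lt hs)

/-- The Laplace transform of a Poisson tail probability as a function of time. -/
lemma integral_exp_neg_mul_mul_poissonTail {q : ℂ} (hq : q.re = 1) {x : ℝ} (hx : 0 ≤ x) (d : ℕ) :
    ∫ s in Set.Ioi (0 : ℝ), Complex.exp (-q * s) * (poissonTail d (x * s) : ℂ)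
      = q⁻¹ * (x / (x + q)) ^ d := by
  have hq0 : q ≠ 0 := fun h => by simp [h] at hq
  have hxq : (x : ℂ) + q ≠ 0 := fun h => by
    have := congrArg Complex.re h
    simp [hq] at this
    linarith
  induction d with
  | zero =>
    have h := integral_exp_mul_complex_Ioi (a := -q) (by simp [hq]) 0
    simp only [Nat.cast_zero, poissonTail_of_nonpos le_rfl, Complex.ofReal_one, mul_one, pow_zero]
    rw [h]
    simp
  | succ d ih =>
    have hint := integrableOn_exp_neg_mul_mul_poissonTail hq hx (d : ℤ)
    have hint' := integrableOn_exp_neg_mul_mul_poissonTail hq hx ((d : ℤ) + 1)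
    set I := ∫ s in Set.Ioi (0 : ℝ), Complex.exp (-q * s) * (poissonTail (d + 1) (x * s) : ℂ)
      with hI
    have hder : ∀ s ∈ Set.Ioi (0 : ℝ),
        HasDerivAt (fun s : ℝ => Complex.exp (-q * s) * (poissonTail (d + 1) (x * s) : ℂ))
        (x * (Complex.exp (-q * s) * (poissonTail d (x * s) : ℂ))
          - (x + q) * (Complex.exp (-q * s) * (poissonTail (d + 1) (x * s) : ℂ))) s := by
      intro s _
      have h1 : HasDerivAt (fun s : ℝ => Complex.exp (-q * s)) (Complex.exp (-q * s) * (-q)) s := by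
        refine HasDerivAt.cexp ?_
        simpa using (Complex.ofRealCLM.hasDerivAt (x := s)).const_mul (-q)
      have h2 : HasDerivAt (fun s : ℝ => poissonTail ((d : ℤ) + 1) (x * s))
          ((poissonTail (d + 1 - 1) (x * s) - poissonTail (d + 1) (x * s)) * x) s := by
        refine HasDerivAt.comp (h₂ := poissonTail ((d : ℤ) + 1)) s (hasDerivAt_poissonTail _ _) ?_
        simpa using (hasDerivAt_id s).const_mul x
      convert! h1.mul h2.ofReal_comp using 1
      rw [add_sub_cancel_right]
      push_cast
      ring
    have hlim : Filter.Tendsto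
        (fun s : ℝ => Complex.exp (-q * s) * (poissonTail (d + 1) (x * s) : ℂ)) Filter.atTop
        (nhds 0) := by
      refine squeeze_zero_norm' (a := fun s => Real.exp (-s)) ?_ Real.tendsto_exp_neg_atTop_nhds_zero
      filter_upwards [Filter.eventually_ge_atTop 0] with s hs
      exact norm_exp_neg_mul_mul_poissonTail_le hq hx _ hs
    -- Integrating the derivative over the half line, with both boundary values zero, gives x I_d =
    -- (x + q) I_{d+1}, the recursion that produces the power.
    have key := integral_Ioi_of_hasDerivAt_of_tendsto
      (continuous_exp_neg_mul_mul_poissonTail q x ((d : ℤ) + 1)).continuousWithinAt hder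
      ((hint.const_mul (x : ℂ)).sub (hint'.const_mul ((x : ℂ) + q))) hlim
    rw [integral_sub (hint.const_mul (x : ℂ)) (hint'.const_mul ((x : ℂ) + q)),
      integral_const_mul, integral_const_mul, ih, ← hI] at key
    rw [mul_zero, poissonTail_zero_right (by omega), Complex.ofReal_zero, mul_zero, sub_zero,
      sub_eq_zero] at key
    push_cast
    rw [← hI]
    rw [pow_succ]
    field_simp
    calc I * q * (x + q) = q * ((x + q) * I) := by ring
      _ = _ := by rw [← key]; field_simp

/-- The damped oscillating Poisson tail is Lipschitz, even after exponential tilting. -/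
lemma zpow_mul_norm_exp_mul_poissonTail_sub_le {θ x : ℝ} (hθ : 1 < θ) (hx : 0 ≤ x)
    (hx1 : (θ - 1) * x ≤ 1) (d : ℤ) (τ : ℝ) {s t : ℝ} (hs : 0 ≤ s) (hst : s ≤ t) :
    θ ^ d * ‖Complex.exp (τ * t * Complex.I) * (poissonTail d (x * t) : ℂ)
        - Complex.exp (τ * s * Complex.I) * (poissonTail d (x * s) : ℂ)‖
      ≤ (|τ| + x * (θ + 1)) * Real.exp t * (t - s) := by
  have hθ0 : 0 < θ := by linarith
  have hz : 0 < θ ^ d := zpow_pos hθ0 _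
  -- The condition (θ - 1) x ≤ 1 makes tilting by θ cost at most exp(y), which the density exp(-y)
  -- of the Laplace integral compensates.
  have hbound : ∀ (e : ℤ) (y : ℝ), 0 ≤ y → θ ^ e * poissonTail e (x * y) ≤ Real.exp y := by
    intro e y hy
    refine (zpow_mul_poissonTail_le e (mul_nonneg hx hy) hθ.le).trans (Real.exp_le_exp.2 ?_)
    nlinarith
  have h := Convex.norm_image_sub_le_of_norm_hasDerivWithin_le
    (f := fun s : ℝ => Complex.exp (τ * s * Complex.I) * (poissonTail d (x * s) : ℂ))
    (f' := fun s : ℝ => Complex.exp (τ * s * Complex.I) * (τ * Complex.I)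
        * (poissonTail d (x * s) : ℂ) + Complex.exp (τ * s * Complex.I)
        * (((poissonTail (d - 1) (x * s) - poissonTail d (x * s)) * x : ℝ) : ℂ))
    (s := Set.Icc s t) (C := (|τ| + x * (θ + 1)) * Real.exp t / θ ^ d) (x := s) (y := t)
    (fun y _ => HasDerivAt.hasDerivWithinAt ?_) (fun y hy => ?_) (convex_Icc s t)
    (Set.left_mem_Icc.2 hst) (Set.right_mem_Icc.2 hst)
  · rw [Real.norm_eq_abs, abs_of_nonneg (by linarith : 0 ≤ t - s)] at h
    calc _ ≤ θ ^ d * ((|τ| + x * (θ + 1)) * Real.exp t / θ ^ d * (t - s)) := by gcongr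
      _ = _ := by field_simp
  · refine HasDerivAt.mul ?_ (HasDerivAt.ofReal_comp ?_)
    · refine HasDerivAt.cexp ?_
      simpa using ((Complex.ofRealCLM.hasDerivAt (x := y)).const_mul (τ : ℂ)).mul_const Complex.I
    · refine HasDerivAt.comp (h₂ := poissonTail d) y (hasDerivAt_poissonTail _ _) ?_
      simpa using (hasDerivAt_id y).const_mul x
  · have hy0 : 0 ≤ y := hs.trans hy.1
    have hxy := mul_nonneg hx hy0
    have hg0 := poissonTail_nonneg d hxy
    have hg1 := poissonTail_nonneg (d - 1) hxy
    have hnorm : ‖Complex.exp (τ * y * Complex.I)‖ = 1 := by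
      rw [← Complex.ofReal_mul]; exact Complex.norm_exp_ofReal_mul_I _
    have hsplit : θ ^ d = θ * θ ^ (d - 1) := by
      rw [← zpow_one_add₀ hθ0.ne']; congr 1; ring
    have h1 := hbound d y hy0
    have h2 := hbound (d - 1) y hy0
    have hey : Real.exp y ≤ Real.exp t := Real.exp_le_exp.2 hy.2
    rw [le_div_iff₀ hz]
    calc _ ≤ (|τ| * poissonTail d (x * y)
          + (poissonTail (d - 1) (x * y) + poissonTail d (x * y)) * x) * θ ^ d := by
          gcongr
          refine (norm_add_le _ _).trans (add_le_add (le_of_eq ?_) ?_)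
          · simp only [norm_mul, hnorm, Complex.norm_real, Complex.norm_I, Real.norm_eq_abs,
              abs_of_nonneg hg0]
            ring
          · rw [norm_mul, hnorm, one_mul, Complex.norm_real, Real.norm_eq_abs, abs_mul,
              abs_of_nonneg hx]
            gcongr
            exact (abs_sub _ _).trans_eq (by rw [abs_of_nonneg hg0, abs_of_nonneg hg1])
      _ = |τ| * (θ ^ d * poissonTail d (x * y))
          + x * (θ * (θ ^ (d - 1) * poissonTail (d - 1) (x * y))
            + θ ^ d * poissonTail d (x * y)) := by
          have h3 : θ ^ d * poissonTail (d - 1) (x * y)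
              = θ * (θ ^ (d - 1) * poissonTail (d - 1) (x * y)) := by rw [hsplit]; ring
          rw [← h3]
          ring
      _ ≤ |τ| * Real.exp t + x * (θ * Real.exp t + Real.exp t) := by
          gcongr
          · exact h1.trans hey
          · exact h2.trans hey
          · exact h1.trans hey
      _ = _ := by ring


lemma sum_Ico_inv_sq_le {N : ℕ} (hN : 1 ≤ N) (n : ℕ) :
    ∑ j ∈ Finset.Ico N n, ((j : ℝ) ^ 2)⁻¹ ≤ 2 / N := by
  obtain ⟨m, rfl⟩ : ∃ m, N = m + 1 := ⟨N - 1, by omega⟩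
  have h := sum_Ioo_inv_sq_le (α := ℝ) m n
  have h2 : Finset.Ioo m n = Finset.Ico (m + 1) n := by ext; simp
  rw [h2] at h
  exact_mod_cast h

lemma log_div_sub_log_div_succ {n j : ℕ} (hn : 1 ≤ n) (hj : 1 ≤ j) :
    Real.log (n / j) - Real.log (n / (j + 1 : ℕ)) = Real.log ((j + 1) / j) := by
  have hn' : (n : ℝ) ≠ 0 := by positivity
  have hj' : (j : ℝ) ≠ 0 := by positivity
  have hj'' : (j : ℝ) + 1 ≠ 0 := by positivity
  push_cast
  rw [Real.log_div hn' hj', Real.log_div hn' hj'', Real.log_div hj'' hj']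
  ring

lemma log_succ_div_le {j : ℕ} (hj : 1 ≤ j) : Real.log (((j : ℝ) + 1) / j) ≤ 1 / j := by
  have hj' : (0 : ℝ) < j := by positivity
  refine (Real.log_le_sub_one_of_pos (by positivity)).trans (le_of_eq ?_)
  field_simp
  ring

/-- The error of one cell of the Riemann sum. -/
lemma zpow_mul_norm_cell_le {θ x : ℝ} (hθ : 1 < θ) (hx : 0 ≤ x) (hx1 : (θ - 1) * x ≤ 1) (d : ℤ)
    (τ : ℝ) {n j : ℕ} (hj : 1 ≤ j) (hjn : j < n) :
    θ ^ d * ‖(n : ℂ)⁻¹ * (Complex.exp (τ * Real.log (n / j) * Complex.I)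
          * (poissonTail d (x * Real.log (n / j)) : ℂ))
        - ∫ s in Real.log (n / (j + 1 : ℕ))..Real.log (n / j),
          Complex.exp (-(1 - τ * Complex.I) * s) * (poissonTail d (x * s) : ℂ)‖
      ≤ 2 * (|τ| + x * (θ + 1)) * ((j : ℝ) ^ 2)⁻¹ := by
  have hθ0 : 0 < θ := by linarith
  have hz : 0 < θ ^ d := zpow_pos hθ0 _
  have hn0 : (0 : ℝ) < n := by exact_mod_cast (by omega : 0 < n)
  have hj0 : (0 : ℝ) < j := by exact_mod_cast hj
  have hj1 : (0 : ℝ) < ((j + 1 : ℕ) : ℝ) := by positivity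
  set t := Real.log (n / j) with ht
  set b := Real.log (n / (j + 1 : ℕ)) with hb
  set u : ℝ → ℂ := fun s => Complex.exp (τ * s * Complex.I) * (poissonTail d (x * s) : ℂ) with hu
  have hucont : Continuous u := by
    have := continuous_poissonTail d
    fun_prop
  have hlen : t - b ≤ 1 / j := by
    rw [ht, hb, log_div_sub_log_div_succ (by omega) hj]; exact log_succ_div_le hj
  have hbt : b ≤ t := by
    refine Real.log_le_log (by positivity) ?_
    gcongr
    omega
  have hb0 : 0 ≤ b := by
    refine Real.log_nonneg ?_
    rw [le_div_iff₀ hj1, one_mul]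
    exact_mod_cast hjn
  have hexpt : Real.exp t = n / j := Real.exp_log (by positivity)
  -- The cell between log(n/(j+1)) and log(n/j) has exponential mass (j+1)/n - j/n, exactly the
  -- weight of one label. Only the oscillation of u within the cell contributes to the error.
  have hmass : ∫ s in b..t, Complex.exp (-(s : ℂ)) = (n : ℂ)⁻¹ := by
    have h1 : ∫ s in b..t, Real.exp (-s) = (n : ℝ)⁻¹ := by
      rw [intervalIntegral.integral_comp_neg (fun s => Real.exp s), integral_exp, Real.exp_neg,
        Real.exp_neg, hexpt, hb, Real.exp_log (by positivity)]
      push_cast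
      field_simp
      ring
    have h2 := congrArg (fun y : ℝ => (y : ℂ)) h1
    simp only [← intervalIntegral.integral_ofReal] at h2
    simpa using h2
  have hdiff : (n : ℂ)⁻¹ * u t - ∫ s in b..t,
        Complex.exp (-(1 - τ * Complex.I) * s) * (poissonTail d (x * s) : ℂ)
      = ∫ s in b..t, Complex.exp (-(s : ℂ)) * (u t - u s) := by
    rw [← hmass, ← intervalIntegral.integral_mul_const, ← intervalIntegral.integral_sub]
    · refine intervalIntegral.integral_congr fun s _ => ?_
      simp only [hu]
      have : Complex.exp (-(1 - τ * Complex.I) * s)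
          = Complex.exp (-(s : ℂ)) * Complex.exp (τ * s * Complex.I) := by
        rw [← Complex.exp_add]; congr 1; ring
      rw [this]
      ring
    · exact Continuous.intervalIntegrable (by fun_prop) _ _
    · exact (continuous_exp_neg_mul_mul_poissonTail _ x d).intervalIntegrable _ _
  have hK : 0 ≤ |τ| + x * (θ + 1) := by positivity
  rw [hdiff]
  have hle := intervalIntegral.norm_integral_le_of_norm_le_const (a := b) (b := t)
    (f := fun s : ℝ => Complex.exp (-(s : ℂ)) * (u t - u s))
    (C := ((j : ℝ) + 1) / n * ((|τ| + x * (θ + 1)) * (n / j) * (1 / j) / θ ^ d)) ?_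
  · calc _ ≤ θ ^ d * (((j : ℝ) + 1) / n * ((|τ| + x * (θ + 1)) * (n / j) * (1 / j) / θ ^ d)
          * |t - b|) := by gcongr
      _ ≤ θ ^ d * (((j : ℝ) + 1) / n * ((|τ| + x * (θ + 1)) * (n / j) * (1 / j) / θ ^ d)
          * (1 / j)) := by
          rw [abs_of_nonneg (by linarith : 0 ≤ t - b)]
          gcongr
      _ = (|τ| + x * (θ + 1)) * ((j : ℝ) ^ 2)⁻¹ * ((j + 1) / j) := by field_simp
      _ ≤ (|τ| + x * (θ + 1)) * ((j : ℝ) ^ 2)⁻¹ * 2 := by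
          gcongr
          rw [div_le_iff₀ hj0]
          have : (1 : ℝ) ≤ j := by exact_mod_cast hj
          linarith
      _ = _ := by ring
  · intro s hs
    rw [Set.uIoc_of_le hbt] at hs
    have h1 := zpow_mul_norm_exp_mul_poissonTail_sub_le hθ hx hx1 d τ (hb0.trans hs.1.le) hs.2
    rw [norm_mul]
    gcongr
    · rw [Complex.norm_exp]
      simp only [Complex.neg_re, Complex.ofReal_re]
      calc Real.exp (-s) ≤ Real.exp (-b) := Real.exp_le_exp.2 (by linarith [hs.1])
        _ = ((j : ℝ) + 1) / n := by
          rw [Real.exp_neg, hb, Real.exp_log (by positivity)]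
          push_cast
          rw [inv_div]
    · rw [le_div_iff₀ hz, mul_comm]
      refine h1.trans ?_
      rw [hexpt]
      gcongr
      linarith [hs.1]

/-- The Riemann sum of the damped oscillating Poisson tail is close to the Laplace transform. -/
lemma zpow_mul_norm_riemannSum_sub_le {θ r x : ℝ} (hθ : 1 < θ) (hr : 1 ≤ r) (hrθ : r < θ)
    (hx : 0 ≤ x) (hx1 : (θ - 1) * x ≤ 1) {d : ℕ} (hd : 1 ≤ d) (τ : ℝ) {n N : ℕ} (hN : 1 ≤ N)
    (hNn : N ≤ n) :
    θ ^ d * ‖(n : ℂ)⁻¹ * ∑ j ∈ Finset.Icc N n, Complex.exp (τ * Real.log (n / j) * Complex.I)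
          * (poissonTail d (x * Real.log (n / j)) : ℂ)
        - (1 - τ * Complex.I)⁻¹ * (x / (x + (1 - τ * Complex.I))) ^ d‖
      ≤ 2 * (|τ| + x * (θ + 1)) * (2 / N)
        + (θ / r) ^ d * (Real.exp (-((θ - r) / (θ - 1)) * Real.log (n / N))
          / ((θ - r) / (θ - 1))) := by
  have hθ0 : 0 < θ := by linarith
  have hn : 1 ≤ n := hN.trans hNn
  have hn0 : (0 : ℝ) < n := by exact_mod_cast hn
  have hN0 : (0 : ℝ) < N := by exact_mod_cast hN
  set q : ℂ := 1 - τ * Complex.I with hq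
  have hqre : q.re = 1 := by simp [hq]
  set f : ℝ → ℂ := fun s => Complex.exp (-q * s) * (poissonTail d (x * s) : ℂ) with hf
  have hfc : Continuous f := continuous_exp_neg_mul_mul_poissonTail q x d
  set S := Real.log (n / N) with hS
  have hS0 : 0 ≤ S := Real.log_nonneg (by
    rw [le_div_iff₀ hN0, one_mul]; exact_mod_cast hNn)
  set c : ℕ → ℂ := fun j => Complex.exp (τ * Real.log (n / j) * Complex.I)
          * (poissonTail d (x * Real.log (n / j)) : ℂ) with hc
  -- The label n carries no cell. Its term vanishes because a Poisson variable of mean zero does not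
  -- reach d ≥ 1.
  have hcn : c n = 0 := by
    simp only [hc, div_self hn0.ne', Real.log_one, mul_zero]
    rw [poissonTail_zero_right (by omega)]
    simp
  have hint : ∫ s in Set.Ioi (0 : ℝ), f s = (∫ s in (0 : ℝ)..S, f s) + ∫ s in Set.Ioi S, f s := by
    have hi := integrableOn_exp_neg_mul_mul_poissonTail hqre hx (d : ℤ)
    rw [intervalIntegral.integral_of_le hS0, ← setIntegral_union Set.Ioc_disjoint_Ioi_same
      measurableSet_Ioi (hi.mono_set Set.Ioc_subset_Ioi_self)
      (hi.mono_set (Set.Ioi_subset_Ioi hS0)), Set.Ioc_union_Ioi_eq_Ioi hS0]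
  have hlap : q⁻¹ * (x / (x + q)) ^ d = ∫ s in Set.Ioi (0 : ℝ), f s :=
    (integral_exp_neg_mul_mul_poissonTail hqre hx d).symm
  have hadj : ∫ s in (0 : ℝ)..S, f s
      = ∑ j ∈ Finset.Ico N n, ∫ s in Real.log (n / (j + 1 : ℕ))..Real.log (n / j), f s := by
    have h := intervalIntegral.sum_integral_adjacent_intervals_Ico (f := f) (μ := volume)
      (a := fun j : ℕ => Real.log (n / j)) hNn (fun k _ => hfc.intervalIntegrable _ _)
    rw [div_self hn0.ne', Real.log_one, intervalIntegral.integral_symm] at h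
    rw [← neg_eq_iff_eq_neg.2 h.symm.symm, ← Finset.sum_neg_distrib]
    exact Finset.sum_congr rfl fun j _ => by rw [← intervalIntegral.integral_symm]
  have hsum : ∑ j ∈ Finset.Icc N n, c j = ∑ j ∈ Finset.Ico N n, c j := by
    rw [← Finset.Ico_add_one_right_eq_Icc, Finset.sum_Ico_succ_top hNn, hcn, add_zero]
  have hz : 0 < θ ^ d := by positivity
  -- Beyond log(n/N) the tilt θ leaves no decay to integrate. With the smaller tilt r, the integrand
  -- decays at rate at least 1 - (r - 1) x ≥ β, at the price of the factor (θ / r)^d.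
  have hβ : 0 < (θ - r) / (θ - 1) := div_pos (by linarith) (by linarith)
  set β := (θ - r) / (θ - 1) with hβdef
  have htail : θ ^ d * ‖∫ s in Set.Ioi S, f s‖ ≤ (θ / r) ^ d * (Real.exp (-β * S) / β) := by
    have hr0 : 0 < r := by linarith
    have hbound : ‖∫ s in Set.Ioi S, f s‖ ≤ ∫ s in Set.Ioi S, (r ^ d)⁻¹ * Real.exp (-β * s) := by
      refine norm_integral_le_of_norm_le ((integrableOn_exp_mul_Ioi (by linarith) S).const_mul _) ?_
      refine (ae_restrict_mem measurableSet_Ioi).mono fun s hs => ?_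
      have hs0 : 0 ≤ s := hS0.trans (le_of_lt hs)
      have hxs := mul_nonneg hx hs0
      have hg := zpow_mul_poissonTail_le (d : ℤ) hxs hr
      rw [zpow_natCast] at hg
      have hg' : poissonTail d (x * s) ≤ (r ^ d)⁻¹ * Real.exp ((r - 1) * (x * s)) := by
        rw [inv_mul_eq_div, le_div_iff₀ (by positivity), mul_comm]
        exact hg
      have hre : (-q * (s : ℂ)).re = -s := by simp [hqre]
      rw [hf, norm_mul, Complex.norm_exp, Complex.norm_real, Real.norm_eq_abs,
        abs_of_nonneg (poissonTail_nonneg _ hxs), hre]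
      calc Real.exp (-s) * poissonTail d (x * s)
          ≤ Real.exp (-s) * ((r ^ d)⁻¹ * Real.exp ((r - 1) * (x * s))) := by gcongr
        _ = (r ^ d)⁻¹ * Real.exp (-s + (r - 1) * (x * s)) := by rw [Real.exp_add]; ring
        _ ≤ (r ^ d)⁻¹ * Real.exp (-β * s) := by
          gcongr
          have h1 : (r - 1) * x ≤ 1 - β := by
            rw [hβdef]
            have : 1 - (θ - r) / (θ - 1) = (r - 1) / (θ - 1) := by
              field_simp [(by linarith : θ - 1 ≠ 0)]; ring
            rw [this, le_div_iff₀ (by linarith)]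
            nlinarith
          nlinarith
    rw [integral_const_mul, integral_exp_mul_Ioi (by linarith)] at hbound
    calc θ ^ d * ‖∫ s in Set.Ioi S, f s‖
        ≤ θ ^ d * ((r ^ d)⁻¹ * (-Real.exp (-β * S) / -β)) := by gcongr
      _ = _ := by rw [div_pow, neg_div_neg_eq]; ring
  rw [hlap, hint, hadj, hsum, Finset.mul_sum, ← sub_sub, ← Finset.sum_sub_distrib]
  calc _ ≤ θ ^ d * (∑ j ∈ Finset.Ico N n, ‖(n : ℂ)⁻¹ * c j
          - ∫ s in Real.log (n / (j + 1 : ℕ))..Real.log (n / j), f s‖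
        + ‖∫ s in Set.Ioi S, f s‖) := by
        gcongr
        exact (norm_sub_le _ _).trans (add_le_add_left (norm_sum_le _ _) _)
    _ ≤ ∑ j ∈ Finset.Ico N n, 2 * (|τ| + x * (θ + 1)) * ((j : ℝ) ^ 2)⁻¹
        + (θ / r) ^ d * (Real.exp (-β * S) / β) := by
        rw [mul_add, Finset.mul_sum]
        refine add_le_add (Finset.sum_le_sum fun j hj => ?_) htail
        rw [Finset.mem_Ico] at hj
        have h := zpow_mul_norm_cell_le hθ hx hx1 (d : ℤ) τ (hN.trans hj.1) hj.2
        rw [zpow_natCast] at h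
        exact h
    _ ≤ _ := by
        rw [← Finset.mul_sum]
        have := sum_Ico_inv_sq_le hN n
        gcongr

end WRT

namespace WRT

open MeasureTheory ProbabilityTheory

/-! ### The degrees as counters -/

section Structure

variable {Ω : Type*} {W : ℕ → Ω → ℝ} {parent : ℕ → Ω → ℕ}

/-- The σ-algebra generated by the weights. -/
abbrev weightSigma (W : ℕ → Ω → ℝ) : MeasurableSpace Ω :=
  ⨆ i : ℕ, MeasurableSpace.comap (W (i + 1)) inferInstance

/-- The probability that vertex `m + 1` connects to vertex `j i`, given the weights. -/
noncomputable def attachProb {ι : Type*} (W : ℕ → Ω → ℝ) (j : ι → ℕ) (ω : Ω) (m : ℕ) (i : ι) : ℝ :=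
  if j i ≤ m then W (j i) ω / totalWeight W m ω else 0

/-- The event that each vertex `j i` has in-degree at least `d i` in the tree on `1, ..., n`. -/
def tailEvent {ι : Type*} (parent : ℕ → Ω → ℕ) (n : ℕ) (j : ι → ℕ) (d : ι → ℤ) : Set Ω :=
  {ω | ∀ i, d i ≤ (inDegree parent n (j i) ω : ℤ)}

lemma measurable_weight_weightSigma {i : ℕ} (hi : 1 ≤ i) : Measurable[weightSigma W] (W i) := by
  obtain ⟨m, rfl⟩ : ∃ m, i = m + 1 := ⟨i - 1, by omega⟩
  exact Measurable.mono (comap_measurable (W (m + 1)))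
    (le_iSup (fun i : ℕ => MeasurableSpace.comap (W (i + 1)) inferInstance) m) le_rfl

lemma measurable_totalWeight_weightSigma (m : ℕ) :
    Measurable[weightSigma W] (totalWeight W m) :=
  Finset.measurable_fun_sum _ fun _ hi =>
    measurable_weight_weightSigma (Finset.mem_Icc.1 hi).1

lemma measurable_parent_history {n j : ℕ} (hj : j ∈ Finset.Icc 2 n) :
    Measurable[history W parent n] (parent j) :=
  Measurable.mono (comap_measurable (parent j))
    (le_sup_of_le_right (le_iSup₂ (f := fun (j : ℕ) (_ : j ∈ Finset.Icc 2 n) =>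
      MeasurableSpace.comap (parent j) inferInstance) j hj)) le_rfl

lemma mul_le_totalWeight {w : ℝ} {ω : Ω} (h : ∀ i, 1 ≤ i → W i ω ∈ Set.Icc w 1) (m : ℕ) :
    w * m ≤ totalWeight W m ω := by
  have := Finset.card_nsmul_le_sum (Finset.Icc 1 m) (fun i => W i ω) w
    fun i hi => (h i (Finset.mem_Icc.1 hi).1).1
  rw [Nat.card_Icc, nsmul_eq_mul, Nat.add_sub_cancel] at this
  rw [totalWeight]
  linarith

lemma totalWeight_pos {w : ℝ} (hw : 0 < w) {ω : Ω} (h : ∀ i, 1 ≤ i → W i ω ∈ Set.Icc w 1) {m : ℕ}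
    (hm : 1 ≤ m) : 0 < totalWeight W m ω := by
  have : (0 : ℝ) < m := by exact_mod_cast hm
  exact lt_of_lt_of_le (by positivity) (mul_le_totalWeight h m)

lemma inDegree_succ {m : ℕ} (hm : 1 ≤ m) (v : ℕ) (ω : Ω) :
    inDegree parent (m + 1) v ω
      = inDegree parent m v ω + if parent (m + 1) ω = v then 1 else 0 := by
  have h : Finset.Icc 2 (m + 1) = insert (m + 1) (Finset.Icc 2 m) := by
    ext; simp; omega
  simp only [inDegree, h, Finset.filter_insert]
  split_ifs with hp
  · rw [Finset.card_insert_of_notMem (by simp)]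
  · simp

lemma measurable_inDegree_history (n v : ℕ) :
    Measurable[history W parent n] (inDegree parent n v) := by
  have h : inDegree parent n v
      = fun ω => ∑ j ∈ Finset.Icc 2 n, if parent j ω = v then 1 else 0 := by
    funext ω; rw [inDegree, Finset.card_filter]
  rw [h]
  refine Finset.measurable_fun_sum _ fun j hj => ?_
  exact Measurable.ite (measurable_parent_history hj (measurableSet_singleton v))
    measurable_const measurable_const

lemma measurableSet_tailEvent_history {ι : Type*} [Countable ι] (n : ℕ) (j : ι → ℕ) (d : ι → ℤ) :
    MeasurableSet[history W parent n] (tailEvent parent n j d) := by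
  have h : tailEvent parent n j d
      = ⋂ i, (inDegree parent n (j i)) ⁻¹' {z : ℕ | d i ≤ (z : ℤ)} := by
    ext ω; simp [tailEvent]
  rw [h]
  exact MeasurableSet.iInter fun i => measurable_inDegree_history n (j i) (by measurability)

lemma weight_div_totalWeight_mem_Icc {w : ℝ} (hw : 0 < w) {ω : Ω}
    (h : ∀ i, 1 ≤ i → W i ω ∈ Set.Icc w 1) {v m : ℕ} (hv : v ∈ Finset.Icc 1 m) :
    W v ω / totalWeight W m ω ∈ Set.Icc 0 1 := by
  rw [Finset.mem_Icc] at hv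
  have hpos := totalWeight_pos hw h (hv.1.trans hv.2)
  refine ⟨div_nonneg (hw.le.trans (h v hv.1).1) hpos.le, (div_le_one hpos).2 ?_⟩
  exact Finset.single_le_sum (f := fun i => W i ω)
    (fun i hi => hw.le.trans (h i (Finset.mem_Icc.1 hi).1).1) (Finset.mem_Icc.2 hv)

variable {ι : Type*} {j : ι → ℕ}

lemma measurable_attachProb (hj : ∀ i, 1 ≤ j i) (m : ℕ) (i : ι) :
    Measurable[weightSigma W] fun ω => attachProb W j ω m i := by
  unfold attachProb
  split_ifs
  · exact (measurable_weight_weightSigma (hj i)).div (measurable_totalWeight_weightSigma m)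
  · exact measurable_const

lemma attachProb_mem_Icc (hj : ∀ i, 1 ≤ j i) {w : ℝ} (hw : 0 < w) {ω : Ω}
    (h : ∀ i, 1 ≤ i → W i ω ∈ Set.Icc w 1) (m : ℕ) (i : ι) :
    attachProb W j ω m i ∈ Set.Icc 0 1 := by
  unfold attachProb
  split_ifs with hji
  · exact weight_div_totalWeight_mem_Icc hw h (Finset.mem_Icc.2 ⟨hj i, hji⟩)
  · simp

variable [Fintype ι]

lemma sum_attachProb_le_one (hj : ∀ i, 1 ≤ j i) (hinj : Function.Injective j) {w : ℝ} (hw : 0 < w)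
    {ω : Ω} (h : ∀ i, 1 ≤ i → W i ω ∈ Set.Icc w 1) (m : ℕ) :
    ∑ i, attachProb W j ω m i ≤ 1 := by
  rcases Nat.eq_zero_or_pos m with rfl | hm
  · have h0 : ∀ i, attachProb W j ω 0 i = 0 := fun i => by
      have := hj i
      simp [attachProb, show ¬ j i ≤ 0 by omega]
    simp [h0]
  · have hpos := totalWeight_pos hw h hm
    classical
    have h1 : ∑ i, attachProb W j ω m i
        = ∑ v ∈ (Finset.univ.filter fun i => j i ≤ m).image j, W v ω / totalWeight W m ω := by
      rw [Finset.sum_image (fun a _ b _ hab => hinj hab), Finset.sum_filter]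
      rfl
    rw [h1, ← Finset.sum_div, div_le_one hpos]
    refine Finset.sum_le_sum_of_subset_of_nonneg ?_ fun i hi _ =>
      hw.le.trans (h i (Finset.mem_Icc.1 hi).1).1
    intro v hv
    simp only [Finset.mem_image, Finset.mem_filter, Finset.mem_univ, true_and] at hv
    obtain ⟨i, hi, rfl⟩ := hv
    exact Finset.mem_Icc.2 ⟨hj i, hi⟩

variable [DecidableEq ι]

/-- The new vertex has one parent and the labels j i are distinct, so at most one of the degrees
rises, by one. Attaching to j i amounts to lowering the i-th threshold beforehand. -/
lemma indicator_tailEvent_succ (hinj : Function.Injective j) {m : ℕ} (hm : 1 ≤ m) (d : ι → ℤ)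
    (ω : Ω) :
    (tailEvent parent (m + 1) j d).indicator (fun _ => (1 : ℝ)) ω
      = (tailEvent parent m j d).indicator (fun _ => (1 : ℝ)) ω
        + ∑ i, Set.indicator {ω | parent (m + 1) ω = j i} (fun _ => (1 : ℝ)) ω
          * ((tailEvent parent m j (lower d i)).indicator (fun _ => (1 : ℝ)) ω
            - (tailEvent parent m j d).indicator (fun _ => (1 : ℝ)) ω) := by
  by_cases hex : ∃ i, parent (m + 1) ω = j i
  · obtain ⟨i₀, hi₀⟩ := hex
    rw [Finset.sum_eq_single i₀]
    · have h1 : ω ∈ {ω | parent (m + 1) ω = j i₀} := hi₀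
      rw [Set.indicator_of_mem h1, one_mul, add_sub_cancel]
      have h2 : ω ∈ tailEvent parent (m + 1) j d ↔ ω ∈ tailEvent parent m j (lower d i₀) := by
        refine forall_congr' fun i => ?_
        rw [inDegree_succ hm, hi₀]
        by_cases hi : i = i₀
        · subst hi
          simp [lower]
        · have : j i₀ ≠ j i := fun h => hi (hinj h).symm
          simp [lower, Function.update_of_ne hi, this]
      by_cases h3 : ω ∈ tailEvent parent m j (lower d i₀)
      · rw [Set.indicator_of_mem h3, Set.indicator_of_mem (h2.2 h3)]
      · rw [Set.indicator_of_notMem h3, Set.indicator_of_notMem fun h => h3 (h2.1 h)]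
    · intro i _ hi
      have : ω ∉ {ω | parent (m + 1) ω = j i} := fun h =>
        hi (hinj (Eq.trans (Eq.symm h) hi₀))
      rw [Set.indicator_of_notMem this, zero_mul]
    · simp
  · push Not at hex
    rw [Finset.sum_eq_zero fun i _ => ?_, add_zero]
    · have h2 : ω ∈ tailEvent parent (m + 1) j d ↔ ω ∈ tailEvent parent m j d := by
        refine forall_congr' fun i => ?_
        rw [inDegree_succ hm, if_neg (hex i), add_zero]
      classical
      simp only [Set.indicator_apply, h2]
    · have : ω ∉ {ω | parent (m + 1) ω = j i} := hex i
      rw [Set.indicator_of_notMem this, zero_mul]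

end Structure

variable {Ω : Type*} [mΩ : MeasurableSpace Ω] {μ : Measure Ω} {W : ℕ → Ω → ℝ}
  {parent : ℕ → Ω → ℕ}

/-! ### The weights -/

lemma ae_le_one_of_weightAssumption [IsProbabilityMeasure μ] {X : Ω → ℝ} (hXm : Measurable X)
    (hX : WeightAssumption μ X) : ∀ᵐ ω ∂μ, X ω ≤ 1 := by
  have h : ∀ m : ℕ, ∀ᵐ ω ∂μ, X ω ≤ 1 + 1 / ((m : ℝ) + 1) := by
    intro m
    have hpos : (0 : ℝ) < 1 / ((m : ℝ) + 1) := by positivity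
    have hnot : ¬ μ {ω | X ω ≤ 1 + 1 / ((m : ℝ) + 1)} < 1 := fun hlt => by
      have := hX.sup_eq_one.1 hlt
      linarith
    have h1 : μ {ω | X ω ≤ 1 + 1 / ((m : ℝ) + 1)} = 1 := le_antisymm prob_le_one (not_lt.1 hnot)
    exact (prob_compl_eq_zero_iff (measurableSet_le hXm measurable_const)).2 h1
  filter_upwards [ae_all_iff.2 h] with ω hω
  refine le_of_tendsto_of_tendsto tendsto_const_nhds
    (by simpa using tendsto_one_div_add_atTop_nhds_zero_nat.const_add (1 : ℝ))
    (Filter.Eventually.of_forall hω)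

lemma exists_ae_weight_mem_Icc [IsProbabilityMeasure μ] (hT : IsWeightedRecursiveTree μ W parent)
    (hW : WeightAssumption μ (W 1)) :
    ∃ w : ℝ, 0 < w ∧ w < 1 ∧ ∀ᵐ ω ∂μ, ∀ i, 1 ≤ i → W i ω ∈ Set.Icc w 1 := by
  obtain ⟨w, hw0, hw1, hw⟩ := hW.bounded_below
  refine ⟨w, hw0, hw1, ae_all_iff.2 fun i => ?_⟩
  by_cases hi : 1 ≤ i
  · have h1 : ∀ᵐ ω ∂μ, W 1 ω ∈ Set.Icc w 1 := by
      filter_upwards [hw, ae_le_one_of_weightAssumption (hT.measurable_weight 1 le_rfl) hW]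
        with ω h1 h2 using ⟨h1, h2⟩
    have h2 := (hT.identDistrib_weight i hi).symm.ae_mem_snd measurableSet_Icc h1
    filter_upwards [h2] with ω hω _ using hω
  · exact Filter.Eventually.of_forall fun ω h => absurd h hi

lemma weightSigma_le (hT : IsWeightedRecursiveTree μ W parent) : weightSigma W ≤ mΩ :=
  iSup_le fun i => (hT.measurable_weight (i + 1) (by omega)).comap_le

lemma history_le (hT : IsWeightedRecursiveTree μ W parent) (n : ℕ) : history W parent n ≤ mΩ :=
  sup_le (weightSigma_le hT) (iSup₂_le fun j hj =>
    (hT.measurable_parent j (Finset.mem_Icc.1 hj).1).comap_le)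

/-! ### Conditional laws of the degrees given the weights. -/

section Link

variable [IsProbabilityMeasure μ]

lemma integrable_of_ae_mem_Icc {f : Ω → ℝ} (hf : AEStronglyMeasurable f μ) {a b : ℝ}
    (h : ∀ᵐ ω ∂μ, f ω ∈ Set.Icc a b) : Integrable f μ := by
  refine Integrable.of_bound hf (max |a| |b|) (h.mono fun ω hω => ?_)
  exact abs_le_max_abs_abs hω.1 hω.2

/-- The model only prescribes the attachment probabilities to 1, ..., m. These add up to one, which
leaves no mass for any other value of the parent. -/
lemma ae_parent_mem_Icc (hT : IsWeightedRecursiveTree μ W parent) (hW : WeightAssumption μ (W 1))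
    {m : ℕ} (hm : 1 ≤ m) : ∀ᵐ ω ∂μ, parent (m + 1) ω ∈ Finset.Icc 1 m := by
  obtain ⟨w, hw0, -, hw⟩ := exists_ae_weight_mem_Icc hT hW
  have hms : ∀ i, MeasurableSet {ω | parent (m + 1) ω = i} := fun i =>
    hT.measurable_parent (m + 1) (by omega) (measurableSet_singleton i)
  have hmS : MeasurableSet {ω | parent (m + 1) ω ∈ Finset.Icc 1 m} :=
    hT.measurable_parent (m + 1) (by omega) (Finset.measurableSet _)
  have hfun : Set.indicator {ω | parent (m + 1) ω ∈ Finset.Icc 1 m} (fun _ => (1 : ℝ))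
      = fun ω => ∑ i ∈ Finset.Icc 1 m,
        Set.indicator {ω | parent (m + 1) ω = i} (fun _ => (1 : ℝ)) ω := by
    funext ω
    simp [Set.indicator_apply, Finset.sum_ite_eq]
  have h1 : μ.real {ω | parent (m + 1) ω ∈ Finset.Icc 1 m} = 1 := by
    have hi : ∫ ω, Set.indicator {ω | parent (m + 1) ω ∈ Finset.Icc 1 m} (fun _ => (1 : ℝ)) ω ∂μ
        = μ.real {ω | parent (m + 1) ω ∈ Finset.Icc 1 m} := by
      rw [integral_indicator_const _ hmS, smul_eq_mul, mul_one]
    rw [← hi, hfun, integral_finsetSum _ fun i _ => (integrable_const 1).indicator (hms i)]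
    have h2 : ∀ i ∈ Finset.Icc 1 m,
        ∫ ω, Set.indicator {ω | parent (m + 1) ω = i} (fun _ => (1 : ℝ)) ω ∂μ
          = ∫ ω, W i ω / totalWeight W m ω ∂μ := fun i hi => by
      rw [← integral_condExp (history_le hT m)]
      exact integral_congr_ae (hT.attach m hm i hi)
    rw [Finset.sum_congr rfl h2, ← integral_finsetSum]
    · have h3 : ∫ ω, ∑ i ∈ Finset.Icc 1 m, W i ω / totalWeight W m ω ∂μ = ∫ _, (1 : ℝ) ∂μ := by
        refine integral_congr_ae (hw.mono fun ω hω => ?_)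
        have := totalWeight_pos hw0 hω hm
        simp only [← Finset.sum_div]
        exact div_self this.ne'
      rw [h3]; simp
    · intro i hi
      refine integrable_of_ae_mem_Icc (a := 0) (b := 1) ?_
        (hw.mono fun ω hω => weight_div_totalWeight_mem_Icc hw0 hω hi)
      exact (((measurable_weight_weightSigma (Finset.mem_Icc.1 hi).1).div
        (measurable_totalWeight_weightSigma m)).mono (weightSigma_le hT)
          le_rfl).aestronglyMeasurable
  have h2 : μ {ω | parent (m + 1) ω ∈ Finset.Icc 1 m} = 1 := by
    rw [measureReal_def] at h1
    rw [← ENNReal.toReal_eq_one_iff]; exact h1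
  exact (prob_compl_eq_zero_iff hmS).2 h2

variable {ι : Type*} {j : ι → ℕ}

lemma condExp_parent_eq (hT : IsWeightedRecursiveTree μ W parent) (hW : WeightAssumption μ (W 1))
    (hj : ∀ i, 1 ≤ j i) {m : ℕ} (hm : 1 ≤ m) (i : ι) :
    μ[Set.indicator {ω | parent (m + 1) ω = j i} (fun _ => (1 : ℝ)) | history W parent m]
      =ᵐ[μ] fun ω => attachProb W j ω m i := by
  by_cases hji : j i ≤ m
  · simpa only [attachProb, hji, if_true] using
      hT.attach m hm (j i) (Finset.mem_Icc.2 ⟨hj i, hji⟩)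
  · simp only [attachProb, hji, if_false]
    have h0 : Set.indicator {ω | parent (m + 1) ω = j i} (fun _ => (1 : ℝ)) =ᵐ[μ] 0 := by
      filter_upwards [ae_parent_mem_Icc hT hW hm] with ω hω
      rw [Finset.mem_Icc] at hω
      have : ω ∉ {ω | parent (m + 1) ω = j i} := fun h => hji (by
        have h' : parent (m + 1) ω = j i := h
        omega)
      simp [Set.indicator_of_notMem this]
    refine (condExp_congr_ae h0).trans ?_
    rw [condExp_zero]
    rfl

variable [Fintype ι] [DecidableEq ι]

/-- Given the weights, the tails of the degrees follow the counter recursion. -/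
theorem condExp_tailEvent_eq (hT : IsWeightedRecursiveTree μ W parent)
    (hW : WeightAssumption μ (W 1)) (hj : ∀ i, 1 ≤ j i) (hinj : Function.Injective j) (m : ℕ)
    (d : ι → ℤ) :
    μ[(tailEvent parent m j d).indicator (fun _ => (1 : ℝ)) | weightSigma W]
      =ᵐ[μ] fun ω => counterTail (attachProb W j ω) m d := by
  obtain ⟨w, hw0, -, hw⟩ := exists_ae_weight_mem_Icc hT hW
  have hmT : ∀ m d, MeasurableSet (tailEvent parent m j d) := fun m d =>
    history_le hT m _ (measurableSet_tailEvent_history m j d)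
  have hiT : ∀ m d, Integrable ((tailEvent parent m j d).indicator (fun _ => (1 : ℝ))) μ :=
    fun m d => (integrable_const 1).indicator (hmT m d)
  induction m generalizing d with
  | zero =>
    have h : (tailEvent parent 0 j d).indicator (fun _ => (1 : ℝ))
        = fun _ => if ∀ i, d i ≤ 0 then 1 else 0 := by
      funext ω
      simp [Set.indicator_apply, tailEvent, inDegree]
    rw [h, condExp_const (weightSigma_le hT)]
    rfl
  | succ m ih =>
    -- Passing from 0 to 1 adds only the root, which has no parent; all degrees and all attachment
    -- probabilities are then zero.
    rcases Nat.eq_zero_or_pos m with rfl | hm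
    · have h1 : tailEvent parent (0 + 1) j d = tailEvent parent 0 j d := by
        simp [tailEvent, inDegree]
      rw [h1]
      filter_upwards [ih d] with ω hω
      rw [hω]
      have h0 : ∀ i, attachProb W j ω 0 i = 0 := fun i => by
        have := hj i
        simp [attachProb, show ¬ j i ≤ 0 by omega]
      simp [counterTail, h0]
    have hmT' := fun d => measurableSet_tailEvent_history (W := W) (parent := parent) m j d
    have hsm : ∀ d, StronglyMeasurable[history W parent m]
        ((tailEvent parent m j d).indicator (fun _ => (1 : ℝ))) := fun d =>
      (measurable_const.indicator (hmT' d)).stronglyMeasurable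
    set T : (ι → ℤ) → Ω → ℝ := fun d => (tailEvent parent m j d).indicator (fun _ => (1 : ℝ))
      with hTdef
    set X : ι → Ω → ℝ := fun i => Set.indicator {ω | parent (m + 1) ω = j i} (fun _ => (1 : ℝ))
      with hX
    have hXi : ∀ i, Integrable (X i) μ := fun i => (integrable_const 1).indicator
      (hT.measurable_parent (m + 1) (by omega) (measurableSet_singleton _))
    have hTb : ∀ d ω, |T d ω| ≤ 1 := fun d ω => by
      classical
      simp only [hTdef, Set.indicator_apply]; split_ifs <;> simp
    have hTdb : ∀ i, ∀ ω, ‖T (lower d i) ω - T d ω‖ ≤ 2 := fun i ω =>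
      (abs_sub _ _).trans (by linarith [hTb (lower d i) ω, hTb d ω])
    have hsmd : ∀ i, StronglyMeasurable[history W parent m] (T (lower d i) - T d) := fun i =>
      (hsm _).sub (hsm _)
    have hXTi : ∀ i, Integrable (X i * (T (lower d i) - T d)) μ := fun i =>
      (hXi i).mul_bdd ((hsmd i).mono (history_le hT m)).aestronglyMeasurable
        (Filter.Eventually.of_forall (hTdb i))
    have hfun : (tailEvent parent (m + 1) j d).indicator (fun _ => (1 : ℝ))
        = T d + ∑ i, X i * (T (lower d i) - T d) := by
      funext ω
      rw [indicator_tailEvent_succ hinj hm]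
      simp [hTdef, hX]
    have hP : ∀ i, Measurable[weightSigma W] fun ω => attachProb W j ω m i :=
      measurable_attachProb hj m
    have hcond : μ[(tailEvent parent (m + 1) j d).indicator (fun _ => (1 : ℝ))
          | history W parent m]
        =ᵐ[μ] T d + ∑ i, (fun ω => attachProb W j ω m i) * (T (lower d i) - T d) := by
      rw [hfun]
      refine (condExp_add (hiT m d) (integrable_finsetSum' _ fun i _ => hXTi i) _).trans ?_
      refine Filter.EventuallyEq.add ?_ ?_
      · rw [condExp_of_stronglyMeasurable (history_le hT m) (hsm d) (hiT m d)]
      · refine (condExp_finsetSum (fun i _ => hXTi i) _).trans ?_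
        have : ∀ i, μ[X i * (T (lower d i) - T d) | history W parent m]
            =ᵐ[μ] (fun ω => attachProb W j ω m i) * (T (lower d i) - T d) := fun i =>
          (condExp_mul_of_stronglyMeasurable_right (hsmd i) (hXTi i) (hXi i)).trans
            ((condExp_parent_eq hT hW hj hm i).mul (Filter.EventuallyEq.refl _ _))
        filter_upwards [ae_all_iff.2 this] with ω hω
        simp only [Finset.sum_apply]
        exact Finset.sum_congr rfl fun i _ => hω i
    have hTdi : ∀ i, Integrable (T (lower d i) - T d) μ := fun i => (hiT m _).sub (hiT m _)
    have hPTi : ∀ i, Integrable ((fun ω => attachProb W j ω m i) * (T (lower d i) - T d)) μ :=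
      fun i => (hTdi i).bdd_mul
        ((hP i).mono (weightSigma_le hT) le_rfl).aestronglyMeasurable
        (hw.mono fun ω hω => by
          have := attachProb_mem_Icc hj hw0 hω m i
          rw [Real.norm_eq_abs, abs_of_nonneg this.1]
          exact this.2)
    -- Conditioning first on the history treats the old degrees as known and averages over the new
    -- parent. Conditioning then on the weights treats the attachment probabilities as known, so
    -- that the induction hypothesis applies.
    have htower := condExp_condExp_of_le (μ := μ)
      (f := (tailEvent parent (m + 1) j d).indicator (fun _ => (1 : ℝ)))
      (m₁ := weightSigma W) (m₂ := history W parent m) le_sup_left (history_le hT m)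
    refine htower.symm.trans ((condExp_congr_ae hcond).trans ?_)
    refine (condExp_add (hiT m d) (integrable_finsetSum' _ fun i _ => hPTi i) _).trans ?_
    have hsum := condExp_finsetSum (μ := μ) (s := Finset.univ) (fun i _ => hPTi i) (weightSigma W)
    have heach : ∀ i, μ[(fun ω => attachProb W j ω m i) * (T (lower d i) - T d) | weightSigma W]
        =ᵐ[μ] fun ω => attachProb W j ω m i * (counterTail (attachProb W j ω) m (lower d i)
          - counterTail (attachProb W j ω) m d) := fun i =>
      (condExp_mul_of_stronglyMeasurable_left (hP i).stronglyMeasurable (hPTi i)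
        (hTdi i)).trans ((Filter.EventuallyEq.refl _ _).mul
          ((condExp_sub (hiT m _) (hiT m _) _).trans ((ih (lower d i)).sub (ih d))))
    filter_upwards [hsum, ae_all_iff.2 heach, ih d] with ω h1 h2 h3
    rw [Pi.add_apply, h1, h3]
    simp only [Finset.sum_apply, counterTail]
    rw [Finset.sum_congr rfl fun i _ => h2 i]
    simp only [mul_sub, Finset.sum_sub_distrib, sub_mul, one_mul, Finset.sum_mul]
    ring

end Link

end WRT

namespace WRT

open MeasureTheory ProbabilityTheory

/-! ### Sums of reciprocals of the total weight -/

/-- The logarithm telescopes into terms log((m+1)/m), which lie between 1/(m+1) and 1/m. Each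
differs from 1/m by at most 1/m², and these errors sum to at most 2/j. -/
lemma abs_sum_Ico_inv_sub_log_le {j n : ℕ} (hj : 1 ≤ j) (hjn : j ≤ n) :
    |∑ m ∈ Finset.Ico j n, (m : ℝ)⁻¹ - Real.log (n / j)| ≤ 2 / j := by
  have hj0 : (0 : ℝ) < j := by exact_mod_cast hj
  have hlog : Real.log (n / j) = ∑ m ∈ Finset.Ico j n, Real.log (((m : ℝ) + 1) / m) := by
    induction n, hjn using Nat.le_induction with
    | base => simp [hj0.ne']
    | succ n hn ih =>
      have hn0 : (0 : ℝ) < n := by exact_mod_cast hj.trans hn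
      rw [Finset.sum_Ico_succ_top hn, ← ih, ← Real.log_mul (by positivity) (by positivity)]
      congr 1
      push_cast
      field_simp
  rw [hlog, ← Finset.sum_sub_distrib]
  refine (Finset.abs_sum_le_sum_abs _ _).trans
    ((Finset.sum_le_sum fun m hm => ?_).trans (sum_Ico_inv_sq_le hj n))
  have hm1 : 1 ≤ m := hj.trans (Finset.mem_Ico.1 hm).1
  have hm0 : (0 : ℝ) < m := by exact_mod_cast hm1
  have h1 := log_succ_div_le hm1
  have h2 := Real.one_sub_inv_le_log_of_pos (x := ((m : ℝ) + 1) / m) (by positivity)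
  rw [one_div] at h1
  rw [abs_of_nonneg (by linarith)]
  have h3 : 1 - (((m : ℝ) + 1) / m)⁻¹ = ((m : ℝ) + 1)⁻¹ := by
    field_simp
    ring
  have h4 : (m : ℝ)⁻¹ - ((m : ℝ) + 1)⁻¹ ≤ ((m : ℝ) ^ 2)⁻¹ := by
    have : (m : ℝ)⁻¹ - ((m : ℝ) + 1)⁻¹ = ((m : ℝ) * (m + 1))⁻¹ := by
      field_simp
      ring
    rw [this]
    gcongr
    nlinarith
  linarith

/-- The error in the approximation of sums of reciprocals of the total weight, up to `n` and from
`N` on, if the relative deviation of the total weight from its mean is at most `η`. -/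
noncomputable def recipError (b η : ℝ) (N n : ℕ) : ℝ :=
  2 * η / b ^ 2 * (Real.log n + 2) + 2 / (b * N)

lemma recipError_nonneg {b η : ℝ} (hb : 0 < b) (hη : 0 ≤ η) (N n : ℕ) :
    0 ≤ recipError b η N n := by
  unfold recipError
  have := Real.log_natCast_nonneg n
  positivity

/-- The bound η ≤ b/2 gives S m ≥ m b / 2, so each reciprocal is off by at most 2η / (b² m). The
harmonic sum then costs only a logarithm. -/
lemma abs_sum_inv_sub_log_div_le {S : ℕ → ℝ} {b η : ℝ} (hb : 0 < b) (hη0 : 0 ≤ η)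
    (hη : η ≤ b / 2) {N n j : ℕ} (hN : 1 ≤ N) (hNj : N ≤ j) (hjn : j ≤ n)
    (hS : ∀ m ∈ Finset.Icc N n, |S m - m * b| ≤ m * η) :
    |∑ m ∈ Finset.Ico j n, (S m)⁻¹ - Real.log (n / j) / b| ≤ recipError b η N n := by
  have hj0 : (0 : ℝ) < j := by exact_mod_cast hN.trans hNj
  have hN0 : (0 : ℝ) < N := by exact_mod_cast hN
  have hn0 : (0 : ℝ) < n := by exact_mod_cast (hN.trans hNj).trans hjn
  have hh := abs_sum_Ico_inv_sub_log_le (hN.trans hNj) hjn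
  have hterm : ∀ m ∈ Finset.Ico j n, |(S m)⁻¹ - (m : ℝ)⁻¹ / b| ≤ 2 * η / b ^ 2 * (m : ℝ)⁻¹ := by
    intro m hm
    rw [Finset.mem_Ico] at hm
    have hm0 : (0 : ℝ) < m := by exact_mod_cast (hN.trans hNj).trans hm.1
    have h1 := hS m (Finset.mem_Icc.2 ⟨hNj.trans hm.1, hm.2.le⟩)
    have h2 : m * b / 2 ≤ S m := by
      have := (abs_le.1 h1).1
      nlinarith
    have hS0 : 0 < S m := lt_of_lt_of_le (by positivity) h2
    have h3 : (S m)⁻¹ - (m : ℝ)⁻¹ / b = (m * b - S m) / (S m * (m * b)) := by field_simp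
    rw [h3, abs_div, abs_sub_comm, abs_of_pos (by positivity : 0 < S m * (m * b)),
      div_le_iff₀ (by positivity)]
    calc |S m - m * b| ≤ m * η := h1
      _ = 2 * η / b ^ 2 * (m : ℝ)⁻¹ * (m * b / 2 * (m * b)) := by field_simp
      _ ≤ 2 * η / b ^ 2 * (m : ℝ)⁻¹ * (S m * (m * b)) := by gcongr
  have hsplit : ∑ m ∈ Finset.Ico j n, (S m)⁻¹ - Real.log (n / j) / b
      = ∑ m ∈ Finset.Ico j n, ((S m)⁻¹ - (m : ℝ)⁻¹ / b)
        + (∑ m ∈ Finset.Ico j n, (m : ℝ)⁻¹ - Real.log (n / j)) / b := by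
    rw [Finset.sum_sub_distrib, ← Finset.sum_div]
    ring
  have hinvle : ∑ m ∈ Finset.Ico j n, (m : ℝ)⁻¹ ≤ Real.log n + 2 := by
    have h1 := (abs_le.1 hh).2
    have h2 : Real.log (n / j) ≤ Real.log n := by
      refine Real.log_le_log (by positivity) (div_le_self hn0.le ?_)
      exact_mod_cast hN.trans hNj
    have h3 : (2 : ℝ) / j ≤ 2 := div_le_self (by norm_num) (by exact_mod_cast hN.trans hNj)
    linarith
  rw [hsplit, recipError]
  refine (abs_add_le _ _).trans (add_le_add ?_ ?_)
  · refine (Finset.abs_sum_le_sum_abs _ _).trans ((Finset.sum_le_sum hterm).trans ?_)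
    rw [← Finset.mul_sum]
    gcongr
  · rw [abs_div, abs_of_pos hb, div_le_iff₀ hb]
    refine hh.trans ?_
    have : 2 / (b * N) * b = 2 / (N : ℝ) := by field_simp
    rw [this]
    gcongr

/-- Before N only the deterministic bound S m ≥ w m is available. It inflates the mean degree by
about log(N) / w, which is a small multiple of log n when N is a small power of n. -/
lemma sum_inv_le_of_small {S : ℕ → ℝ} {b η w : ℝ} (hb : 0 < b) (hη0 : 0 ≤ η) (hη : η ≤ b / 2)
    (hw : 0 < w) {N n j : ℕ} (hj : 1 ≤ j) (hjN : j ≤ N) (hNn : N ≤ n)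
    (hS : ∀ m ∈ Finset.Icc N n, |S m - m * b| ≤ m * η) (hSw : ∀ m : ℕ, w * m ≤ S m) :
    ∑ m ∈ Finset.Ico j n, (S m)⁻¹
      ≤ (Real.log N + 2) / w + (Real.log (n / N) / b + recipError b η N n) := by
  have hj0 : (0 : ℝ) < j := by exact_mod_cast hj
  have hN0 : (0 : ℝ) < N := by exact_mod_cast hj.trans hjN
  rw [← Finset.sum_Ico_consecutive _ hjN hNn]
  refine add_le_add ?_ ?_
  · have h1 : ∑ m ∈ Finset.Ico j N, (S m)⁻¹ ≤ ∑ m ∈ Finset.Ico j N, (m : ℝ)⁻¹ / w := by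
      refine Finset.sum_le_sum fun m hm => ?_
      have hm0 : (0 : ℝ) < m := by exact_mod_cast hj.trans (Finset.mem_Ico.1 hm).1
      rw [inv_div_left]
      gcongr
      linarith [hSw m]
    refine h1.trans ?_
    rw [← Finset.sum_div]
    gcongr
    have h2 := (abs_le.1 (abs_sum_Ico_inv_sub_log_le hj hjN)).2
    have h3 : Real.log (N / j) ≤ Real.log N :=
      Real.log_le_log (by positivity) (div_le_self hN0.le (by exact_mod_cast hj))
    have h4 : (2 : ℝ) / j ≤ 2 := div_le_self (by norm_num) (by exact_mod_cast hj)
    linarith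
  · have := (abs_le.1 (abs_sum_inv_sub_log_div_le hb hη0 hη (hj.trans hjN) le_rfl hNn hS)).2
    linarith

/-! ### Concentration of the total weight -/

variable {Ω : Type*} [mΩ : MeasurableSpace Ω] {μ : Measure Ω} {W : ℕ → Ω → ℝ}
  {parent : ℕ → Ω → ℕ}

/-- The event that the total weights of the first `m` vertices, `N ≤ m ≤ n`, deviate from their
means `m b` by at most `m η`. -/
def goodEvent (W : ℕ → Ω → ℝ) (b η : ℝ) (N n : ℕ) : Set Ω :=
  {ω | ∀ m ∈ Finset.Icc N n, |totalWeight W m ω - m * b| ≤ m * η}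

lemma measurableSet_goodEvent (hT : IsWeightedRecursiveTree μ W parent) (b η : ℝ) (N n : ℕ) :
    MeasurableSet (goodEvent W b η N n) := by
  have hm : ∀ m, Measurable (totalWeight W m) := fun m =>
    (measurable_totalWeight_weightSigma m).mono (weightSigma_le hT) le_rfl
  have h : goodEvent W b η N n
      = ⋂ m ∈ Finset.Icc N n, {ω | |totalWeight W m ω - m * b| ≤ m * η} := by
    ext ω; simp [goodEvent]
  rw [h]
  refine Finset.measurableSet_biInter _ fun m _ => ?_
  exact measurableSet_le ((hm m).sub_const _).abs measurable_const

variable [IsProbabilityMeasure μ]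

/-- Hoeffding's inequality for weights in [0, 1], whose sub-Gaussian parameter is 1/4, applied to
both signs. -/
lemma measureReal_totalWeight_deviation_le (hT : IsWeightedRecursiveTree μ W parent)
    (hW : WeightAssumption μ (W 1)) {η : ℝ} (hη : 0 ≤ η) {m : ℕ} (hm : 1 ≤ m) :
    μ.real {ω | ¬ |totalWeight W m ω - m * ∫ ω, W 1 ω ∂μ| ≤ m * η}
      ≤ 2 * Real.exp (-(2 * m * η ^ 2)) := by
  obtain ⟨w, hw0, -, hw⟩ := exists_ae_weight_mem_Icc hT hW
  have hm0 : (0 : ℝ) < m := by exact_mod_cast hm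
  have hint : ∀ i, ∫ ω, W (i + 1) ω ∂μ = ∫ ω, W 1 ω ∂μ := fun i =>
    (hT.identDistrib_weight (i + 1) (by omega)).integral_eq
  set b := ∫ ω, W 1 ω ∂μ with hb
  have hsub : ∀ i, HasSubgaussianMGF (fun ω => W (i + 1) ω - b) ((‖(1 : ℝ) - 0‖₊ / 2) ^ 2) μ := by
    intro i
    have h := hasSubgaussianMGF_of_mem_Icc (μ := μ) (X := W (i + 1)) (a := 0) (b := 1)
      (hT.measurable_weight (i + 1) (by omega)).aemeasurable
      (hw.mono fun ω hω => ⟨hw0.le.trans (hω (i + 1) (by omega)).1, (hω (i + 1) (by omega)).2⟩)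
    rwa [hint i] at h
  have hind : iIndepFun (fun i ω => W (i + 1) ω - b) μ :=
    hT.indep_weight.comp (fun _ x => x - b) fun _ => measurable_id.sub_const b
  have hind' : iIndepFun (fun i ω => -(W (i + 1) ω - b)) μ :=
    hT.indep_weight.comp (fun _ x => -(x - b)) fun _ => (measurable_id.sub_const b).neg
  have h1 := HasSubgaussianMGF.measure_sum_range_ge_le_of_iIndepFun hind (n := m)
    (fun i _ => hsub i) (ε := m * η) (by positivity)
  have h2 := HasSubgaussianMGF.measure_sum_range_ge_le_of_iIndepFun hind' (n := m)
    (fun i _ => (hsub i).neg) (ε := m * η) (by positivity)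
  have hexp : -(m * η) ^ 2 / (2 * m * (((‖(1 : ℝ) - 0‖₊ / 2) ^ 2 : NNReal) : ℝ))
      = -(2 * m * η ^ 2) := by
    simp
    field_simp
  rw [hexp] at h1 h2
  have htot : ∀ ω, totalWeight W m ω - m * b = ∑ i ∈ Finset.range m, (W (i + 1) ω - b) := by
    intro ω
    rw [totalWeight, Finset.sum_sub_distrib, Finset.sum_const, Finset.card_range, nsmul_eq_mul,
      Finset.range_eq_Ico, Finset.sum_Ico_add' (fun i => W i ω) 0 m 1]
    rfl
  calc μ.real {ω | ¬ |totalWeight W m ω - m * b| ≤ m * η}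
      ≤ μ.real ({ω | m * η ≤ ∑ i ∈ Finset.range m, (W (i + 1) ω - b)}
        ∪ {ω | m * η ≤ ∑ i ∈ Finset.range m, -(W (i + 1) ω - b)}) := by
        refine measureReal_mono fun ω hω => ?_
        have hω' : ¬ |totalWeight W m ω - m * b| ≤ m * η := hω
        rw [htot, not_le, lt_abs] at hω'
        rcases hω' with h | h
        · exact Or.inl h.le
        · refine Or.inr ?_
          change m * η ≤ ∑ i ∈ Finset.range m, -(W (i + 1) ω - b)
          rw [Finset.sum_neg_distrib]
          exact h.le
    _ ≤ _ := (measureReal_union_le _ _).trans (by linarith)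

/-- The total weights concentrate. -/
lemma measureReal_goodEvent_compl_le (hT : IsWeightedRecursiveTree μ W parent)
    (hW : WeightAssumption μ (W 1)) {η : ℝ} (hη : 0 ≤ η) {N n : ℕ} (hN : 1 ≤ N) :
    μ.real (goodEvent W (∫ ω, W 1 ω ∂μ) η N n)ᶜ ≤ n * (2 * Real.exp (-(2 * N * η ^ 2))) := by
  have h : (goodEvent W (∫ ω, W 1 ω ∂μ) η N n)ᶜ
      = ⋃ m ∈ Finset.Icc N n, {ω | ¬ |totalWeight W m ω - m * ∫ ω, W 1 ω ∂μ| ≤ m * η} := by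
    ext ω; simp [goodEvent, and_assoc]
  rw [h]
  refine (measureReal_biUnion_finset_le _ _).trans ?_
  calc _ ≤ ∑ m ∈ Finset.Icc N n, 2 * Real.exp (-(2 * N * η ^ 2)) := by
        refine Finset.sum_le_sum fun m hm => ?_
        have hm' := (Finset.mem_Icc.1 hm).1
        refine (measureReal_totalWeight_deviation_le hT hW hη (hN.trans hm')).trans ?_
        gcongr
    _ ≤ _ := by
        rw [Finset.sum_const, nsmul_eq_mul, Nat.card_Icc]
        gcongr
        omega

end WRT

namespace WRT

open MeasureTheory ProbabilityTheory

/-! ### Estimates for a fixed realisation of the weights -/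

section Pointwise

variable {Ω : Type*} {W : ℕ → Ω → ℝ} {ι : Type*} {j : ι → ℕ} {w : ℝ} {ω : Ω}

lemma sum_range_attachProb (i : ι) (n : ℕ) :
    ∑ m ∈ Finset.range n, attachProb W j ω m i
      = W (j i) ω * ∑ m ∈ Finset.Ico (j i) n, (totalWeight W m ω)⁻¹ := by
  have h : Finset.Ico (j i) n = (Finset.range n).filter fun m => j i ≤ m := by
    ext; simp [and_comm]
  rw [h, Finset.sum_filter, Finset.mul_sum]
  refine Finset.sum_congr rfl fun m _ => ?_
  unfold attachProb
  split_ifs <;> simp [div_eq_mul_inv]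

lemma sum_inv_totalWeight_nonneg (hw : 0 < w) (h : ∀ i, 1 ≤ i → W i ω ∈ Set.Icc w 1) (a n : ℕ) :
    0 ≤ ∑ m ∈ Finset.Ico a n, (totalWeight W m ω)⁻¹ := by
  refine Finset.sum_nonneg fun m _ => inv_nonneg.2 ?_
  exact le_trans (by positivity) (mul_le_totalWeight h m)

variable [Fintype ι]

/-- Each attachment probability is at most 1 / (w m) and vanishes before N, so the squares sum to
O(1/N). This sum is the error of the Poisson approximation; it is small only because all labels are
at least N. -/
lemma sum_sq_attachProb_le (hw : 0 < w) (h : ∀ i, 1 ≤ i → W i ω ∈ Set.Icc w 1) {N : ℕ}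
    (hN : 1 ≤ N) (hNj : ∀ i, N ≤ j i) (n : ℕ) {C : ℝ} :
    ∑ m ∈ Finset.range n, (∑ i, attachProb W j ω m i * C) ^ 2
      ≤ (C * Fintype.card ι / w) ^ 2 * (2 / N) := by
  have hle : ∀ m i, |attachProb W j ω m i| ≤ if N ≤ m then w⁻¹ * (m : ℝ)⁻¹ else 0 := by
    intro m i
    unfold attachProb
    by_cases hji : j i ≤ m
    · have hNm : N ≤ m := (hNj i).trans hji
      have hm0 : (0 : ℝ) < m := by exact_mod_cast hN.trans hNm
      have hW' := h (j i) (hN.trans (hNj i))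
      have hS := mul_le_totalWeight h m
      have hS0 : 0 < totalWeight W m ω := lt_of_lt_of_le (by positivity) hS
      rw [if_pos hji, if_pos hNm, abs_of_nonneg (div_nonneg (hw.le.trans hW'.1) hS0.le),
        ← mul_inv, ← one_div]
      have := hW'.2
      gcongr
    · rw [if_neg hji, abs_zero]
      split_ifs <;> positivity
  have hsq : ∀ m ∈ Finset.range n, (∑ i, attachProb W j ω m i * C) ^ 2
      ≤ if N ≤ m then (C * Fintype.card ι / w) ^ 2 * ((m : ℝ) ^ 2)⁻¹ else 0 := by
    intro m _
    have h1 : |∑ i, attachProb W j ω m i|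
        ≤ Fintype.card ι * if N ≤ m then w⁻¹ * (m : ℝ)⁻¹ else 0 := by
      refine (Finset.abs_sum_le_sum_abs _ _).trans ((Finset.sum_le_sum fun i _ => hle m i).trans ?_)
      rw [Finset.sum_const, Finset.card_univ, nsmul_eq_mul]
    rw [← Finset.sum_mul, mul_pow, ← sq_abs (∑ i, attachProb W j ω m i)]
    calc _ ≤ (Fintype.card ι * if N ≤ m then w⁻¹ * (m : ℝ)⁻¹ else 0) ^ 2 * C ^ 2 := by gcongr
      _ = _ := by
        split_ifs
        · field_simp
        · simp
  refine (Finset.sum_le_sum hsq).trans ?_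
  have hset : (Finset.range n).filter (fun m => N ≤ m) = Finset.Ico N n := by
    ext; simp [and_comm]
  rw [← Finset.sum_filter, hset, ← Finset.mul_sum]
  have := sum_Ico_inv_sq_le hN n
  gcongr

variable [DecidableEq ι] {b η : ℝ} {N n : ℕ}

/-- For vertices with large labels, the degrees are approximately Poisson. -/
lemma tilt_mul_abs_counterTail_sub_poissonTails_le (hb : 0 < b) (hb1 : b ≤ 1) (hη0 : 0 ≤ η)
    (hη : η ≤ b / 2) (hw : 0 < w) (h : ∀ i, 1 ≤ i → W i ω ∈ Set.Icc w 1) (hN : 1 ≤ N)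
    (hinj : Function.Injective j) (hNj : ∀ i, N ≤ j i) (hjn : ∀ i, j i ≤ n)
    (hG : ω ∈ goodEvent W b η N n) (hκ : recipError b η N n ≤ 1) (d : ι → ℤ) :
    tilt (fun _ => 1 + b) d * |counterTail (attachProb W j ω) n d
        - poissonTails d fun i => W (j i) ω / b * Real.log (n / j i)|
      ≤ (((b + 2) * Fintype.card ι / w) ^ 2 * (2 / N)
          + Fintype.card ι * (recipError b η N n * (b + 2)))
        * ∏ i, (Real.exp 1 * (n / j i)) := by
  set κ := recipError b η N n with hκdef
  have hκ0 : 0 ≤ κ := recipError_nonneg hb hη0 N n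
  have hj : ∀ i, 1 ≤ j i := fun i => hN.trans (hNj i)
  have hp : ∀ m i, 0 ≤ attachProb W j ω m i := fun m i => (attachProb_mem_Icc hj hw h m i).1
  have hp1 := sum_attachProb_le_one hj hinj hw h
  have hr : ∀ _ : ι, (1 : ℝ) ≤ 1 + b := fun _ => by linarith
  have hW0 : ∀ i, 0 ≤ W (j i) ω := fun i => hw.le.trans (h (j i) (hj i)).1
  have hW1 : ∀ i, W (j i) ω ≤ 1 := fun i => (h (j i) (hj i)).2
  have hlog0 : ∀ i, 0 ≤ Real.log ((n : ℝ) / j i) := fun i => by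
    have : (0 : ℝ) < j i := by exact_mod_cast hj i
    refine Real.log_nonneg ?_
    rw [le_div_iff₀ this, one_mul]
    exact_mod_cast hjn i
  set x : ι → ℝ := fun i => ∑ m ∈ Finset.range n, attachProb W j ω m i with hx
  set y : ι → ℝ := fun i => W (j i) ω / b * Real.log (n / j i) with hy
  have hx0 : ∀ i, 0 ≤ x i := fun i => Finset.sum_nonneg fun m _ => hp m i
  have hy0 : ∀ i, 0 ≤ y i := fun i => mul_nonneg (div_nonneg (hW0 i) hb.le) (hlog0 i)
  have hxy : ∀ i, |x i - y i| ≤ κ := by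
    intro i
    have h1 := abs_sum_inv_sub_log_div_le hb hη0 hη hN (hNj i) (hjn i) hG
    have h2 : x i - y i = W (j i) ω * (∑ m ∈ Finset.Ico (j i) n, (totalWeight W m ω)⁻¹
        - Real.log (n / j i) / b) := by
      rw [hx, hy]; simp only; rw [sum_range_attachProb]; ring
    rw [h2, abs_mul, abs_of_nonneg (hW0 i)]
    calc _ ≤ 1 * κ := by gcongr; exact hW1 i
      _ = κ := one_mul _
  -- The tilt 1 + b is matched to the means: b times (W / b) log(n/j) is at most log(n/j) since W ≤
  -- 1, and the slack b κ ≤ 1 accounts for the factor e.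
  have hz : Real.exp (∑ i, (1 + b - 1) * (y i + κ)) ≤ ∏ i, (Real.exp 1 * ((n : ℝ) / j i)) := by
    rw [Real.exp_sum]
    refine Finset.prod_le_prod (fun i _ => (Real.exp_pos _).le) fun i _ => ?_
    have hji : (0 : ℝ) < j i := by exact_mod_cast hj i
    have hn0 : (0 : ℝ) < n := by exact_mod_cast (hj i).trans (hjn i)
    rw [← Real.exp_log (by positivity : (0 : ℝ) < n / j i), ← Real.exp_add]
    refine Real.exp_le_exp.2 ?_
    have h1 : (1 + b - 1) * (y i + κ) = W (j i) ω * Real.log (n / j i) + b * κ := by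
      rw [hy]; field_simp; ring
    rw [h1]
    have h2 := mul_le_of_le_one_left (hlog0 i) (hW1 i)
    have h3 : b * κ ≤ 1 := by nlinarith
    linarith
  have hxz : ∀ i, x i ≤ y i + κ := fun i => by linarith [(abs_le.1 (hxy i)).2]
  have h1 := tilt_mul_abs_counterTail_sub_le (r := fun _ => 1 + b) hr hp hp1 n d
  have h2 := tilt_mul_abs_poissonTails_sub_le (r := fun _ => 1 + b) hr (x := y) (y := x)
    (z := fun i => y i + κ) hy0 hx0 (fun i => by linarith) hxz d
  have ht := tilt_pos (r := fun _ : ι => 1 + b) (fun _ => by linarith) d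
  have h12 : (1 + b + 1) = b + 2 := by ring
  rw [h12] at h1
  rw [h12] at h2
  calc _ ≤ tilt (fun _ => 1 + b) d * (|counterTail (attachProb W j ω) n d - poissonTails d x|
        + |poissonTails d x - poissonTails d y|) := by
        gcongr
        exact abs_sub_le _ _ _
    _ ≤ ((b + 2) * Fintype.card ι / w) ^ 2 * (2 / N) * Real.exp (∑ i, (1 + b - 1) * (y i + κ))
        + Real.exp (∑ i, (1 + b - 1) * (y i + κ)) * (Fintype.card ι * (κ * (b + 2))) := by
        rw [mul_add]
        refine add_le_add (h1.trans ?_) (h2.trans ?_)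
        · have := sum_sq_attachProb_le (j := j) hw h hN hNj n (C := b + 2)
          refine mul_le_mul this ?_ (Real.exp_pos _).le (by positivity)
          refine Real.exp_le_exp.2 (Finset.sum_le_sum fun i _ => ?_)
          exact mul_le_mul_of_nonneg_left (hxz i) (by linarith)
        · gcongr
          calc ∑ i, |x i - y i| * (b + 2) ≤ ∑ _i : ι, κ * (b + 2) := by
                refine Finset.sum_le_sum fun i _ => ?_
                have := hxy i
                gcongr
            _ = _ := by rw [Finset.sum_const, Finset.card_univ, nsmul_eq_mul]
    _ = (((b + 2) * Fintype.card ι / w) ^ 2 * (2 / N) + Fintype.card ι * (κ * (b + 2)))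
        * Real.exp (∑ i, (1 + b - 1) * (y i + κ)) := by ring
    _ ≤ _ := by gcongr

/-- The bound on the tilted degree tail of a vertex with a label below `N`. -/
noncomputable def smallBound (b w r : ℝ) (d : ℤ) (N n : ℕ) : ℝ :=
  ((1 + b) / r) ^ d *
    Real.exp ((r - 1) * ((Real.log N + 2) / w + (Real.log (n / N) / b + 1)))

/-- The bound on the tilted degree tail of vertex `v`. -/
noncomputable def vertexBound (b w r : ℝ) (d : ℤ) (N n v : ℕ) : ℝ :=
  if N ≤ v then Real.exp 1 * (n / v) else smallBound b w r d N n

lemma vertexBound_nonneg (hb : 0 < b) {r : ℝ} (hr : 1 ≤ r) (d : ℤ) (N n v : ℕ) :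
    0 ≤ vertexBound b w r d N n v := by
  unfold vertexBound smallBound
  have : 0 < (1 + b) / r := div_pos (by linarith) (by linarith)
  split_ifs <;> positivity

/-- An upper bound for the degree tails that also covers vertices with small labels. -/
lemma tilt_mul_counterTail_le_prod_vertexBound (hb : 0 < b) (hb1 : b ≤ 1) (hη0 : 0 ≤ η)
    (hη : η ≤ b / 2) (hw : 0 < w) (h : ∀ i, 1 ≤ i → W i ω ∈ Set.Icc w 1) (hN : 1 ≤ N)
    (hNn : N ≤ n) (hinj : Function.Injective j) (hj : ∀ i, 1 ≤ j i) (hjn : ∀ i, j i ≤ n)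
    (hG : ω ∈ goodEvent W b η N n) (hκ : recipError b η N n ≤ 1) {r : ι → ℝ}
    (hr : ∀ i, 1 ≤ r i) (d : ι → ℤ) :
    tilt (fun _ => 1 + b) d * |counterTail (attachProb W j ω) n d|
      ≤ ∏ i, vertexBound b w (r i) (d i) N n (j i) := by
  have hp : ∀ m i, 0 ≤ attachProb W j ω m i := fun m i => (attachProb_mem_Icc hj hw h m i).1
  have hp1 := sum_attachProb_le_one hj hinj hw h
  -- The Markov inequality is applied with a tilt depending on the coordinate: the full tilt for
  -- large labels, the smaller r i for small ones. The mismatch with the tilt 1 + b is the factor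
  -- ((1 + b) / r' i)^(d i).
  set r' : ι → ℝ := fun i => if N ≤ j i then 1 + b else r i with hr'
  have hr1 : ∀ i, 1 ≤ r' i := fun i => by
    simp only [hr']; split_ifs
    · linarith
    · exact hr i
  have hr0 : ∀ i, 0 < r' i := fun i => by linarith [hr1 i]
  have hW0 : ∀ i, 0 ≤ W (j i) ω := fun i => hw.le.trans (h (j i) (hj i)).1
  have hW1 : ∀ i, W (j i) ω ≤ 1 := fun i => (h (j i) (hj i)).2
  have hxle : ∀ i, ∑ m ∈ Finset.range n, attachProb W j ω m i
      ≤ ∑ m ∈ Finset.Ico (j i) n, (totalWeight W m ω)⁻¹ := fun i => by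
    rw [sum_range_attachProb]
    exact mul_le_of_le_one_left (sum_inv_totalWeight_nonneg hw h _ _) (hW1 i)
  have h1 := tilt_mul_counterTail_le hr1 hp hp1 n d
  have htilt : tilt (fun _ => 1 + b) d = (∏ i, ((1 + b) / r' i) ^ d i) * tilt r' d := by
    rw [tilt, tilt, ← Finset.prod_mul_distrib]
    refine Finset.prod_congr rfl fun i _ => ?_
    rw [← mul_zpow, div_mul_cancel₀ _ (hr0 i).ne']
  have hquot : ∀ i, 0 < (1 + b) / r' i := fun i => div_pos (by linarith) (hr0 i)
  rw [htilt, mul_assoc]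
  calc _ ≤ (∏ i, ((1 + b) / r' i) ^ d i)
        * Real.exp (∑ i, (r' i - 1) * ∑ m ∈ Finset.range n, attachProb W j ω m i) := by
        refine mul_le_mul_of_nonneg_left h1 ?_
        exact Finset.prod_nonneg fun i _ => (zpow_pos (hquot i) _).le
    _ = ∏ i, (((1 + b) / r' i) ^ d i
        * Real.exp ((r' i - 1) * ∑ m ∈ Finset.range n, attachProb W j ω m i)) := by
        rw [Real.exp_sum, Finset.prod_mul_distrib]
    _ ≤ _ := by
        refine Finset.prod_le_prod
          (fun i _ => mul_nonneg (zpow_pos (hquot i) _).le (Real.exp_pos _).le) fun i _ => ?_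
        have hji : (0 : ℝ) < j i := by exact_mod_cast hj i
        have hn0 : (0 : ℝ) < n := by exact_mod_cast (hj i).trans (hjn i)
        by_cases hNj : N ≤ j i
        · have hr'i : r' i = 1 + b := by simp [hr', hNj]
          simp only [vertexBound, if_pos hNj]
          rw [hr'i, div_self (by linarith), one_zpow, one_mul, add_sub_cancel_left]
          have h2 := (abs_le.1 (abs_sum_inv_sub_log_div_le hb hη0 hη hN hNj (hjn i) hG)).2
          calc _ ≤ Real.exp (1 + Real.log (n / j i)) := by
                refine Real.exp_le_exp.2 ?_
                have h3 : b * ∑ m ∈ Finset.range n, attachProb W j ω m i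
                    ≤ b * (Real.log (n / j i) / b + 1) := by
                  refine mul_le_mul_of_nonneg_left ?_ hb.le
                  linarith [hxle i]
                have h4 : b * (Real.log (n / j i) / b + 1) = Real.log (n / j i) + b := by
                  field_simp
                linarith
            _ = _ := by rw [Real.exp_add, Real.exp_log (by positivity)]
        · have hr'i : r' i = r i := by simp [hr', hNj]
          simp only [vertexBound, if_neg hNj, smallBound]
          rw [hr'i]
          have hq : 0 < (1 + b) / r i := div_pos (by linarith) (by linarith [hr i])
          refine mul_le_mul_of_nonneg_left (Real.exp_le_exp.2 ?_) (zpow_pos hq _).le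
          refine mul_le_mul_of_nonneg_left ?_ (by linarith [hr i])
          have h2 := sum_inv_le_of_small hb hη0 hη hw (hj i) (not_le.1 hNj).le hNn hG
            (mul_le_totalWeight h)
          linarith [hxle i]

end Pointwise

end WRT

namespace WRT

open MeasureTheory ProbabilityTheory

/-! ### Sums over tuples -/

section Tuples

variable {ι : Type*} [Fintype ι] [DecidableEq ι] {c : ι → ℕ → ℝ} {S : Finset ℕ} {V : ℝ}

lemma sum_piFinset_prod_le (hc : ∀ i v, 0 ≤ c i v) (hV : ∀ i, ∑ v ∈ S, c i v ≤ V) :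
    ∑ u ∈ Fintype.piFinset fun _ : ι => S, ∏ i, c i (u i) ≤ V ^ Fintype.card ι := by
  rw [← Finset.prod_univ_sum, ← Finset.card_univ]
  refine (Finset.prod_le_prod (fun i _ => Finset.sum_nonneg fun v _ => hc i v)
    fun i _ => hV i).trans_eq ?_
  rw [Finset.prod_const]

/-- Only the coordinate i₀ is restricted; each of the others contributes at most V. The assumption V
≥ 1 allows the exponent to be the full cardinality instead of one less. -/
lemma sum_piFinset_prod_le_of_mem (hc : ∀ i v, 0 ≤ c i v) (hV1 : 1 ≤ V)
    (hV : ∀ i, ∑ v ∈ S, c i v ≤ V) {i₀ : ι} (T : Finset ℕ) :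
    ∑ u ∈ (Fintype.piFinset fun _ : ι => S) with u i₀ ∈ T, ∏ i, c i (u i)
      ≤ (∑ v ∈ T, c i₀ v) * V ^ Fintype.card ι := by
  have hsub : (Fintype.piFinset fun _ : ι => S).filter (fun u => u i₀ ∈ T)
      ⊆ Fintype.piFinset (Function.update (fun _ => S) i₀ T) := by
    intro u hu
    rw [Finset.mem_filter, Fintype.mem_piFinset] at hu
    rw [Fintype.mem_piFinset]
    intro i
    by_cases hi : i = i₀
    · subst hi; simpa using hu.2
    · simpa [Function.update_of_ne hi] using hu.1 i
  have h0 : ∀ (i : ι) (A : Finset ℕ), 0 ≤ ∑ v ∈ A, c i v := fun i A =>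
    Finset.sum_nonneg fun v _ => hc i v
  refine (Finset.sum_le_sum_of_subset_of_nonneg hsub fun u _ _ =>
    Finset.prod_nonneg fun i _ => hc i _).trans ?_
  rw [← Finset.prod_univ_sum, ← Finset.mul_prod_erase _ _ (Finset.mem_univ i₀),
    Function.update_self]
  refine mul_le_mul_of_nonneg_left ?_ (h0 _ _)
  calc ∏ i ∈ Finset.univ.erase i₀, ∑ v ∈ Function.update (fun _ => S) i₀ T i, c i v
      ≤ ∏ _i ∈ Finset.univ.erase i₀, V := by
        refine Finset.prod_le_prod (fun i _ => h0 _ _) fun i hi => ?_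
        rw [Function.update_of_ne (Finset.ne_of_mem_erase hi)]
        exact hV i
    _ ≤ V ^ Fintype.card ι := by
        rw [Finset.prod_const]
        exact pow_le_pow_right₀ hV1 (Finset.card_le_univ _)

/-- A coincidence of two coordinates removes one degree of freedom: the factor at i is bounded by δ
and the remaining coordinates are summed freely. -/
lemma sum_piFinset_prod_le_of_eq (hc : ∀ i v, 0 ≤ c i v) (hV1 : 1 ≤ V)
    (hV : ∀ i, ∑ v ∈ S, c i v ≤ V) {δ : ℝ} (hδ : 0 ≤ δ) {i l : ι} (hil : i ≠ l)
    (hcδ : ∀ v ∈ S, c i v ≤ δ) :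
    ∑ u ∈ (Fintype.piFinset fun _ : ι => S) with u i = u l, ∏ m, c m (u m)
      ≤ δ * V ^ Fintype.card ι := by
  set c' : ι → ℕ → ℝ := fun m v => if m = i then 1 else c m v with hc'
  have hc'0 : ∀ m v, 0 ≤ c' m v := fun m v => by
    simp only [hc']; split_ifs
    · exact zero_le_one
    · exact hc m v
  set A := (Fintype.piFinset fun _ : ι => S).filter (fun u => u i = u l) with hA
  -- The erased entry is recovered from u l, so overwriting coordinate i by the dummy value 0 loses
  -- nothing on A.
  have hinj : Set.InjOn (fun u : ι → ℕ => Function.update u i 0) (A : Set (ι → ℕ)) := by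
    intro u hu u' hu' huu
    have hu1 : u i = u l := (Finset.mem_filter.1 (Finset.mem_coe.1 hu)).2
    have hu2 : u' i = u' l := (Finset.mem_filter.1 (Finset.mem_coe.1 hu')).2
    have hne : ∀ m, m ≠ i → u m = u' m := fun m hm => by
      have := congrFun huu m
      simpa [Function.update_of_ne hm] using this
    funext m
    by_cases hm : m = i
    · subst hm; rw [hu1, hu2, hne l hil.symm]
    · exact hne m hm
  have himage : A.image (fun u : ι → ℕ => Function.update u i 0)
      ⊆ Fintype.piFinset (Function.update (fun _ => S) i {0}) := by
    intro u hu
    obtain ⟨u', hu', rfl⟩ := Finset.mem_image.1 hu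
    rw [Fintype.mem_piFinset]
    intro m
    by_cases hm : m = i
    · subst hm; simp
    · simpa [Function.update_of_ne hm] using Fintype.mem_piFinset.1 (Finset.mem_filter.1 hu').1 m
  calc ∑ u ∈ A, ∏ m, c m (u m) ≤ ∑ u ∈ A, δ * ∏ m, c' m (Function.update u i 0 m) := by
        refine Finset.sum_le_sum fun u hu => ?_
        rw [← Finset.mul_prod_erase _ _ (Finset.mem_univ i),
          ← Finset.mul_prod_erase _ (fun m => c' m (Function.update u i 0 m)) (Finset.mem_univ i)]
        have h1 : c' i (Function.update u i 0 i) = 1 := by simp [hc']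
        have h2 : ∏ m ∈ Finset.univ.erase i, c' m (Function.update u i 0 m)
            = ∏ m ∈ Finset.univ.erase i, c m (u m) := by
          refine Finset.prod_congr rfl fun m hm => ?_
          have := Finset.ne_of_mem_erase hm
          simp [hc', this]
        rw [h1, h2, one_mul]
        exact mul_le_mul_of_nonneg_right
          (hcδ _ (Fintype.mem_piFinset.1 (Finset.mem_filter.1 hu).1 i))
          (Finset.prod_nonneg fun m _ => hc m _)
    _ = δ * ∑ u ∈ A.image (fun u : ι → ℕ => Function.update u i 0), ∏ m, c' m (u m) := by
        rw [← Finset.mul_sum, Finset.sum_image hinj]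
    _ ≤ δ * ∑ u ∈ Fintype.piFinset (Function.update (fun _ => S) i {0}), ∏ m, c' m (u m) := by
        refine mul_le_mul_of_nonneg_left ?_ hδ
        exact Finset.sum_le_sum_of_subset_of_nonneg himage fun u _ _ =>
          Finset.prod_nonneg fun m _ => hc'0 m _
    _ ≤ δ * V ^ Fintype.card ι := by
        refine mul_le_mul_of_nonneg_left ?_ hδ
        rw [← Finset.prod_univ_sum, ← Finset.card_univ]
        rw [← Finset.prod_const]
        refine Finset.prod_le_prod (fun m _ => Finset.sum_nonneg fun v _ => hc'0 m v)
          fun m _ => ?_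
        by_cases hm : m = i
        · subst hm; simpa [hc'] using hV1
        · simpa [hc', hm] using hV m

/-- The tuples of distinct vertices in `{1, ..., n}`. -/
def distinctTuples (ι : Type*) [Fintype ι] [DecidableEq ι] (n : ℕ) : Finset (ι → ℕ) :=
  (Fintype.piFinset fun _ : ι => Finset.Icc 1 n).filter Function.Injective

lemma mem_distinctTuples {n : ℕ} {u : ι → ℕ} :
    u ∈ distinctTuples ι n ↔ (∀ i, u i ∈ Finset.Icc 1 n) ∧ Function.Injective u := by
  simp [distinctTuples, Fintype.mem_piFinset]

lemma card_distinctTuples (n : ℕ) :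
    (distinctTuples ι n).card = n.descFactorial (Fintype.card ι) := by
  have h : Fintype.card (ι ↪ Finset.Icc 1 n) = n.descFactorial (Fintype.card ι) := by
    rw [Fintype.card_embedding_eq]; simp
  rw [← h, ← Finset.card_univ]
  symm
  refine Finset.card_bij (fun e _ => fun i => (e i : ℕ)) ?_ ?_ ?_
  · intro e _
    exact mem_distinctTuples.2 ⟨fun i => (e i).2, fun a b hab => e.injective (Subtype.ext hab)⟩
  · intro e _ e' _ hee
    ext i
    exact congrFun hee i
  · intro u hu
    rw [mem_distinctTuples] at hu
    exact ⟨⟨fun i => ⟨u i, hu.1 i⟩, fun a b hab => hu.2 (congrArg Subtype.val hab)⟩,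
      Finset.mem_univ _, rfl⟩

end Tuples

/-! ### Uniform samples of vertices -/

lemma degreeEvent_inter_eq {Ω : Type*} {k : ℕ} (parent : ℕ → Ω → ℕ) (n : ℕ) (v : Ω → Fin k → ℕ) (d : Fin k → ℤ)
    (u : Fin k → ℕ) :
    degreeEvent parent n v d ∩ {ω | v ω = u} = {ω | v ω = u} ∩ tailEvent parent n u d := by
  ext ω
  constructor
  · rintro ⟨h1, h2⟩
    refine ⟨h2, fun i => ?_⟩
    have h3 : v ω = u := h2
    have := h1 i
    rwa [h3] at this
  · rintro ⟨h1, h2⟩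
    refine ⟨fun i => ?_, h1⟩
    have h3 : v ω = u := h1
    rw [h3]
    exact h2 i

variable {Ω : Type*} [mΩ : MeasurableSpace Ω] {μ : Measure Ω} {W : ℕ → Ω → ℝ}
  {parent : ℕ → Ω → ℕ}

section Sample

variable {k n : ℕ} {v : Ω → Fin k → ℕ}

lemma measurableSet_degreeEvent (hT : IsWeightedRecursiveTree μ W parent)
    (hv : IsUniformSample μ n v) (d : Fin k → ℤ) :
    MeasurableSet (degreeEvent parent n v d) := by
  have h : degreeEvent parent n v d
      = ⋃ u : Fin k → ℕ, {ω | v ω = u} ∩ tailEvent parent n u d := by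
    simp_rw [← degreeEvent_inter_eq]
    ext ω; simp
  rw [h]
  exact MeasurableSet.iUnion fun u => (hv.measurable (measurableSet_singleton u)).inter
    (history_le hT n _ (measurableSet_tailEvent_history n u d))

variable [IsProbabilityMeasure μ]

/-- The prescribed masses of the distinct tuples already add up to one, their number being the
falling factorial. -/
lemma ae_mem_distinctTuples (hv : IsUniformSample μ n v) (hkn : k ≤ n) :
    ∀ᵐ ω ∂μ, v ω ∈ distinctTuples (Fin k) n := by
  have hms : MeasurableSet {ω | v ω ∈ distinctTuples (Fin k) n} :=
    hv.measurable (Finset.measurableSet _)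
  have hpos : (0 : ℝ) < n.descFactorial k := by
    exact_mod_cast Nat.pos_of_ne_zero fun h => by
      rw [Nat.descFactorial_eq_zero_iff_lt] at h; omega
  have hU : {ω | v ω ∈ distinctTuples (Fin k) n}
      = ⋃ u ∈ distinctTuples (Fin k) n, {ω | v ω = u} := by
    ext ω; simp
  have h1 : μ.real {ω | v ω ∈ distinctTuples (Fin k) n} = 1 := by
    rw [hU, measureReal_biUnion_finset]
    · have : ∀ u ∈ distinctTuples (Fin k) n, μ.real {ω | v ω = u} = 1 / (n.descFactorial k : ℝ) :=
        fun u hu => hv.law u (mem_distinctTuples.1 hu).2 (mem_distinctTuples.1 hu).1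
      rw [Finset.sum_congr rfl this, Finset.sum_const, card_distinctTuples, nsmul_eq_mul,
        Fintype.card_fin]
      field_simp
    · intro u _ u' _ huu
      exact Set.disjoint_left.2 fun ω h h' => huu (Eq.trans (Eq.symm h) h')
    · exact fun u _ => hv.measurable (measurableSet_singleton u)
  have h2 : μ {ω | v ω ∈ distinctTuples (Fin k) n} = 1 := by
    rw [measureReal_def] at h1
    rw [← ENNReal.toReal_eq_one_iff]; exact h1
  exact (prob_compl_eq_zero_iff hms).2 h2

/-- Integrals over the degree event decompose according to the sampled vertices. -/
lemma setIntegral_degreeEvent_eq (hT : IsWeightedRecursiveTree μ W parent)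
    (hv : IsUniformSample μ n v) (hkn : k ≤ n)
    (hvT : Indep (MeasurableSpace.comap v inferInstance) (history W parent n) μ)
    (d : Fin k → ℤ) (φ : (Fin k → ℕ) → ℂ) :
    ∫ ω in degreeEvent parent n v d, φ (v ω) ∂μ
      = (n.descFactorial k : ℂ)⁻¹ * ∑ u ∈ distinctTuples (Fin k) n,
        φ u * (μ.real (tailEvent parent n u d) : ℂ) := by
  have hmD := measurableSet_degreeEvent hT hv d
  have hmu : ∀ u, MeasurableSet {ω | v ω = u} := fun u => hv.measurable (measurableSet_singleton u)
  have hfun : ∀ᵐ ω ∂μ, (degreeEvent parent n v d).indicator (fun ω => φ (v ω)) ω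
      = ∑ u ∈ distinctTuples (Fin k) n,
        (degreeEvent parent n v d ∩ {ω | v ω = u}).indicator (fun _ => φ u) ω := by
    filter_upwards [ae_mem_distinctTuples hv hkn] with ω hω
    rw [Finset.sum_eq_single_of_mem (v ω) hω]
    · by_cases hD : ω ∈ degreeEvent parent n v d
      · have hmem : ω ∈ degreeEvent parent n v d ∩ {ω' | v ω' = v ω} := ⟨hD, rfl⟩
        rw [Set.indicator_of_mem hD, Set.indicator_of_mem hmem]
      · rw [Set.indicator_of_notMem hD, Set.indicator_of_notMem fun h => hD h.1]
    · intro u _ hu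
      have hmem : ω ∉ degreeEvent parent n v d ∩ {ω' | v ω' = u} := fun h => hu (Eq.symm h.2)
      exact Set.indicator_of_notMem hmem _
  rw [← integral_indicator hmD, integral_congr_ae hfun,
    integral_finsetSum _ fun u _ => (integrable_const _).indicator (hmD.inter (hmu u)),
    Finset.mul_sum]
  refine Finset.sum_congr rfl fun u hu => ?_
  rw [integral_indicator_const _ (hmD.inter (hmu u)), degreeEvent_inter_eq]
  have hindep : μ.real ({ω | v ω = u} ∩ tailEvent parent n u d)
      = μ.real {ω | v ω = u} * μ.real (tailEvent parent n u d) := by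
    have h := (Indep_iff _ _ μ).1 hvT {ω | v ω = u} (tailEvent parent n u d)
      ⟨{u}, measurableSet_singleton u, rfl⟩ (measurableSet_tailEvent_history n u d)
    rw [measureReal_def, h, ENNReal.toReal_mul]
    rfl
  rw [hindep, hv.law u (mem_distinctTuples.1 hu).2 (mem_distinctTuples.1 hu).1]
  simp only [Complex.real_smul]
  push_cast
  ring

end Sample

end WRT

namespace WRT

open MeasureTheory ProbabilityTheory

/-! ### Degree tails of fixed vertices -/

variable {Ω : Type*} [mΩ : MeasurableSpace Ω] {μ : Measure Ω} {W : ℕ → Ω → ℝ}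
  {parent : ℕ → Ω → ℕ}

/-- The mean of the Poisson tail with the random mean `X / b * s`. -/
noncomputable def meanTail (μ : Measure Ω) (X : Ω → ℝ) (b : ℝ) (d : ℤ) (s : ℝ) : ℝ :=
  ∫ ω, poissonTail d (X ω / b * s) ∂μ

/-- Distinct vertices have independent weights of the common law. Once the total weights have been
replaced by their means, the weights are the only coupling between the coordinates, and averaging
over them factorises. -/
lemma integral_poissonTails_eq (hT : IsWeightedRecursiveTree μ W parent) {ι : Type*} [Fintype ι]
    {j : ι → ℕ} (hj : ∀ i, 1 ≤ j i) (hinj : Function.Injective j) (b : ℝ) (d : ι → ℤ)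
    (s : ι → ℝ) :
    ∫ ω, poissonTails d (fun i => W (j i) ω / b * s i) ∂μ
      = ∏ i, meanTail μ (W 1) b (d i) (s i) := by
  have hpre : Function.Injective fun i => j i - 1 := fun a c hac => hinj (by
    have h1 := hj a
    have h2 := hj c
    simp only at hac
    omega)
  have hind : iIndepFun (fun i => W (j i)) μ := by
    have h := hT.indep_weight.precomp hpre
    have hfun : (fun i => W (j i - 1 + 1)) = fun i => W (j i) := by
      funext i
      rw [Nat.sub_add_cancel (hj i)]
    rw [← hfun]
    exact h
  have hmeas : ∀ i, Measurable fun x : ℝ => poissonTail (d i) (x / b * s i) := fun i =>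
    (continuous_poissonTail (d i)).measurable.comp (by fun_prop)
  have h := hind.integral_fun_prod_comp (fun i => (hT.measurable_weight (j i) (hj i)).aemeasurable)
    (fun i => (hmeas i).aestronglyMeasurable)
  refine h.trans (Finset.prod_congr rfl fun i _ => ?_)
  exact ((hT.identDistrib_weight (j i) (hj i)).comp (hmeas i)).integral_eq

section Fixed

variable [IsProbabilityMeasure μ]

lemma zpow_mul_meanTail_mem_Icc {X : Ω → ℝ} (hX : ∀ᵐ ω ∂μ, X ω ∈ Set.Icc 0 1) {b : ℝ}
    (hb : 0 < b) (d : ℤ) {s : ℝ} (hs : 0 ≤ s) :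
    (1 + b) ^ d * meanTail μ X b d s ∈ Set.Icc 0 (Real.exp s) := by
  have hz : 0 < (1 + b) ^ d := zpow_pos (by linarith) _
  have hx0 : ∀ {x : ℝ}, 0 ≤ x → 0 ≤ x / b * s := fun h => mul_nonneg (div_nonneg h hb.le) hs
  constructor
  · refine mul_nonneg hz.le (integral_nonneg_of_ae (hX.mono fun ω hω => ?_))
    exact poissonTail_nonneg d (hx0 hω.1)
  · rw [meanTail, ← integral_const_mul]
    calc _ ≤ ∫ _, Real.exp s ∂μ := by
          refine integral_mono_of_nonneg (hX.mono fun ω hω => ?_) (integrable_const _)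
            (hX.mono fun ω hω => ?_)
          · exact mul_nonneg hz.le (poissonTail_nonneg d (hx0 hω.1))
          · refine (zpow_mul_poissonTail_le d (hx0 hω.1) (by linarith : (1 : ℝ) ≤ 1 + b)).trans ?_
            refine Real.exp_le_exp.2 ?_
            have h1 : (1 + b - 1) * (X ω / b * s) = X ω * s := by field_simp; ring
            rw [h1]
            exact mul_le_of_le_one_left hs hω.2
      _ = _ := by simp

lemma integral_le_add_measureReal_compl {f : Ω → ℝ} {G : Set Ω} (hG : MeasurableSet G) {A B : ℝ}
    (hA : 0 ≤ A) (hf0 : ∀ᵐ ω ∂μ, 0 ≤ f ω) (hfA : ∀ᵐ ω ∂μ, ω ∈ G → f ω ≤ A)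
    (hfB : ∀ᵐ ω ∂μ, f ω ≤ B) : ∫ ω, f ω ∂μ ≤ B * μ.real Gᶜ + A := by
  calc ∫ ω, f ω ∂μ ≤ ∫ ω, (Gᶜ.indicator (fun _ => B) ω + A) ∂μ := by
        refine integral_mono_of_nonneg hf0
          (((integrable_const B).indicator hG.compl).add (integrable_const A)) ?_
        filter_upwards [hfA, hfB] with ω h1 h2
        by_cases hω : ω ∈ G
        · have : ω ∉ Gᶜ := fun h => h hω
          simpa [Set.indicator_of_notMem this] using h1 hω
        · have : ω ∈ Gᶜ := hω
          simp only [Set.indicator_of_mem this]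
          linarith
    _ = B * μ.real Gᶜ + A := by
        rw [integral_add ((integrable_const B).indicator hG.compl) (integrable_const A),
          integral_indicator_const _ hG.compl]
        simp [mul_comm]

variable {ι : Type*} [Fintype ι] [DecidableEq ι] {j : ι → ℕ} {w b η : ℝ} {N n : ℕ}

/-- The relative error in the Poisson approximation of the degrees of vertices with large labels. -/
noncomputable def approxError (k : ℕ) (b w η : ℝ) (N n : ℕ) : ℝ :=
  ((b + 2) * k / w) ^ 2 * (2 / N) + k * (recipError b η N n * (b + 2))

/-- The degree tails of fixed vertices, compared with the mean Poisson tails. -/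
lemma abs_tilt_mul_measureReal_tailEvent_sub_le (hT : IsWeightedRecursiveTree μ W parent)
    (hW : WeightAssumption μ (W 1)) (hb : 0 < b) (hb1 : b ≤ 1) (hη0 : 0 ≤ η) (hη : η ≤ b / 2)
    (hw : 0 < w) (hwW : ∀ᵐ ω ∂μ, ∀ i, 1 ≤ i → W i ω ∈ Set.Icc w 1) (hN : 1 ≤ N) (hNn : N ≤ n)
    (hj : j ∈ distinctTuples ι n) (hκ : recipError b η N n ≤ 1) {r : ι → ℝ} (hr : ∀ i, 1 ≤ r i)
    (d : ι → ℤ) :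
    |tilt (fun _ => 1 + b) d * μ.real (tailEvent parent n j d)
        - if ∀ i, N ≤ j i then
            ∏ i, ((1 + b) ^ d i * meanTail μ (W 1) b (d i) (Real.log (n / j i))) else 0|
      ≤ tilt (fun _ => 1 + b) d * μ.real (goodEvent W b η N n)ᶜ
        + (if ∀ i, N ≤ j i then approxError (Fintype.card ι) b w η N n else 1)
          * ∏ i, vertexBound b w (r i) (d i) N n (j i) := by
  rw [mem_distinctTuples] at hj
  obtain ⟨hjmem, hinj⟩ := hj
  have hj1 : ∀ i, 1 ≤ j i := fun i => (Finset.mem_Icc.1 (hjmem i)).1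
  have hjn : ∀ i, j i ≤ n := fun i => (Finset.mem_Icc.1 (hjmem i)).2
  have hmT : MeasurableSet (tailEvent parent n j d) :=
    history_le hT n _ (measurableSet_tailEvent_history n j d)
  have hcond := condExp_tailEvent_eq hT hW hj1 hinj n d
  have hFint : Integrable (fun ω => counterTail (attachProb W j ω) n d) μ :=
    integrable_condExp.congr hcond
  have hFeq : μ.real (tailEvent parent n j d)
      = ∫ ω, counterTail (attachProb W j ω) n d ∂μ := by
    rw [← integral_congr_ae hcond, integral_condExp (weightSigma_le hT),
      integral_indicator_const _ hmT, smul_eq_mul, mul_one]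
  have hF0 : ∀ᵐ ω ∂μ, 0 ≤ counterTail (attachProb W j ω) n d := hwW.mono fun ω h =>
    counterTail_nonneg (fun m i => (attachProb_mem_Icc hj1 hw h m i).1)
      (sum_attachProb_le_one hj1 hinj hw h) n d
  have hF1 : ∀ᵐ ω ∂μ, counterTail (attachProb W j ω) n d ≤ 1 := hwW.mono fun ω h => by
    -- The trivial tilt r = 1 turns the exponential Markov inequality into the bound by one.
    have := tilt_mul_counterTail_le (r := fun _ => (1 : ℝ)) (fun _ => le_rfl)
      (fun m i => (attachProb_mem_Icc hj1 hw h m i).1) (sum_attachProb_le_one hj1 hinj hw h) n d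
    simp [tilt] at this
    exact (le_abs_self _).trans this
  have ht := tilt_pos (r := fun _ : ι => 1 + b) (fun _ => by linarith) d
  have hmG := measurableSet_goodEvent hT b η N n
  have hvb : 0 ≤ ∏ i, vertexBound b w (r i) (d i) N n (j i) :=
    Finset.prod_nonneg fun i _ => vertexBound_nonneg hb (hr i) _ _ _ _
  by_cases hlarge : ∀ i, N ≤ j i
  · rw [if_pos hlarge, if_pos hlarge, hFeq, Finset.prod_mul_distrib,
      ← integral_poissonTails_eq hT hj1 hinj b d fun i => Real.log (n / j i)]
    change |tilt (fun _ => 1 + b) d * _ - tilt (fun _ => 1 + b) d * _| ≤ _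
    have hlog0 : ∀ i, 0 ≤ Real.log ((n : ℝ) / j i) := fun i => by
      have : (0 : ℝ) < j i := by exact_mod_cast hj1 i
      refine Real.log_nonneg ?_
      rw [le_div_iff₀ this, one_mul]
      exact_mod_cast hjn i
    have hy : ∀ᵐ ω ∂μ, ∀ i, 0 ≤ W (j i) ω / b * Real.log (n / j i) := hwW.mono fun ω h i =>
      mul_nonneg (div_nonneg (hw.le.trans (h (j i) (hj1 i)).1) hb.le) (hlog0 i)
    have hGint : Integrable (fun ω => poissonTails d fun i => W (j i) ω / b * Real.log (n / j i))
        μ := by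
      refine integrable_of_ae_mem_Icc (a := 0) (b := 1) ?_ (hy.mono fun ω h =>
        ⟨poissonTails_nonneg d h, poissonTails_le_one d h⟩)
      refine Measurable.aestronglyMeasurable (Finset.measurable_fun_prod _ fun i _ => ?_)
      exact (continuous_poissonTail (d i)).measurable.comp
        (((hT.measurable_weight (j i) (hj1 i)).div_const b).mul_const _)
    have hvle : ∏ i, (Real.exp 1 * ((n : ℝ) / j i))
        = ∏ i, vertexBound b w (r i) (d i) N n (j i) :=
      Finset.prod_congr rfl fun i _ => by rw [vertexBound, if_pos (hlarge i)]
    have hae0 : 0 ≤ approxError (Fintype.card ι) b w η N n := by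
      have := recipError_nonneg hb hη0 N n
      unfold approxError
      positivity
    rw [← mul_sub, ← integral_sub hFint hGint, abs_mul, abs_of_pos ht]
    calc _ ≤ tilt (fun _ => 1 + b) d * ∫ ω, |counterTail (attachProb W j ω) n d
          - poissonTails d fun i => W (j i) ω / b * Real.log (n / j i)| ∂μ := by
          gcongr
          exact abs_integral_le_integral_abs
      _ = ∫ ω, tilt (fun _ => 1 + b) d * |counterTail (attachProb W j ω) n d
          - poissonTails d fun i => W (j i) ω / b * Real.log (n / j i)| ∂μ := by
          rw [integral_const_mul]
      _ ≤ _ := by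
          refine integral_le_add_measureReal_compl hmG (mul_nonneg hae0 hvb) ?_ ?_ ?_
          · exact Filter.Eventually.of_forall fun ω => by positivity
          · filter_upwards [hwW] with ω h hG
            rw [← hvle]
            exact tilt_mul_abs_counterTail_sub_poissonTails_le hb hb1 hη0 hη hw h hN hinj hlarge
              hjn hG hκ d
          · filter_upwards [hF0, hF1, hy] with ω h0 h1 h2
            refine mul_le_of_le_one_right ht.le (abs_sub_le_iff.2 ⟨?_, ?_⟩)
            · linarith [poissonTails_nonneg d h2]
            · linarith [poissonTails_le_one d h2]
  -- With a small label present no approximation is attempted: the tail is compared with zero and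
  -- only bounded above.
  · rw [if_neg hlarge, if_neg hlarge, sub_zero, hFeq, one_mul, ← integral_const_mul]
    rw [abs_of_nonneg (integral_nonneg_of_ae (hF0.mono fun ω h => mul_nonneg ht.le h))]
    refine integral_le_add_measureReal_compl hmG hvb (hF0.mono fun ω h => mul_nonneg ht.le h) ?_ ?_
    · filter_upwards [hwW, hF0] with ω h h0 hG
      have := tilt_mul_counterTail_le_prod_vertexBound hb hb1 hη0 hη hw h hN hNn hinj hj1 hjn hG hκ
        hr d
      rwa [abs_of_nonneg h0] at this
    · filter_upwards [hF1] with ω h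
      exact mul_le_of_le_one_right ht.le h

end Fixed

end WRT

namespace WRT

open MeasureTheory ProbabilityTheory

/-! ### Summation over the sampled vertices -/

section Tuples

variable {ι : Type*} [Fintype ι] [DecidableEq ι] {c : ι → ℕ → ℝ} {S : Finset ℕ} {V : ℝ}

/-- A union bound over the pairs of coordinates that may coincide. -/
lemma sum_not_injective_prod_le (hc : ∀ i v, 0 ≤ c i v) (hV1 : 1 ≤ V)
    (hV : ∀ i, ∑ v ∈ S, c i v ≤ V) {δ : ℝ} (hδ : 0 ≤ δ) (hcδ : ∀ i, ∀ v ∈ S, c i v ≤ δ) :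
    ∑ u ∈ (Fintype.piFinset fun _ : ι => S) with ¬ Function.Injective u, ∏ m, c m (u m)
      ≤ (Fintype.card ι : ℝ) ^ 2 * (δ * V ^ Fintype.card ι) := by
  have hV0 : 0 ≤ V := by linarith
  have hp : ∀ u : ι → ℕ, 0 ≤ ∏ m, c m (u m) := fun u => Finset.prod_nonneg fun m _ => hc m _
  have hterm : ∀ (u : ι → ℕ) (i l : ι),
      0 ≤ if i ≠ l ∧ u i = u l then ∏ m, c m (u m) else 0 := fun u i l => by
    split_ifs
    · exact hp u
    · exact le_rfl
  calc _ ≤ ∑ u ∈ (Fintype.piFinset fun _ : ι => S) with ¬ Function.Injective u,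
          ∑ i, ∑ l, if i ≠ l ∧ u i = u l then ∏ m, c m (u m) else 0 := by
        refine Finset.sum_le_sum fun u hu => ?_
        have hu' := (Finset.mem_filter.1 hu).2
        rw [Function.Injective] at hu'
        push Not at hu'
        obtain ⟨i, l, hul, hil⟩ := hu'
        calc _ = if i ≠ l ∧ u i = u l then ∏ m, c m (u m) else 0 := by rw [if_pos ⟨hil, hul⟩]
          _ ≤ ∑ l, if i ≠ l ∧ u i = u l then ∏ m, c m (u m) else 0 :=
            Finset.single_le_sum (f := fun l => if i ≠ l ∧ u i = u l then ∏ m, c m (u m) else 0)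
              (fun l _ => hterm u i l) (Finset.mem_univ l)
          _ ≤ _ := Finset.single_le_sum
              (f := fun i => ∑ l, if i ≠ l ∧ u i = u l then ∏ m, c m (u m) else 0)
              (fun i _ => Finset.sum_nonneg fun l _ => hterm u i l) (Finset.mem_univ i)
    _ ≤ ∑ u ∈ Fintype.piFinset fun _ : ι => S,
          ∑ i, ∑ l, if i ≠ l ∧ u i = u l then ∏ m, c m (u m) else 0 :=
        Finset.sum_le_sum_of_subset_of_nonneg (Finset.filter_subset _ _) fun u _ _ =>
          Finset.sum_nonneg fun i _ => Finset.sum_nonneg fun l _ => hterm u i l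
    _ = ∑ i, ∑ l, ∑ u ∈ Fintype.piFinset fun _ : ι => S,
          if i ≠ l ∧ u i = u l then ∏ m, c m (u m) else 0 := by
        rw [Finset.sum_comm]
        exact Finset.sum_congr rfl fun i _ => Finset.sum_comm
    _ ≤ ∑ _i : ι, ∑ _l : ι, δ * V ^ Fintype.card ι := by
        refine Finset.sum_le_sum fun i _ => Finset.sum_le_sum fun l _ => ?_
        by_cases hil : i = l
        · simp only [hil, ne_eq, not_true_eq_false, false_and, if_false, Finset.sum_const_zero]
          positivity
        · simp only [ne_eq, hil, not_false_eq_true, true_and]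
          rw [← Finset.sum_filter]
          exact sum_piFinset_prod_le_of_eq hc hV1 hV hδ hil (hcδ i)
    _ = _ := by
        simp only [Finset.sum_const, Finset.card_univ, nsmul_eq_mul]
        ring

/-- If the terms of a sum over distinct tuples are close to products for tuples with entries at
least `N`, then the sum is close to the product of the sums. -/
lemma norm_sum_distinctTuples_sub_prod_le {n N : ℕ} (hN : 1 ≤ N) (hc : ∀ i v, 0 ≤ c i v)
    (hV1 : 1 ≤ V) (hV : ∀ i, ∑ v ∈ Finset.Icc 1 n, c i v ≤ V) {ρ δ K : ℝ} (hK : 0 ≤ K)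
    (hρ : 0 ≤ ρ) (hδ : 0 ≤ δ) (hcδ : ∀ i, ∀ v ∈ Finset.Icc N n, c i v ≤ δ)
    {φ : ι → ℕ → ℂ} (hφ : ∀ i v, ‖φ i v‖ ≤ 1) {P : (ι → ℕ) → ℝ} {g : ι → ℕ → ℝ}
    (hg : ∀ i, ∀ v ∈ Finset.Icc N n, |g i v| ≤ c i v)
    (hP : ∀ u ∈ distinctTuples ι n, |P u - if ∀ i, N ≤ u i then ∏ i, g i (u i) else 0|
      ≤ ρ + (if ∀ i, N ≤ u i then K else 1) * ∏ i, c i (u i)) :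
    ‖∑ u ∈ distinctTuples ι n, (∏ i, φ i (u i)) * (P u : ℂ)
        - ∏ i, ∑ v ∈ Finset.Icc N n, φ i v * (g i v : ℂ)‖
      ≤ (n : ℝ) ^ Fintype.card ι * ρ
        + (K + ∑ i, ∑ v ∈ Finset.Ico 1 N, c i v + (Fintype.card ι : ℝ) ^ 2 * δ)
          * V ^ Fintype.card ι := by
  have hp : ∀ u : ι → ℕ, 0 ≤ ∏ m, c m (u m) := fun u => Finset.prod_nonneg fun m _ => hc m _
  have hφp : ∀ u : ι → ℕ, ‖∏ i, φ i (u i)‖ ≤ 1 := fun u => by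
    rw [norm_prod]
    exact Finset.prod_le_one (fun i _ => norm_nonneg _) fun i _ => hφ i _
  have hset : (Fintype.piFinset fun _ : ι => Finset.Icc N n).filter Function.Injective
      = (distinctTuples ι n).filter fun u => ∀ i, N ≤ u i := by
    ext u
    simp only [Finset.mem_filter, Fintype.mem_piFinset, mem_distinctTuples, Finset.mem_Icc]
    constructor
    · rintro ⟨h1, h2⟩
      exact ⟨⟨fun i => ⟨hN.trans (h1 i).1, (h1 i).2⟩, h2⟩, fun i => (h1 i).1⟩
    · rintro ⟨⟨h1, h2⟩, h3⟩
      exact ⟨fun i => ⟨h3 i, (h1 i).2⟩, h2⟩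
  -- Expanding the product yields all tuples with entries at least N. The injective ones are
  -- compared term by term with the sum, while the others form an error of their own.
  have hprod : ∏ i, ∑ v ∈ Finset.Icc N n, φ i v * (g i v : ℂ)
      = ∑ u ∈ distinctTuples ι n,
          (∏ i, φ i (u i)) * ((if ∀ i, N ≤ u i then ∏ i, g i (u i) else 0 : ℝ) : ℂ)
        + ∑ u ∈ (Fintype.piFinset fun _ : ι => Finset.Icc N n) with ¬ Function.Injective u,
          ∏ i, (φ i (u i) * (g i (u i) : ℂ)) := by
    rw [Finset.prod_univ_sum,
      ← Finset.sum_filter_add_sum_filter_not _ Function.Injective, hset, Finset.sum_filter]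
    congr 1
    refine Finset.sum_congr rfl fun u _ => ?_
    split_ifs
    · rw [Finset.prod_mul_distrib]; push_cast; rfl
    · simp
  rw [hprod, ← sub_sub, ← Finset.sum_sub_distrib]
  have hA : ‖∑ u ∈ distinctTuples ι n, ((∏ i, φ i (u i)) * (P u : ℂ)
        - (∏ i, φ i (u i)) * ((if ∀ i, N ≤ u i then ∏ i, g i (u i) else 0 : ℝ) : ℂ))‖
      ≤ (n : ℝ) ^ Fintype.card ι * ρ
        + (K + ∑ i, ∑ v ∈ Finset.Ico 1 N, c i v) * V ^ Fintype.card ι := by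
    calc _ ≤ ∑ u ∈ distinctTuples ι n,
          (ρ + (K * ∏ i, c i (u i)
            + ∑ i, if u i ∈ Finset.Ico 1 N then ∏ l, c l (u l) else 0)) := by
          refine (norm_sum_le _ _).trans (Finset.sum_le_sum fun u hu => ?_)
          rw [← mul_sub, norm_mul, ← Complex.ofReal_sub, Complex.norm_real, Real.norm_eq_abs]
          refine (mul_le_of_le_one_left (abs_nonneg _) (hφp u)).trans ((hP u hu).trans ?_)
          have hterm : ∀ i, 0 ≤ if u i ∈ Finset.Ico 1 N then ∏ l, c l (u l) else 0 := fun i => by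
            split_ifs
            · exact hp u
            · exact le_rfl
          gcongr
          split_ifs with hl
          · exact le_add_of_nonneg_right (Finset.sum_nonneg fun i _ => hterm i)
          -- A tuple with some entry below N is charged to one such coordinate.
          · push Not at hl
            obtain ⟨i, hi⟩ := hl
            have hmem : u i ∈ Finset.Ico 1 N :=
              Finset.mem_Ico.2 ⟨(Finset.mem_Icc.1 ((mem_distinctTuples.1 hu).1 i)).1, hi⟩
            have h1 := Finset.single_le_sum
              (f := fun i => if u i ∈ Finset.Ico 1 N then ∏ l, c l (u l) else 0)
              (fun i _ => hterm i) (Finset.mem_univ i)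
            simp only [if_pos hmem] at h1
            rw [one_mul]
            exact h1.trans (le_add_of_nonneg_left (mul_nonneg hK (hp u)))
      _ ≤ ∑ u ∈ Fintype.piFinset fun _ : ι => Finset.Icc 1 n,
          (ρ + (K * ∏ i, c i (u i)
            + ∑ i, if u i ∈ Finset.Ico 1 N then ∏ l, c l (u l) else 0)) := by
          refine Finset.sum_le_sum_of_subset_of_nonneg (Finset.filter_subset _ _) fun u _ _ => ?_
          refine add_nonneg hρ (add_nonneg (mul_nonneg hK (hp u)) (Finset.sum_nonneg fun i _ => ?_))
          split_ifs
          · exact hp u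
          · exact le_rfl
      _ = (n : ℝ) ^ Fintype.card ι * ρ
          + (K * ∑ u ∈ Fintype.piFinset fun _ : ι => Finset.Icc 1 n, ∏ i, c i (u i)
          + ∑ i, ∑ u ∈ (Fintype.piFinset fun _ : ι => Finset.Icc 1 n) with u i ∈ Finset.Ico 1 N,
            ∏ l, c l (u l)) := by
          rw [Finset.sum_add_distrib, Finset.sum_add_distrib, ← Finset.mul_sum, Finset.sum_const,
            nsmul_eq_mul]
          congr 2
          · simp [Fintype.card_piFinset]
          · rw [Finset.sum_comm]
            exact Finset.sum_congr rfl fun i _ => by rw [Finset.sum_filter]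
      _ ≤ (n : ℝ) ^ Fintype.card ι * ρ + (K * V ^ Fintype.card ι
          + ∑ i, (∑ v ∈ Finset.Ico 1 N, c i v) * V ^ Fintype.card ι) := by
          gcongr with i
          · exact sum_piFinset_prod_le hc hV
          · exact sum_piFinset_prod_le_of_mem hc hV1 hV _
      _ = _ := by rw [← Finset.sum_mul]; ring
  have hB : ‖∑ u ∈ (Fintype.piFinset fun _ : ι => Finset.Icc N n) with ¬ Function.Injective u,
        ∏ i, (φ i (u i) * (g i (u i) : ℂ))‖
      ≤ (Fintype.card ι : ℝ) ^ 2 * (δ * V ^ Fintype.card ι) := by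
    refine (norm_sum_le _ _).trans (le_trans (Finset.sum_le_sum fun u hu => ?_)
      (sum_not_injective_prod_le hc hV1 (S := Finset.Icc N n) (fun i => ?_) hδ hcδ))
    · rw [norm_prod]
      refine Finset.prod_le_prod (fun i _ => norm_nonneg _) fun i _ => ?_
      rw [norm_mul, Complex.norm_real, Real.norm_eq_abs]
      exact (mul_le_of_le_one_left (abs_nonneg _) (hφ i _)).trans
        (hg i _ (Fintype.mem_piFinset.1 (Finset.mem_filter.1 hu).1 i))
    · refine le_trans ?_ (hV i)
      exact Finset.sum_le_sum_of_subset_of_nonneg (Finset.Icc_subset_Icc_left hN)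
        fun v _ _ => hc i v
  exact (norm_sub_le _ _).trans ((add_le_add hA hB).trans_eq (by ring))

end Tuples

end WRT

namespace WRT

open MeasureTheory ProbabilityTheory Filter Topology

/-! ### Choice of the tilting parameters -/

/-- From log y ≤ y - 1 the left side is at most a (1 + b - r) / r, which is below (1 + b - r) / b as
soon as r > a b. Such an r below 1 + b exists exactly because a < (1 + b) / b. The inequality says
that the gain in decay from tilting less exceeds the loss ((1 + b) / r)^d. -/
lemma exists_tilting_parameter {a b : ℝ} (hb : 0 < b) (ha0 : 0 < a) (ha : a < (1 + b) / b) :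
    ∃ r : ℝ, 1 < r ∧ r < 1 + b ∧ a * Real.log ((1 + b) / r) < (1 + b - r) / b := by
  have hab : a * b < 1 + b := (lt_div_iff₀ hb).1 ha
  obtain ⟨r, hr1, hr2⟩ := exists_between (max_lt (by linarith : (1 : ℝ) < 1 + b) hab)
  have h1 : 1 < r := (le_max_left _ _).trans_lt hr1
  have h2 : a * b < r := (le_max_right _ _).trans_lt hr1
  have hr0 : 0 < r := by linarith
  refine ⟨r, h1, hr2, ?_⟩
  have hlog := Real.log_le_sub_one_of_pos (x := (1 + b) / r) (by positivity)
  have h3 : (1 + b) / r - 1 = (1 + b - r) / r := by field_simp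
  calc a * Real.log ((1 + b) / r) ≤ a * ((1 + b - r) / r) := by
        rw [← h3]; gcongr
    _ < (1 + b - r) / b := by
        rw [← mul_div_assoc, div_lt_div_iff₀ hr0 hb]
        have : 0 < 1 + b - r := by linarith
        nlinarith

/-- The strict inequality survives a small perturbation, uniformly over finitely many coordinates.
The terms in ε leave room for d exceeding a log n, for the number n^ε of small labels, for the weak
bound S m ≥ w m, and for a final decay n^(-ε). -/
lemma exists_tilting_parameters {ι : Type*} [Finite ι] {a : ι → ℝ} {b w : ℝ} (hb : 0 < b)
    (ha0 : ∀ i, 0 < a i) (ha : ∀ i, a i < (1 + b) / b) :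
    ∃ (ε : ℝ) (r : ι → ℝ), 0 < ε ∧ ε < 1 ∧ ∀ i, 1 < r i ∧ r i < 1 + b ∧
      (a i + ε) * Real.log ((1 + b) / r i) + ε * (2 + (r i - 1) / w) < (1 + b - r i) / b := by
  choose r hr1 hr2 hr3 using fun i => exists_tilting_parameter hb (ha0 i) (ha i)
  have h : ∀ i, ∀ᶠ ε : ℝ in 𝓝[>] 0,
      (a i + ε) * Real.log ((1 + b) / r i) + ε * (2 + (r i - 1) / w) < (1 + b - r i) / b := by
    intro i
    have hc : Continuous fun ε : ℝ =>
        (a i + ε) * Real.log ((1 + b) / r i) + ε * (2 + (r i - 1) / w) := by fun_prop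
    have hlim := hc.tendsto 0
    simp only [add_zero, zero_mul] at hlim
    exact (hlim.mono_left nhdsWithin_le_nhds).eventually_lt_const (hr3 i)
  have h1 : ∀ᶠ ε : ℝ in 𝓝[>] 0, ε ∈ Set.Ioo (0 : ℝ) 1 := Ioo_mem_nhdsGT zero_lt_one
  obtain ⟨ε, hε, hε1⟩ := ((eventually_all.2 h).and h1).exists
  exact ⟨ε, r, hε1.1, hε1.2, fun i => ⟨hr1 i, hr2 i, hε i⟩⟩

/-! ### Asymptotics of the error terms -/

lemma tendsto_log_natCast_atTop : Tendsto (fun n : ℕ => Real.log n) atTop atTop :=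
  Real.tendsto_log_atTop.comp tendsto_natCast_atTop_atTop

lemma tendsto_exp_neg_mul_log_mul_pow {γ : ℝ} (hγ : 0 < γ) (m : ℕ) :
    Tendsto (fun n : ℕ => Real.exp (-(γ * Real.log n)) * (Real.log n + 2) ^ m) atTop (𝓝 0) := by
  have h1 : Tendsto (fun x : ℝ => x ^ m * Real.exp (-x)) atTop (𝓝 0) :=
    Real.tendsto_pow_mul_exp_neg_atTop_nhds_zero m
  have h2 : Tendsto (fun n : ℕ => γ * (Real.log n + 2)) atTop atTop :=
    (tendsto_atTop_add_const_right _ _ tendsto_log_natCast_atTop).const_mul_atTop hγ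
  have h3 := (h1.comp h2).const_mul (Real.exp (2 * γ) / γ ^ m)
  rw [mul_zero] at h3
  refine h3.congr fun n => ?_
  simp only [Function.comp]
  have h4 : Real.exp (-(γ * (Real.log n + 2))) * Real.exp (2 * γ)
      = Real.exp (-(γ * Real.log n)) := by
    rw [← Real.exp_add]; congr 1; ring
  rw [← h4, mul_pow]
  field_simp

/-- The threshold between small and large labels. -/
noncomputable def labelThreshold (ε : ℝ) (n : ℕ) : ℕ := ⌈Real.exp (ε * Real.log n)⌉₊

/-- The allowed relative deviation of the total weights. -/
noncomputable def weightTolerance (ε : ℝ) (n : ℕ) : ℝ := Real.exp (-(ε / 4 * Real.log n))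

lemma exp_le_labelThreshold (ε : ℝ) (n : ℕ) :
    Real.exp (ε * Real.log n) ≤ labelThreshold ε n := Nat.le_ceil _

lemma one_le_labelThreshold (ε : ℝ) (n : ℕ) : 1 ≤ labelThreshold ε n :=
  Nat.one_le_ceil_iff.2 (Real.exp_pos _)

lemma labelThreshold_le {ε : ℝ} (hε : 0 < ε) (n : ℕ) :
    (labelThreshold ε n : ℝ) ≤ 2 * Real.exp (ε * Real.log n) := by
  have h1 := Nat.ceil_lt_add_one (Real.exp_pos (ε * Real.log n)).le
  have h2 : 1 ≤ Real.exp (ε * Real.log n) :=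
    Real.one_le_exp (mul_nonneg hε.le (Real.log_natCast_nonneg n))
  rw [labelThreshold]
  linarith

lemma labelThreshold_le_self {ε : ℝ} (hε : ε < 1) {n : ℕ} (hn : 1 ≤ n) :
    labelThreshold ε n ≤ n := by
  refine Nat.ceil_le.2 ?_
  have hn0 : (0 : ℝ) < n := by exact_mod_cast hn
  calc Real.exp (ε * Real.log n) ≤ Real.exp (Real.log n) :=
        Real.exp_le_exp.2 (mul_le_of_le_one_left (Real.log_natCast_nonneg n) hε.le)
    _ = n := Real.exp_log hn0

lemma inv_labelThreshold_le (ε : ℝ) (n : ℕ) :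
    (labelThreshold ε n : ℝ)⁻¹ ≤ Real.exp (-(ε * Real.log n)) := by
  rw [Real.exp_neg]
  exact inv_anti₀ (Real.exp_pos _) (exp_le_labelThreshold ε n)

lemma tendsto_inv_labelThreshold_mul_pow {ε : ℝ} (hε : 0 < ε) (m : ℕ) :
    Tendsto (fun n : ℕ => (labelThreshold ε n : ℝ)⁻¹ * (Real.log n + 2) ^ m) atTop (𝓝 0) := by
  refine squeeze_zero (fun n => ?_) (fun n => ?_) (tendsto_exp_neg_mul_log_mul_pow hε m)
  · have := Real.log_natCast_nonneg n
    positivity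
  · have := Real.log_natCast_nonneg n
    have := inv_labelThreshold_le ε n
    gcongr

lemma tendsto_recipError_mul_pow {ε b : ℝ} (hε : 0 < ε) (m : ℕ) :
    Tendsto (fun n : ℕ => recipError b (weightTolerance ε n) (labelThreshold ε n) n
      * (Real.log n + 2) ^ m) atTop (𝓝 0) := by
  have h1 := (tendsto_exp_neg_mul_log_mul_pow (by positivity : 0 < ε / 4) (m + 1)).const_mul
    (2 / b ^ 2)
  have h2 := (tendsto_inv_labelThreshold_mul_pow hε m).const_mul (2 / b)
  have h3 := h1.add h2
  rw [mul_zero, mul_zero, add_zero] at h3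
  refine h3.congr fun n => ?_
  simp only [recipError, weightTolerance]
  rw [pow_succ]
  ring

lemma tendsto_approxError_mul_pow {ε b w : ℝ} (hε : 0 < ε) (k m : ℕ) :
    Tendsto (fun n : ℕ => approxError k b w (weightTolerance ε n) (labelThreshold ε n) n
      * (Real.log n + 2) ^ m) atTop (𝓝 0) := by
  have h1 := (tendsto_inv_labelThreshold_mul_pow hε m).const_mul (((b + 2) * k / w) ^ 2 * 2)
  have h2 := (tendsto_recipError_mul_pow (b := b) hε m).const_mul (k * (b + 2))
  have h3 := h1.add h2
  rw [mul_zero, mul_zero, add_zero] at h3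
  refine h3.congr fun n => ?_
  simp only [approxError]
  ring

lemma eventually_recipError_le_one {ε b : ℝ} (hε : 0 < ε) :
    ∀ᶠ n : ℕ in atTop, recipError b (weightTolerance ε n) (labelThreshold ε n) n ≤ 1 := by
  have h := tendsto_recipError_mul_pow (b := b) hε 0
  simp only [pow_zero, mul_one] at h
  exact (h.eventually_lt_const zero_lt_one).mono fun n hn => hn.le

lemma tendsto_weightTolerance {ε : ℝ} (hε : 0 < ε) :
    Tendsto (weightTolerance ε) atTop (𝓝 0) := by
  have h := tendsto_exp_neg_mul_log_mul_pow (by positivity : 0 < ε / 4) 0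
  simp only [pow_zero, mul_one] at h
  exact h

/-- Powers with exponent asymptotic to `a log n` grow at most polynomially. -/
lemma eventually_zpow_le_exp {a ε x : ℝ} (hε : 0 < ε) (hx : 1 ≤ x) {d : ℕ → ℤ}
    (hd : Tendsto (fun n : ℕ => (d n : ℝ) / Real.log n) atTop (𝓝 a)) :
    ∀ᶠ n : ℕ in atTop, x ^ d n ≤ Real.exp ((a + ε) * Real.log x * Real.log n) := by
  filter_upwards [hd.eventually_lt_const (by linarith : a < a + ε),
    tendsto_log_natCast_atTop.eventually_gt_atTop 0] with n h1 h2
  rw [div_lt_iff₀ h2] at h1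
  have hx0 : 0 < x := by linarith
  rw [← Real.rpow_intCast, Real.rpow_def_of_pos hx0]
  refine Real.exp_le_exp.2 ?_
  have := Real.log_nonneg hx
  nlinarith

/-- There are about n^ε small labels, each with the same bound, itself a power of n. The choice of r
and ε makes the total exponent at most -ε, which absorbs every power of log n. -/
lemma tendsto_sum_smallBound_mul_pow {ε a b w r : ℝ} (hb : 0 < b) (hw : 0 < w) (hε : 0 < ε)
    (hε1 : ε < 1) (hr1 : 1 < r) (hr2 : r < 1 + b)
    (hr : (a + ε) * Real.log ((1 + b) / r) + ε * (2 + (r - 1) / w) < (1 + b - r) / b)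
    {d : ℕ → ℤ} (hd : Tendsto (fun n : ℕ => (d n : ℝ) / Real.log n) atTop (𝓝 a)) (m : ℕ) :
    Tendsto (fun n : ℕ => (∑ v ∈ Finset.Ico 1 (labelThreshold ε n),
      vertexBound b w r (d n) (labelThreshold ε n) n v / n) * (Real.log n + 2) ^ m) atTop (𝓝 0) := by
  have hr0 : 0 < r := by linarith
  have hq : 1 ≤ (1 + b) / r := (one_le_div hr0).2 hr2.le
  have hlim := (tendsto_exp_neg_mul_log_mul_pow hε m).const_mul
    (2 * Real.exp ((r - 1) * (3 / w + 1)))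
  rw [mul_zero] at hlim
  refine squeeze_zero' (Eventually.of_forall fun n => ?_) ?_ hlim
  · have := Real.log_natCast_nonneg n
    refine mul_nonneg (Finset.sum_nonneg fun v _ => ?_) (by positivity)
    exact div_nonneg (vertexBound_nonneg hb hr1.le _ _ _ _) (Nat.cast_nonneg n)
  · filter_upwards [eventually_zpow_le_exp hε hq hd, eventually_ge_atTop 1] with n hz hn
    have hn0 : (0 : ℝ) < n := by exact_mod_cast hn
    have hL := Real.log_natCast_nonneg n
    set L := Real.log n with hLdef
    set N := labelThreshold ε n with hN
    have hN1 : 1 ≤ N := one_le_labelThreshold ε n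
    have hN0 : (0 : ℝ) < N := by exact_mod_cast hN1
    have hN2 : (N : ℝ) ≤ 2 * Real.exp (ε * L) := labelThreshold_le hε n
    have hlogN : Real.log N ≤ ε * L + 1 := by
      refine (Real.log_le_log hN0 hN2).trans ?_
      rw [Real.log_mul (by norm_num) (Real.exp_pos _).ne', Real.log_exp]
      have := Real.log_two_lt_d9
      linarith
    have hlognN : Real.log (n / N) ≤ L :=
      Real.log_le_log (by positivity) (div_le_self hn0.le (by exact_mod_cast hN1))
    have hs0 : 0 ≤ smallBound b w r (d n) N n := by
      unfold smallBound
      have : 0 < (1 + b) / r := by positivity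
      positivity
    have hsb : smallBound b w r (d n) N n ≤ Real.exp ((a + ε) * Real.log ((1 + b) / r) * L)
        * Real.exp ((r - 1) * ((ε * L + 1 + 2) / w + (L / b + 1))) := by
      unfold smallBound
      refine mul_le_mul hz ?_ (Real.exp_pos _).le (Real.exp_pos _).le
      refine Real.exp_le_exp.2 (mul_le_mul_of_nonneg_left ?_ (by linarith))
      gcongr
    have hsum : ∑ v ∈ Finset.Ico 1 N, vertexBound b w r (d n) N n v / n
        ≤ N * (smallBound b w r (d n) N n / n) := by
      have h1 : ∀ v ∈ Finset.Ico 1 N, vertexBound b w r (d n) N n v / n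
          = smallBound b w r (d n) N n / n := fun v hv => by
        rw [vertexBound, if_neg (not_le.2 (Finset.mem_Ico.1 hv).2)]
      rw [Finset.sum_congr rfl h1, Finset.sum_const, nsmul_eq_mul, Nat.card_Ico]
      gcongr
      omega
    rw [← mul_assoc]
    gcongr
    have hninv : (n : ℝ)⁻¹ = Real.exp (-L) := by rw [Real.exp_neg, hLdef, Real.exp_log hn0]
    calc _ ≤ N * (smallBound b w r (d n) N n / n) := hsum
      _ ≤ 2 * Real.exp (ε * L) * ((Real.exp ((a + ε) * Real.log ((1 + b) / r) * L)
        * Real.exp ((r - 1) * ((ε * L + 1 + 2) / w + (L / b + 1)))) / n) := by gcongr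
      _ = 2 * Real.exp (ε * L + (a + ε) * Real.log ((1 + b) / r) * L
          + (r - 1) * ((ε * L + 1 + 2) / w + (L / b + 1)) + -L) := by
          rw [div_eq_mul_inv, hninv, Real.exp_add, Real.exp_add, Real.exp_add]
          ring
      _ ≤ 2 * Real.exp ((r - 1) * (3 / w + 1) + -(ε * L)) := by
          refine mul_le_mul_of_nonneg_left (Real.exp_le_exp.2 ?_) (by norm_num)
          -- Collecting the coefficient of L isolates the expression made negative by the choice of
          -- the tilting parameters, since (r - 1)/b - 1 = -(1 + b - r)/b.
          have hid : ε * L + (a + ε) * Real.log ((1 + b) / r) * L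
              + (r - 1) * ((ε * L + 1 + 2) / w + (L / b + 1)) + -L
              = (r - 1) * (3 / w + 1) + -(ε * L) + L * ((a + ε) * Real.log ((1 + b) / r)
                + ε * (2 + (r - 1) / w) - (1 + b - r) / b) := by
            field_simp
            ring
          rw [hid]
          have : L * ((a + ε) * Real.log ((1 + b) / r)
                + ε * (2 + (r - 1) / w) - (1 + b - r) / b) ≤ 0 :=
            mul_nonpos_of_nonneg_of_nonpos hL (by linarith)
          linarith
      _ = _ := by rw [Real.exp_add]; ring

lemma sum_Icc_inv_le (n : ℕ) : ∑ v ∈ Finset.Icc 1 n, (v : ℝ)⁻¹ ≤ Real.log n + 1 := by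
  have h := harmonic_le_one_add_log n
  rw [harmonic_eq_sum_Icc] at h
  push_cast at h
  linarith

/-- Large labels contribute e times a harmonic sum, small labels at most one. The full tilt
therefore loses only a logarithm per vertex. -/
lemma sum_vertexBound_le {b w r : ℝ} (d : ℤ) {N n : ℕ} (hN : 1 ≤ N)
    (hNn : N ≤ n) (hsmall : ∑ v ∈ Finset.Ico 1 N, vertexBound b w r d N n v / n ≤ 1) :
    ∑ v ∈ Finset.Icc 1 n, vertexBound b w r d N n v / n ≤ 4 * (Real.log n + 2) := by
  have hn0 : (0 : ℝ) < n := by exact_mod_cast hN.trans hNn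
  have hsplit : ∑ v ∈ Finset.Icc 1 n, vertexBound b w r d N n v / n
      = ∑ v ∈ Finset.Ico 1 N, vertexBound b w r d N n v / n
        + ∑ v ∈ Finset.Ico N (n + 1), vertexBound b w r d N n v / n := by
    rw [Finset.sum_Ico_consecutive _ hN (by omega), Finset.Ico_add_one_right_eq_Icc]
  have hlarge : ∑ v ∈ Finset.Ico N (n + 1), vertexBound b w r d N n v / n
      ≤ 3 * (Real.log n + 1) := by
    calc _ = ∑ v ∈ Finset.Ico N (n + 1), Real.exp 1 * (v : ℝ)⁻¹ := by
          refine Finset.sum_congr rfl fun v hv => ?_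
          rw [vertexBound, if_pos (Finset.mem_Ico.1 hv).1]
          field_simp
      _ ≤ ∑ v ∈ Finset.Icc 1 n, Real.exp 1 * (v : ℝ)⁻¹ := by
          refine Finset.sum_le_sum_of_subset_of_nonneg ?_ fun v _ _ => by positivity
          rw [← Finset.Ico_add_one_right_eq_Icc]
          exact Finset.Ico_subset_Ico_left hN
      _ = Real.exp 1 * ∑ v ∈ Finset.Icc 1 n, (v : ℝ)⁻¹ := by rw [Finset.mul_sum]
      _ ≤ 3 * (Real.log n + 1) := by
          have h1 := sum_Icc_inv_le n
          have h2 := Real.exp_one_lt_d9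
          have h3 := Real.log_natCast_nonneg n
          gcongr
          linarith
  have := Real.log_natCast_nonneg n
  rw [hsplit]
  linarith

end WRT

/-! ### Vanishing of the errors and factorisation over the sampled vertices. -/

namespace WRT

open MeasureTheory ProbabilityTheory Filter Topology

variable {Ω : Type*} [mΩ : MeasurableSpace Ω] {μ : Measure Ω} {W : ℕ → Ω → ℝ}
  {parent : ℕ → Ω → ℕ}

lemma tendsto_exp_sub_exp {C ε : ℝ} (hε : 0 < ε) :
    Tendsto (fun n : ℕ => Real.exp (C * Real.log n - 2 * Real.exp (ε * Real.log n))) atTop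
      (𝓝 0) := by
  have h1 : Tendsto (fun n : ℕ => ε * Real.log n) atTop atTop :=
    tendsto_log_natCast_atTop.const_mul_atTop hε
  have h2 := (Real.tendsto_exp_div_pow_atTop 1).comp h1
  refine squeeze_zero' (Eventually.of_forall fun n => (Real.exp_pos _).le) ?_
    (Real.tendsto_exp_neg_atTop_nhds_zero.comp tendsto_log_natCast_atTop)
  filter_upwards [h2.eventually_ge_atTop (|C + 1| / ε),
    tendsto_log_natCast_atTop.eventually_gt_atTop 0] with n h3 h4
  refine Real.exp_le_exp.2 ?_
  simp only [Function.comp, pow_one] at h3 ⊢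
  rw [div_le_div_iff₀ hε (by positivity)] at h3
  have h5 : |C + 1| * Real.log n ≤ Real.exp (ε * Real.log n) := by
    have : |C + 1| * Real.log n * ε ≤ Real.exp (ε * Real.log n) * ε := by linarith
    exact le_of_mul_le_mul_right this hε
  have h6 : (C + 1) * Real.log n ≤ |C + 1| * Real.log n := by
    gcongr
    exact le_abs_self _
  have h7 := Real.exp_pos (ε * Real.log n)
  linarith

section Limit

variable [IsProbabilityMeasure μ] {ι : Type*} [Fintype ι]

/-- The tilt is at most a power of n because d is of order log n, whereas the deviation probability
is at most 2 n exp(-2 n^(ε/2)). -/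
lemma tendsto_tilt_mul_measureReal_goodEvent_compl (hT : IsWeightedRecursiveTree μ W parent)
    (hW : WeightAssumption μ (W 1)) {b : ℝ} (hb : 0 < b) (hbW : b = ∫ ω, W 1 ω ∂μ) {ε : ℝ}
    (hε : 0 < ε) {a : ι → ℝ} {d : ι → ℕ → ℤ}
    (hd : ∀ i, Tendsto (fun n : ℕ => (d i n : ℝ) / Real.log n) atTop (𝓝 (a i))) :
    Tendsto (fun n : ℕ => tilt (fun _ => 1 + b) (fun i => d i n)
      * μ.real (goodEvent W b (weightTolerance ε n) (labelThreshold ε n) n)ᶜ) atTop (𝓝 0) := by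
  set C := ∑ i, (a i + 1) * Real.log (1 + b) with hC
  have hlim := (tendsto_exp_sub_exp (C := C + 1) (by positivity : 0 < ε / 2)).const_mul 2
  rw [mul_zero] at hlim
  have hz := eventually_all.2 fun i =>
    eventually_zpow_le_exp (x := 1 + b) one_pos (by linarith) (hd i)
  have htp : ∀ n, 0 < tilt (fun _ => 1 + b) (fun i => d i n) := fun n =>
    tilt_pos (fun _ => by linarith) _
  refine squeeze_zero' (Eventually.of_forall fun n => mul_nonneg (htp n).le measureReal_nonneg)
    ?_ hlim
  filter_upwards [hz, eventually_ge_atTop 1] with n hn hn1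
  have hn0 : (0 : ℝ) < n := by exact_mod_cast hn1
  have h1 : tilt (fun _ => 1 + b) (fun i => d i n) ≤ Real.exp (C * Real.log n) := by
    rw [tilt, hC, Finset.sum_mul, Real.exp_sum]
    exact Finset.prod_le_prod (fun i _ => (zpow_pos (by linarith) _).le) fun i _ => hn i
  have hη0 : 0 ≤ weightTolerance ε n := (Real.exp_pos _).le
  have h2 := measureReal_goodEvent_compl_le (n := n) hT hW hη0 (one_le_labelThreshold ε n)
  rw [← hbW] at h2
  -- With N of order n^ε and η = n^(-ε/4), the Hoeffding exponent N η² is of order n^(ε/2), although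
  -- η itself still decays polynomially.
  have h3 : Real.exp (ε / 2 * Real.log n) ≤ labelThreshold ε n * weightTolerance ε n ^ 2 := by
    have h4 : Real.exp (ε / 2 * Real.log n)
        = Real.exp (ε * Real.log n) * weightTolerance ε n ^ 2 := by
      rw [weightTolerance, sq, ← Real.exp_add, ← Real.exp_add]
      congr 1
      ring
    rw [h4]
    have := exp_le_labelThreshold ε n
    gcongr
  calc _ ≤ Real.exp (C * Real.log n)
        * (n * (2 * Real.exp (-(2 * labelThreshold ε n * weightTolerance ε n ^ 2)))) := by
        refine mul_le_mul h1 h2 measureReal_nonneg (Real.exp_pos _).le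
    _ ≤ Real.exp (C * Real.log n) * (n * (2 * Real.exp (-(2 * Real.exp (ε / 2 * Real.log n))))) := by
        have h5 : -(2 * labelThreshold ε n * weightTolerance ε n ^ 2)
            ≤ -(2 * Real.exp (ε / 2 * Real.log n)) := by linarith
        have h6 := Real.exp_le_exp.2 h5
        gcongr
    _ = _ := by
        nth_rewrite 2 [← Real.exp_log hn0]
        rw [sub_eq_add_neg, Real.exp_add, add_mul, Real.exp_add, one_mul]
        ring

variable [DecidableEq ι]

/-- The expectation over the sampled vertices is asymptotically a product of one-vertex sums. -/
theorem tendsto_sum_distinctTuples_sub_prod (hT : IsWeightedRecursiveTree μ W parent)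
    (hW : WeightAssumption μ (W 1)) {b w ε : ℝ} (hb : 0 < b) (hb1 : b ≤ 1)
    (hbW : b = ∫ ω, W 1 ω ∂μ) (hw : 0 < w)
    (hwW : ∀ᵐ ω ∂μ, ∀ i, 1 ≤ i → W i ω ∈ Set.Icc w 1) (hε : 0 < ε) (hε1 : ε < 1) {a r : ι → ℝ}
    (hr : ∀ i, 1 < r i ∧ r i < 1 + b ∧
      (a i + ε) * Real.log ((1 + b) / r i) + ε * (2 + (r i - 1) / w) < (1 + b - r i) / b)
    {d : ι → ℕ → ℤ}
    (hd : ∀ i, Tendsto (fun n : ℕ => (d i n : ℝ) / Real.log n) atTop (𝓝 (a i)))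
    {φ : ℕ → ι → ℕ → ℂ} (hφ : ∀ n i v, ‖φ n i v‖ ≤ 1) :
    Tendsto (fun n : ℕ => ((n : ℂ) ^ Fintype.card ι)⁻¹
        * ∑ u ∈ distinctTuples ι n, (∏ i, φ n i (u i))
          * ((tilt (fun _ => 1 + b) (fun i => d i n)
            * μ.real (tailEvent parent n u fun i => d i n) : ℝ) : ℂ)
      - ∏ i, ((n : ℂ)⁻¹ * ∑ v ∈ Finset.Icc (labelThreshold ε n) n, φ n i v
        * (((1 + b) ^ d i n * meanTail μ (W 1) b (d i n) (Real.log (n / v)) : ℝ) : ℂ)))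
      atTop (𝓝 0) := by
  set k := Fintype.card ι with hk
  have hsmall : ∀ (m : ℕ) (i : ι), Tendsto (fun n : ℕ => (∑ v ∈ Finset.Ico 1 (labelThreshold ε n),
      vertexBound b w (r i) (d i n) (labelThreshold ε n) n v / n) * (Real.log n + 2) ^ m) atTop
      (𝓝 0) := fun m i =>
    tendsto_sum_smallBound_mul_pow hb hw hε hε1 (hr i).1 (hr i).2.1 (hr i).2.2 (hd i) m
  have hsmall1 : ∀ᶠ n : ℕ in atTop, ∀ i, ∑ v ∈ Finset.Ico 1 (labelThreshold ε n),
      vertexBound b w (r i) (d i n) (labelThreshold ε n) n v / n ≤ 1 := by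
    refine eventually_all.2 fun i => ?_
    have h := hsmall 0 i
    simp only [pow_zero, mul_one] at h
    exact (h.eventually_lt_const zero_lt_one).mono fun n hn => hn.le
  -- The total error: deviating weights, Poisson approximation, small labels and coinciding labels.
  -- The last three are multiplied by the k-th power of the logarithmic size of a one-vertex sum.
  set E : ℕ → ℝ := fun n => tilt (fun _ => 1 + b) (fun i => d i n)
      * μ.real (goodEvent W b (weightTolerance ε n) (labelThreshold ε n) n)ᶜ
      + (approxError k b w (weightTolerance ε n) (labelThreshold ε n) n
        + ∑ i, ∑ v ∈ Finset.Ico 1 (labelThreshold ε n),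
          vertexBound b w (r i) (d i n) (labelThreshold ε n) n v / n
        + (k : ℝ) ^ 2 * (Real.exp 1 * (labelThreshold ε n : ℝ)⁻¹))
        * (4 * (Real.log n + 2)) ^ k with hE
  have hElim : Tendsto E atTop (𝓝 0) := by
    have h1 := tendsto_tilt_mul_measureReal_goodEvent_compl hT hW hb hbW hε hd
    have h2 := tendsto_approxError_mul_pow (b := b) (w := w) hε k k
    have h3 := tendsto_finsetSum Finset.univ fun (i : ι) _ => hsmall k i
    have h4 := (tendsto_inv_labelThreshold_mul_pow hε k).const_mul ((k : ℝ) ^ 2 * Real.exp 1)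
    have h5 := h1.add (((h2.add h3).add h4).const_mul ((4 : ℝ) ^ k))
    simp only [Finset.sum_const_zero, mul_zero, add_zero] at h5
    refine h5.congr fun n => ?_
    simp only [hE, ← Finset.sum_mul, mul_pow]
    ring
  refine squeeze_zero_norm' ?_ hElim
  filter_upwards [hsmall1, eventually_recipError_le_one (b := b) hε,
    (tendsto_weightTolerance hε).eventually_lt_const (by positivity : 0 < b / 2),
    eventually_ge_atTop 1] with n hs1 hκ hη hn
  have hn0 : (0 : ℝ) < n := by exact_mod_cast hn
  set N := labelThreshold ε n with hN
  have hN1 : 1 ≤ N := one_le_labelThreshold ε n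
  have hN0 : (0 : ℝ) < N := by exact_mod_cast hN1
  have hNn : N ≤ n := labelThreshold_le_self hε1 hn
  have hη0 : 0 ≤ weightTolerance ε n := (Real.exp_pos _).le
  have hW1 : ∀ᵐ ω ∂μ, W 1 ω ∈ Set.Icc 0 1 := hwW.mono fun ω h =>
    ⟨hw.le.trans (h 1 le_rfl).1, (h 1 le_rfl).2⟩
  have htp : 0 < tilt (fun _ => 1 + b) (fun i => d i n) := tilt_pos (fun _ => by linarith) _
  have hvb : ∀ i v, 0 ≤ vertexBound b w (r i) (d i n) N n v := fun i v =>
    vertexBound_nonneg hb (hr i).1.le _ _ _ _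
  have hL := Real.log_natCast_nonneg n
  have hnk : (0 : ℝ) < (n : ℝ) ^ k := by positivity
  have hae0 : 0 ≤ approxError k b w (weightTolerance ε n) N n := by
    have := recipError_nonneg hb hη0 N n
    unfold approxError
    positivity
  have key := norm_sum_distinctTuples_sub_prod_le (ι := ι) (n := n) (N := N)
    (c := fun i v => vertexBound b w (r i) (d i n) N n v / n) (V := 4 * (Real.log n + 2))
    (ρ := tilt (fun _ => 1 + b) (fun i => d i n)
      * μ.real (goodEvent W b (weightTolerance ε n) N n)ᶜ / (n : ℝ) ^ k)
    (δ := Real.exp 1 * (N : ℝ)⁻¹) (K := approxError k b w (weightTolerance ε n) N n)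
    (φ := φ n)
    (P := fun u => tilt (fun _ => 1 + b) (fun i => d i n)
      * μ.real (tailEvent parent n u fun i => d i n) / (n : ℝ) ^ k)
    (g := fun i v => (1 + b) ^ d i n * meanTail μ (W 1) b (d i n) (Real.log (n / v)) / n)
    hN1 (fun i v => div_nonneg (hvb i v) hn0.le) (by linarith)
    (fun i => sum_vertexBound_le (d i n) hN1 hNn (hs1 i)) hae0
    (by positivity) (by positivity) ?_ (hφ n) ?_ ?_
  · refine le_trans (le_of_eq ?_) (key.trans (le_of_eq ?_))
    · congr 2
      · rw [Finset.mul_sum]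
        refine Finset.sum_congr rfl fun u _ => ?_
        push_cast
        ring
      · refine Finset.prod_congr rfl fun i _ => ?_
        rw [Finset.mul_sum]
        refine Finset.sum_congr rfl fun v _ => ?_
        push_cast
        ring
    · simp only [hE, ← hk]
      congr 1
      field_simp
      rw [hN]
  · intro i v hv
    have hv' := Finset.mem_Icc.1 hv
    have hv0 : (0 : ℝ) < v := by exact_mod_cast hN1.trans hv'.1
    simp only [vertexBound, if_pos hv'.1]
    calc Real.exp 1 * (n / v) / n = Real.exp 1 * (v : ℝ)⁻¹ := by field_simp
      _ ≤ _ := by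
        have : (N : ℝ) ≤ v := by exact_mod_cast hv'.1
        gcongr
  · intro i v hv
    have hv' := Finset.mem_Icc.1 hv
    have hv0 : (0 : ℝ) < v := by exact_mod_cast hN1.trans hv'.1
    have hlog : 0 ≤ Real.log ((n : ℝ) / v) := Real.log_nonneg (by
      rw [le_div_iff₀ hv0, one_mul]; exact_mod_cast hv'.2)
    have h1 := zpow_mul_meanTail_mem_Icc hW1 hb (d i n) hlog
    rw [Real.exp_log (by positivity)] at h1
    rw [abs_div, abs_of_nonneg h1.1, abs_of_pos hn0]
    simp only [vertexBound, if_pos hv'.1]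
    refine div_le_div_of_nonneg_right ?_ hn0.le
    exact h1.2.trans (le_mul_of_one_le_left (by positivity) (Real.one_le_exp zero_le_one))
  · intro u hu
    have h1 := abs_tilt_mul_measureReal_tailEvent_sub_le hT hW hb hb1 hη0 hη.le hw hwW hN1 hNn hu
      hκ (fun i => (hr i).1.le) fun i => d i n
    have hprod : ∀ f : ι → ℝ, ∏ i, f i / (n : ℝ) = (∏ i, f i) / (n : ℝ) ^ k := fun f => by
      rw [Finset.prod_div_distrib, Finset.prod_const, Finset.card_univ]
    simp only [hprod]
    have h2 : (if ∀ i, N ≤ u i then (∏ i, (1 + b) ^ d i n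
        * meanTail μ (W 1) b (d i n) (Real.log (n / u i))) / (n : ℝ) ^ k else 0)
        = (if ∀ i, N ≤ u i then ∏ i, (1 + b) ^ d i n
        * meanTail μ (W 1) b (d i n) (Real.log (n / u i)) else 0) / (n : ℝ) ^ k := by
      split_ifs <;> simp
    rw [h2, ← sub_div, abs_div, abs_of_pos hnk, mul_div_assoc', ← add_div]
    gcongr

end Limit

end WRT

namespace WRT

open MeasureTheory ProbabilityTheory Filter Topology

/-! ### The limit of the one-vertex sums -/

/-- The characteristic functions of centred and normalised Gamma variables converge. -/
lemma tendsto_exp_mul_inv_pow {σ : ℕ → ℝ} {d : ℕ → ℕ} (hσ : Tendsto σ atTop atTop)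
    (hd : Tendsto (fun n => ((d n : ℝ) - σ n ^ 2) / σ n) atTop (𝓝 0)) (t : ℝ) :
    Tendsto (fun n => Complex.exp (t * σ n * Complex.I)
      * ((1 + t / σ n * Complex.I)⁻¹) ^ d n) atTop (𝓝 (Complex.exp (-t ^ 2 / 2))) := by
  have hσinv : Tendsto (fun n => (σ n)⁻¹) atTop (𝓝 0) := tendsto_inv_atTop_zero.comp hσ
  have hσpos : ∀ᶠ n in atTop, 0 < σ n := hσ.eventually_gt_atTop 0
  have hratio : Tendsto (fun n => (d n : ℝ) / σ n ^ 2) atTop (𝓝 1) := by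
    have h := (hd.mul hσinv).const_add 1
    simp only [mul_zero, add_zero] at h
    refine h.congr' ?_
    filter_upwards [hσpos] with n hn
    field_simp
    ring
  set z : ℕ → ℂ := fun n => t / σ n * Complex.I with hz
  have hznorm : ∀ᶠ n in atTop, ‖z n‖ = |t| * (σ n)⁻¹ := by
    filter_upwards [hσpos] with n hn
    simp [hz, div_eq_mul_inv, abs_of_pos hn]
  have hzlt : ∀ᶠ n in atTop, |t| * (σ n)⁻¹ < 1 / 2 := by
    have h := hσinv.const_mul |t|
    rw [mul_zero] at h
    exact h.eventually_lt_const (by norm_num)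
  -- The third-order remainder of the logarithm. It is O(σ⁻³), while d is of order σ², so d E tends
  -- to zero.
  set E : ℕ → ℂ := fun n => Complex.log (1 + z n) - (z n - z n ^ 2 / 2) with hE
  have hEle : ∀ᶠ n in atTop, ‖(d n : ℂ) * E n‖ ≤ |t| ^ 3 * ((d n : ℝ) / σ n ^ 2) * (σ n)⁻¹ := by
    filter_upwards [hσpos, hznorm, hzlt] with n h0 h1 h2
    have hz1 : ‖z n‖ < 1 := by rw [h1]; linarith
    have h3 := Complex.norm_log_sub_logTaylor_le 2 hz1
    have h4 : Complex.logTaylor (2 + 1) (z n) = z n - z n ^ 2 / 2 := by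
      simp [Complex.logTaylor, Finset.sum_range_succ]
      ring
    rw [h4] at h3
    have h5 : (1 - ‖z n‖)⁻¹ ≤ 2 := by
      rw [inv_le_comm₀ (by linarith) (by norm_num), h1]
      linarith
    have h6 : ‖E n‖ ≤ ‖z n‖ ^ 3 := by
      refine h3.trans ?_
      have : ‖z n‖ ^ (2 + 1) * (1 - ‖z n‖)⁻¹ ≤ ‖z n‖ ^ (2 + 1) * 2 := by gcongr
      have h7 : 0 ≤ ‖z n‖ ^ 3 := by positivity
      norm_num at this ⊢
      linarith
    rw [norm_mul, Complex.norm_natCast]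
    calc (d n : ℝ) * ‖E n‖ ≤ d n * (|t| * (σ n)⁻¹) ^ 3 := by rw [← h1]; gcongr
      _ = _ := by field_simp
  have hElim : Tendsto (fun n => (d n : ℂ) * E n) atTop (𝓝 0) := by
    refine squeeze_zero_norm' hEle ?_
    have h := (hratio.const_mul (|t| ^ 3)).mul hσinv
    simpa using h
  -- The exponent i t σ - d log(1 + z) rearranged: the linear term leaves the centring error (d -
  -- σ²)/σ, and the quadratic term gives -(t²/2) d/σ².
  have hmain : Tendsto (fun n => ((-(t * (((d n : ℝ) - σ n ^ 2) / σ n)) : ℝ) : ℂ) * Complex.I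
      + ((-(t ^ 2 / 2) * ((d n : ℝ) / σ n ^ 2) : ℝ) : ℂ) - (d n : ℂ) * E n) atTop
      (𝓝 (((-(t * 0) : ℝ) : ℂ) * Complex.I + ((-(t ^ 2 / 2) * 1 : ℝ) : ℂ) - 0)) := by
    refine ((Tendsto.mul_const _ ?_).add ?_).sub hElim
    · exact (Complex.continuous_ofReal.tendsto _).comp (hd.const_mul t).neg
    · exact (Complex.continuous_ofReal.tendsto _).comp (hratio.const_mul _)
  have hexp := (Complex.continuous_exp.tendsto _).comp hmain
  have hval : Complex.exp (((-(t * 0) : ℝ) : ℂ) * Complex.I + ((-(t ^ 2 / 2) * 1 : ℝ) : ℂ) - 0)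
      = Complex.exp (-t ^ 2 / 2) := by
    congr 1; push_cast; ring
  rw [hval] at hexp
  refine hexp.congr' ?_
  filter_upwards [hσpos, hznorm, hzlt] with n h0 h1 h2
  have hz1 : ‖z n‖ < 1 := by rw [h1]; linarith
  have hne : 1 + z n ≠ 0 := fun h => by
    have h3 : z n = -1 := by linear_combination h
    rw [h3] at hz1
    simp at hz1
  have hσ0 : (σ n : ℂ) ≠ 0 := by exact_mod_cast h0.ne'
  simp only [Function.comp]
  change _ = Complex.exp (t * σ n * Complex.I) * ((1 + z n)⁻¹) ^ d n
  rw [inv_pow, ← Complex.exp_log hne, ← Complex.exp_nat_mul, ← Complex.exp_neg, ← Complex.exp_add]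
  congr 1
  simp only [hE, hz]
  push_cast
  field_simp
  ring_nf
  simp only [Complex.I_sq]
  ring

end WRT

/-! ### Contribution of the atom at one and the error of the Riemann sum. -/

namespace WRT

open MeasureTheory ProbabilityTheory Filter Topology

lemma norm_mul_div_add_le {b x τ : ℝ} (hb : 0 < b) (hx : 0 ≤ x) :
    ‖((1 + b : ℝ) : ℂ) * (x / (x + (1 - τ * Complex.I)))‖ ≤ (1 + b) * (x / (x + 1)) := by
  have h1 : x + 1 ≤ ‖(x : ℂ) + (1 - τ * Complex.I)‖ := by
    have h := Complex.re_le_norm ((x : ℂ) + (1 - τ * Complex.I))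
    simpa using h
  rw [norm_mul, norm_div, Complex.norm_real, Complex.norm_real, Real.norm_of_nonneg hx,
    Real.norm_of_nonneg (by linarith)]
  gcongr

lemma norm_inv_one_sub_mul_I_le (τ : ℝ) : ‖(1 - τ * Complex.I : ℂ)⁻¹‖ ≤ 1 := by
  rw [norm_inv]
  refine inv_le_one_of_one_le₀ ?_
  have h := Complex.re_le_norm (1 - τ * Complex.I : ℂ)
  simpa using h

section OneVertex

variable {Ω : Type*} [mΩ : MeasurableSpace Ω] {μ : Measure Ω} [IsProbabilityMeasure μ]

/-- Only the atom at one of the weight distribution contributes to the limit. -/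
lemma tendsto_integral_exp_mul_pow {X : Ω → ℝ} (hXm : Measurable X)
    (hX : ∀ᵐ ω ∂μ, X ω ∈ Set.Icc 0 1) {b : ℝ} (hb : 0 < b) {σ : ℕ → ℝ} {d : ℕ → ℕ}
    (hσ : Tendsto σ atTop atTop)
    (hd : Tendsto (fun n => ((d n : ℝ) - σ n ^ 2) / σ n) atTop (𝓝 0))
    (hd' : Tendsto d atTop atTop) (t : ℝ) {τ : ℕ → ℝ}
    (hτ : ∀ n, τ n = -(t / σ n) * ((1 + b) / b)) :
    Tendsto (fun n => ∫ ω, Complex.exp (t * σ n * Complex.I) * ((1 - τ n * Complex.I)⁻¹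
        * (((1 + b : ℝ) : ℂ) * (((X ω / b : ℝ) : ℂ)
          / (((X ω / b : ℝ) : ℂ) + (1 - τ n * Complex.I)))) ^ d n) ∂μ) atTop
      (𝓝 (μ.real {ω | X ω = 1} * Complex.exp (-t ^ 2 / 2))) := by
  have hS : MeasurableSet {ω | X ω = 1} := hXm (measurableSet_singleton 1)
  have hlim : (μ.real {ω | X ω = 1} * Complex.exp (-t ^ 2 / 2) : ℂ)
      = ∫ ω, {ω | X ω = 1}.indicator (fun _ => Complex.exp (-t ^ 2 / 2)) ω ∂μ := by
    rw [integral_indicator_const _ hS, Complex.real_smul]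
  have hτ0 : Tendsto τ atTop (𝓝 0) := by
    have h := ((hσ.const_div_atTop t).neg).mul_const ((1 + b) / b)
    rw [neg_zero, zero_mul] at h
    exact h.congr fun n => (hτ n).symm
  have hq : Tendsto (fun n => (1 - τ n * Complex.I)⁻¹) atTop (𝓝 1) := by
    have h : Tendsto (fun n => (1 - (τ n : ℂ) * Complex.I)) atTop
        (𝓝 (1 - ((0 : ℝ) : ℂ) * Complex.I)) :=
      (((Complex.continuous_ofReal.tendsto 0).comp hτ0).mul_const _).const_sub 1
    have h1 : (1 - ((0 : ℝ) : ℂ) * Complex.I) = 1 := by simp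
    rw [h1] at h
    simpa using h.inv₀ one_ne_zero
  have hexp : ∀ n, ‖Complex.exp (t * σ n * Complex.I)‖ = 1 := fun n => by
    have h := Complex.norm_exp_ofReal_mul_I (t * σ n)
    rwa [Complex.ofReal_mul] at h
  have hratio : ∀ x : ℝ, 0 ≤ x → (1 + b) * (x / b / (x / b + 1)) = (1 + b) * x / (x + b) := by
    intro x hx
    have : 0 < x + b := by linarith
    field_simp
  have hnorm : ∀ n (x : ℝ), 0 ≤ x → ‖Complex.exp (t * σ n * Complex.I) * ((1 - τ n * Complex.I)⁻¹
        * (((1 + b : ℝ) : ℂ) * (((x / b : ℝ) : ℂ)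
          / (((x / b : ℝ) : ℂ) + (1 - τ n * Complex.I)))) ^ d n)‖
      ≤ ((1 + b) * x / (x + b)) ^ d n := by
    intro n x hx
    rw [norm_mul, hexp, one_mul, norm_mul, norm_pow]
    have h1 := norm_inv_one_sub_mul_I_le (τ n)
    have h2 := norm_mul_div_add_le (τ := τ n) hb (div_nonneg hx hb.le : 0 ≤ x / b)
    rw [hratio x hx] at h2
    refine (mul_le_of_le_one_left (by positivity) h1).trans ?_
    gcongr
  rw [hlim]
  refine tendsto_integral_of_dominated_convergence (fun _ => 1) ?_ (integrable_const _) ?_ ?_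
  · intro n
    refine Measurable.aestronglyMeasurable ?_
    fun_prop
  · intro n
    filter_upwards [hX] with ω hω
    refine (hnorm n _ hω.1).trans (pow_le_one₀ ?_ ?_)
    · have := hω.1
      positivity
    · rw [div_le_one (by linarith [hω.1])]
      nlinarith [hω.2]
  · filter_upwards [hX] with ω hω
    by_cases h : X ω = 1
    · rw [Set.indicator_of_mem (by exact h)]
      have h1 := (tendsto_exp_mul_inv_pow hσ hd t).mul hq
      rw [mul_one] at h1
      refine h1.congr' ?_
      filter_upwards [hσ.eventually_gt_atTop 0] with n hn
      -- The factor (1 + b)/b in τ is chosen so that 1/b + 1 - iτ = ((1 + b)/b)(1 + i t/σ). The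
      -- tilted base is then exactly the characteristic function of a rescaled exponential variable.
      have h2 : (((1 + b : ℝ) : ℂ) * (((X ω / b : ℝ) : ℂ)
          / (((X ω / b : ℝ) : ℂ) + (1 - τ n * Complex.I)))) = (1 + t / σ n * Complex.I)⁻¹ := by
        have hb' : (b : ℂ) ≠ 0 := by exact_mod_cast hb.ne'
        have hb1 : (1 + b : ℂ) ≠ 0 := by exact_mod_cast (by linarith : (1 + b : ℝ) ≠ 0)
        have h3 : ((X ω / b : ℝ) : ℂ) + (1 - τ n * Complex.I)
            = (1 + b) / b * (1 + t / σ n * Complex.I) := by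
          rw [h, hτ]
          push_cast
          field_simp
          ring
        rw [h3, h]
        push_cast
        rw [div_mul_eq_mul_div, div_div_div_cancel_right₀ hb', mul_div_assoc',
          mul_one, div_mul_cancel_left₀ hb1]
      rw [h2]
      ring
    -- Below the atom the base has modulus at most (1 + b) X / (X + b) < 1, and its d-th power
    -- vanishes since d tends to infinity.
    · rw [Set.indicator_of_notMem (by exact h)]
      have hlt : X ω < 1 := lt_of_le_of_ne hω.2 h
      have hr0 : 0 ≤ (1 + b) * X ω / (X ω + b) := by
        have := hω.1
        positivity
      have hr1 : (1 + b) * X ω / (X ω + b) < 1 := by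
        rw [div_lt_one (by linarith [hω.1])]
        nlinarith
      exact squeeze_zero_norm (fun n => hnorm n _ hω.1)
        ((tendsto_pow_atTop_nhds_zero_of_lt_one hr0 hr1).comp hd')

end OneVertex

/-- The cells cost O(1/N). The cut-off tail has size ((1 + b)/r)^d (n/N)^(-β) with β = (1 + b -
r)/b, whose exponent is negative by the inequality that selects r and ε. -/
lemma tendsto_riemannError {ε a b w r K : ℝ} (hb : 0 < b) (hw : 0 < w) (hε : 0 < ε)
    (hr1 : 1 < r) (hr2 : r < 1 + b)
    (hr : (a + ε) * Real.log ((1 + b) / r) + ε * (2 + (r - 1) / w) < (1 + b - r) / b)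
    {d : ℕ → ℕ} (hd : Tendsto (fun n : ℕ => (d n : ℝ) / Real.log n) atTop (𝓝 a)) :
    Tendsto (fun n : ℕ => K * (2 / (labelThreshold ε n : ℝ))
      + ((1 + b) / r) ^ d n * (Real.exp (-((1 + b - r) / b) * Real.log (n / labelThreshold ε n))
          / ((1 + b - r) / b))) atTop (𝓝 0) := by
  have h1 := (tendsto_inv_labelThreshold_mul_pow hε 0).const_mul (2 * K)
  simp only [pow_zero, mul_one, mul_zero] at h1
  set β := (1 + b - r) / b with hβ
  have hβ0 : 0 < β := div_pos (by linarith) hb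
  have hβ1 : β ≤ 1 := by rw [hβ, div_le_one hb]; linarith
  set γ := β - ε * 2 - (a + ε) * Real.log ((1 + b) / r) with hγ
  have hγ0 : 0 < γ := by
    have : 0 ≤ ε * ((r - 1) / w) := mul_nonneg hε.le (div_nonneg (by linarith) hw.le)
    rw [hγ]; linarith
  have h2 := (tendsto_exp_neg_mul_log_mul_pow hγ0 0).const_mul (2 / β)
  simp only [pow_zero, mul_one, mul_zero] at h2
  have hx : 1 ≤ (1 + b) / r := by rw [one_le_div (by linarith)]; linarith
  have hd' : Tendsto (fun n : ℕ => (((d n : ℕ) : ℤ) : ℝ) / Real.log n) atTop (𝓝 a) := by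
    simpa using hd
  have hlow : Tendsto (fun n : ℕ => K * (2 / (labelThreshold ε n : ℝ))) atTop (𝓝 0) :=
    h1.congr fun n => by ring
  have hup : Tendsto (fun n : ℕ => ((1 + b) / r) ^ d n
      * (Real.exp (-β * Real.log (n / labelThreshold ε n)) / β)) atTop (𝓝 0) := by
    refine squeeze_zero' (Eventually.of_forall fun n => ?_) ?_ h2
    · have : 0 < (1 + b) / r := by linarith
      positivity
    · filter_upwards [eventually_zpow_le_exp hε hx hd', eventually_ge_atTop 1] with n h4 h5
      rw [zpow_natCast] at h4
      have hn0 : (0 : ℝ) < n := by exact_mod_cast h5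
      have hN0 : (0 : ℝ) < labelThreshold ε n := by exact_mod_cast one_le_labelThreshold ε n
      have hL := Real.log_natCast_nonneg n
      have h6 : Real.exp (-β * Real.log (n / labelThreshold ε n))
          ≤ 2 * Real.exp ((2 * ε - β) * Real.log n) := by
        rw [Real.log_div hn0.ne' hN0.ne']
        have h7 : Real.exp (β * Real.log (labelThreshold ε n)) ≤ labelThreshold ε n := by
          have h8 : 0 ≤ Real.log (labelThreshold ε n) := Real.log_natCast_nonneg _
          calc _ ≤ Real.exp (Real.log (labelThreshold ε n)) :=
                Real.exp_le_exp.2 (mul_le_of_le_one_left h8 hβ1)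
            _ = _ := Real.exp_log hN0
        have h9 : Real.exp (ε * Real.log n) ≤ Real.exp (2 * ε * Real.log n) :=
          Real.exp_le_exp.2 (by nlinarith)
        have h10 := labelThreshold_le hε n
        calc Real.exp (-β * (Real.log n - Real.log (labelThreshold ε n)))
            = Real.exp (β * Real.log (labelThreshold ε n)) * Real.exp (-β * Real.log n) := by
              rw [← Real.exp_add]; congr 1; ring
          _ ≤ 2 * Real.exp (2 * ε * Real.log n) * Real.exp (-β * Real.log n) := by
              gcongr; linarith
          _ = _ := by rw [mul_assoc, ← Real.exp_add]; congr 2; ring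
      calc ((1 + b) / r) ^ d n * (Real.exp (-β * Real.log (n / labelThreshold ε n)) / β)
          ≤ Real.exp ((a + ε) * Real.log ((1 + b) / r) * Real.log n)
              * (2 * Real.exp ((2 * ε - β) * Real.log n) / β) := by gcongr
        _ = 2 / β * (Real.exp ((a + ε) * Real.log ((1 + b) / r) * Real.log n)
              * Real.exp ((2 * ε - β) * Real.log n)) := by ring
        _ = _ := by rw [← Real.exp_add, hγ]; congr 2; ring
  simpa using hlow.add hup

end WRT

/-! ### Convergence of the one-vertex sums. -/

namespace WRT

open MeasureTheory ProbabilityTheory Filter Topology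

/-- The rescaled label of a fixed vertex. -/
noncomputable def rescaledLabel (θ a : ℝ) (n v : ℕ) : ℝ :=
  (Real.log v - (1 - a * (1 - θ⁻¹)) * Real.log n) / Real.sqrt (a * (1 - θ⁻¹) ^ 2 * Real.log n)

/-- In terms of log(n/v) the rescaled label is affine, with intercept σ = √(a log n). The phase
exp(i t · label) thus splits into exp(i t σ) and the oscillation exp(i τ log(n/v)) of the Laplace
transform. -/
lemma rescaledLabel_eq {a b : ℝ} (hb : 0 < b) (ha : 0 < a) {n v : ℕ} (hn : 0 < Real.log n)
    (hv : 1 ≤ v) :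
    rescaledLabel (1 + b) a n v = Real.sqrt (a * Real.log n)
      + -(Real.log (n / v) / Real.sqrt (a * Real.log n)) * ((1 + b) / b) := by
  have hv0 : (v : ℝ) ≠ 0 := by exact_mod_cast (by omega : v ≠ 0)
  have hn0 : (n : ℝ) ≠ 0 := fun h => by simp [h] at hn
  have hc : 1 - (1 + b)⁻¹ = b / (1 + b) := by
    have : 1 + b ≠ 0 := by linarith
    field_simp
    ring
  have hc0 : 0 < b / (1 + b) := by positivity
  have hs : Real.sqrt (a * (b / (1 + b)) ^ 2 * Real.log n)
      = b / (1 + b) * Real.sqrt (a * Real.log n) := by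
    rw [mul_right_comm, mul_comm, Real.sqrt_mul (sq_nonneg _), Real.sqrt_sq hc0.le]
  have hσ : 0 < Real.sqrt (a * Real.log n) := Real.sqrt_pos.2 (by positivity)
  have hσ2 : Real.sqrt (a * Real.log n) ^ 2 = a * Real.log n := Real.sq_sqrt (by positivity)
  rw [rescaledLabel, hc, hs, Real.log_div hn0 hv0]
  have hb1 : 1 + b ≠ 0 := by linarith
  field_simp
  rw [hσ2]
  ring

section OneVertex

variable {Ω : Type*} [mΩ : MeasurableSpace Ω] {μ : Measure Ω} [IsProbabilityMeasure μ]

lemma sum_exp_mul_meanTail_eq_integral {X : Ω → ℝ} (hXm : Measurable X)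
    (hX : ∀ᵐ ω ∂μ, X ω ∈ Set.Icc 0 1) {b : ℝ} (hb : 0 < b) (d : ℤ) {n N : ℕ} (hN : 1 ≤ N)
    (ψ : ℕ → ℂ) :
    ∑ v ∈ Finset.Icc N n, ψ v * (meanTail μ X b d (Real.log (n / v)) : ℂ)
      = ∫ ω, ∑ v ∈ Finset.Icc N n, ψ v
        * (poissonTail d (X ω / b * Real.log (n / v)) : ℂ) ∂μ := by
  rw [integral_finsetSum]
  · refine Finset.sum_congr rfl fun v _ => ?_
    rw [integral_const_mul, integral_complex_ofReal, meanTail]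
  · intro v hv
    rw [Finset.mem_Icc] at hv
    refine Integrable.const_mul (Integrable.ofReal ?_) _
    have hv0 : (0 : ℝ) < v := by exact_mod_cast hN.trans hv.1
    have hs : 0 ≤ Real.log (n / v) := Real.log_nonneg (by
      rw [one_le_div hv0]
      exact_mod_cast hv.2)
    refine integrable_of_ae_mem_Icc (a := 0) (b := 1) ?_ ?_
    · exact ((continuous_poissonTail d).measurable.comp
        ((hXm.div_const b).mul_const _)).aestronglyMeasurable
    · filter_upwards [hX] with ω hω
      have h0 : 0 ≤ X ω / b * Real.log (n / v) := mul_nonneg (div_nonneg hω.1 hb.le) hs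
      exact ⟨poissonTail_nonneg d h0, poissonTail_le_one d h0⟩

/-- For fixed X the sum over labels is a Riemann sum for the Laplace transform at 1 - iτ, with an
error uniform in X. The mean of the tilted transform converges by `tendsto_integral_exp_mul_pow`. -/
theorem tendsto_oneVertexSum {X : Ω → ℝ} (hXm : Measurable X)
    (hX : ∀ᵐ ω ∂μ, X ω ∈ Set.Icc 0 1) {a b w r ε : ℝ} (hb : 0 < b) (ha : 0 < a) (hw : 0 < w)
    (hε : 0 < ε) (hε1 : ε < 1) (hr1 : 1 < r) (hr2 : r < 1 + b)
    (hr : (a + ε) * Real.log ((1 + b) / r) + ε * (2 + (r - 1) / w) < (1 + b - r) / b)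
    {d : ℕ → ℕ} (hd : Tendsto d atTop atTop)
    (hda : (fun n : ℕ => (d n : ℝ) / Real.log n - a)
      =o[atTop] fun n : ℕ => 1 / Real.sqrt (Real.log n))
    (hdl : Tendsto (fun n : ℕ => (d n : ℝ) / Real.log n) atTop (𝓝 a)) (t : ℝ) :
    Tendsto (fun n : ℕ => (n : ℂ)⁻¹ * ∑ v ∈ Finset.Icc (labelThreshold ε n) n,
        Complex.exp (t * rescaledLabel (1 + b) a n v * Complex.I)
          * (((1 + b) ^ d n * meanTail μ X b (d n) (Real.log (n / v)) : ℝ) : ℂ)) atTop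
      (𝓝 (μ.real {ω | X ω = 1} * Complex.exp (-t ^ 2 / 2))) := by
  set σ : ℕ → ℝ := fun n => Real.sqrt (a * Real.log n) with hσdef
  have hL := tendsto_log_natCast_atTop
  have hσ : Tendsto σ atTop atTop :=
    Real.tendsto_sqrt_atTop.comp (hL.const_mul_atTop ha)
  -- This is where the rate o(1/√log n) is needed: replacing d by a log n must not shift the
  -- centring on the scale of the fluctuations.
  have hdσ : Tendsto (fun n => ((d n : ℝ) - σ n ^ 2) / σ n) atTop (𝓝 0) := by
    have h := hda.tendsto_div_nhds_zero.mul_const (Real.sqrt a)⁻¹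
    rw [zero_mul] at h
    refine h.congr' ?_
    filter_upwards [hL.eventually_gt_atTop 0] with n hn
    have hs := Real.sqrt_pos.2 hn
    have hsa := Real.sqrt_pos.2 ha
    have hs2 := Real.sq_sqrt hn.le
    simp only [hσdef]
    rw [Real.sq_sqrt (by positivity), Real.sqrt_mul ha.le]
    rw [div_sub' hn.ne', div_div_div_eq, mul_one]
    field_simp
    rw [hs2]
    ring
  set τ : ℕ → ℝ := fun n => -(t / σ n) * ((1 + b) / b) with hτdef
  have hτ0 : Tendsto τ atTop (𝓝 0) := by
    have h := ((hσ.const_div_atTop t).neg).mul_const ((1 + b) / b)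
    rwa [neg_zero, zero_mul] at h
  have hmain := tendsto_integral_exp_mul_pow hXm hX hb hσ hdσ hd t (τ := τ) fun n => rfl
  have herr := tendsto_riemannError (K := 2 * (1 + b⁻¹ * (1 + b + 1))) hb hw hε hr1 hr2 hr hdl
  have hexp : ∀ n, ‖Complex.exp (t * σ n * Complex.I)‖ = 1 := fun n => by
    have h := Complex.norm_exp_ofReal_mul_I (t * σ n)
    rwa [Complex.ofReal_mul] at h
  set F : ℕ → Ω → ℂ := fun n ω => (n : ℂ)⁻¹ * ∑ v ∈ Finset.Icc (labelThreshold ε n) n,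
    Complex.exp (τ n * Real.log (n / v) * Complex.I)
      * (poissonTail (d n) (X ω / b * Real.log (n / v)) : ℂ) with hF
  set G : ℕ → Ω → ℂ := fun n ω => (1 - τ n * Complex.I)⁻¹ * (((X ω / b : ℝ) : ℂ)
    / (((X ω / b : ℝ) : ℂ) + (1 - τ n * Complex.I))) ^ d n with hG
  have hsum : ∀ᶠ n : ℕ in atTop, (n : ℂ)⁻¹ * ∑ v ∈ Finset.Icc (labelThreshold ε n) n,
        Complex.exp (t * rescaledLabel (1 + b) a n v * Complex.I)
          * (((1 + b) ^ d n * meanTail μ X b (d n) (Real.log (n / v)) : ℝ) : ℂ)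
      = ∫ ω, Complex.exp (t * σ n * Complex.I) * (((1 + b : ℝ) : ℂ) ^ d n * F n ω) ∂μ := by
    filter_upwards [hL.eventually_gt_atTop 0] with n hn
    simp only [hF]
    rw [integral_const_mul, integral_const_mul, integral_const_mul,
      ← sum_exp_mul_meanTail_eq_integral hXm hX hb _ (one_le_labelThreshold ε n),
      Finset.mul_sum, Finset.mul_sum, Finset.mul_sum, Finset.mul_sum]
    refine Finset.sum_congr rfl fun v hv => ?_
    have hv1 := (one_le_labelThreshold ε n).trans (Finset.mem_Icc.1 hv).1
    have h1 : Complex.exp (t * rescaledLabel (1 + b) a n v * Complex.I)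
        = Complex.exp (t * σ n * Complex.I)
          * Complex.exp (τ n * Real.log (n / v) * Complex.I) := by
      rw [rescaledLabel_eq hb ha hn hv1, ← Complex.exp_add]
      congr 1
      simp only [hτdef, hσdef]
      push_cast
      ring
    rw [h1]
    push_cast
    ring
  have hGint : ∀ n, ∫ ω, Complex.exp (t * σ n * Complex.I) * ((1 - τ n * Complex.I)⁻¹
        * (((1 + b : ℝ) : ℂ) * (((X ω / b : ℝ) : ℂ)
          / (((X ω / b : ℝ) : ℂ) + (1 - τ n * Complex.I)))) ^ d n) ∂μ
      = ∫ ω, Complex.exp (t * σ n * Complex.I) * (((1 + b : ℝ) : ℂ) ^ d n * G n ω) ∂μ := by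
    intro n
    refine integral_congr_ae (Eventually.of_forall fun ω => ?_)
    simp only [hG, mul_pow]
    ring
  simp only [hGint] at hmain
  have hFm : ∀ n, Measurable (F n) := fun n => by
    refine Measurable.const_mul (Finset.measurable_sum _ fun v _ => Measurable.const_mul ?_ _) _
    exact Complex.measurable_ofReal.comp ((continuous_poissonTail _).measurable.comp
        ((hXm.div_const b).mul_const _))
  have hGm : ∀ n, Measurable (G n) := fun n => by
    simp only [hG]
    fun_prop
  -- The constant 2 (1 + b⁻¹ (b + 2)) bounds 2 (|τ| + x (θ + 1)) through |τ| < 1 and x = X/b ≤ 1/b,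
  -- so the error no longer depends on ω.
  have hbound : ∀ᶠ n : ℕ in atTop, ∀ᵐ ω ∂μ,
      ‖Complex.exp (t * σ n * Complex.I) * (((1 + b : ℝ) : ℂ) ^ d n * F n ω)
        - Complex.exp (t * σ n * Complex.I) * (((1 + b : ℝ) : ℂ) ^ d n * G n ω)‖
      ≤ 2 * (1 + b⁻¹ * (1 + b + 1)) * (2 / (labelThreshold ε n : ℝ))
      + ((1 + b) / r) ^ d n * (Real.exp (-((1 + b - r) / b) * Real.log (n / labelThreshold ε n))
          / ((1 + b - r) / b)) := by
    filter_upwards [eventually_ge_atTop 1, hd.eventually_ge_atTop 1,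
      (hτ0.abs).eventually_lt_const (by simp : |(0 : ℝ)| < 1)] with n hn1 hdn hτn
    filter_upwards [hX] with ω hω
    have hx1 : X ω / b ≤ b⁻¹ := by
      rw [div_eq_mul_inv]
      exact mul_le_of_le_one_left (by positivity) hω.2
    have h := zpow_mul_norm_riemannSum_sub_le (θ := 1 + b) (x := X ω / b) (by linarith) hr1.le hr2
      (div_nonneg hω.1 hb.le) (by rw [add_sub_cancel_left, mul_div_cancel₀ _ hb.ne']; exact hω.2)
      hdn (τ n) (one_le_labelThreshold ε n) (labelThreshold_le_self hε1 hn1)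
    rw [add_sub_cancel_left] at h
    rw [← mul_sub, ← mul_sub, norm_mul, hexp, one_mul, norm_mul, norm_pow, Complex.norm_real,
      Real.norm_of_nonneg (by linarith)]
    refine h.trans ?_
    gcongr
  have hbG : ∀ n, Integrable (fun ω =>
      Complex.exp (t * σ n * Complex.I) * (((1 + b : ℝ) : ℂ) ^ d n * G n ω)) μ := by
    intro n
    refine Integrable.const_mul (Integrable.const_mul ?_ _) _
    refine Integrable.of_bound (hGm n).aestronglyMeasurable 1 ?_
    filter_upwards [hX] with ω hω
    have h2 : ‖(((X ω / b : ℝ) : ℂ) / (((X ω / b : ℝ) : ℂ) + (1 - τ n * Complex.I)))‖ ≤ 1 := by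
      have hx : 0 ≤ X ω / b := div_nonneg hω.1 hb.le
      have h := Complex.re_le_norm (((X ω / b : ℝ) : ℂ) + (1 - τ n * Complex.I))
      rw [norm_div, Complex.norm_real, Real.norm_of_nonneg hx]
      refine div_le_one_of_le₀ (le_trans ?_ h) (norm_nonneg _)
      simp
    simp only [hG]
    rw [norm_mul, norm_pow]
    exact mul_le_one₀ (norm_inv_one_sub_mul_I_le _) (by positivity)
      (pow_le_one₀ (norm_nonneg _) h2)
  have hdiff : Tendsto (fun n =>
      ∫ ω, Complex.exp (t * σ n * Complex.I) * (((1 + b : ℝ) : ℂ) ^ d n * F n ω) ∂μ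
      - ∫ ω, Complex.exp (t * σ n * Complex.I) * (((1 + b : ℝ) : ℂ) ^ d n * G n ω) ∂μ)
      atTop (𝓝 0) := by
    refine squeeze_zero_norm' ?_ herr
    filter_upwards [hbound] with n hn
    have hI : Integrable (fun ω =>
        Complex.exp (t * σ n * Complex.I) * (((1 + b : ℝ) : ℂ) ^ d n * F n ω)
        - Complex.exp (t * σ n * Complex.I) * (((1 + b : ℝ) : ℂ) ^ d n * G n ω)) μ :=
      Integrable.of_bound ((((hFm n).const_mul _).const_mul _).sub
        (((hGm n).const_mul _).const_mul _)).aestronglyMeasurable _ hn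
    have hIF := hI.add (hbG n)
    rw [← integral_sub _ (hbG n)]
    · have h := norm_integral_le_of_norm_le_const hn
      simpa using h
    · refine hIF.congr (Eventually.of_forall fun ω => ?_)
      simp
  have h := hdiff.add hmain
  simp only [sub_add_cancel, zero_add] at h
  exact h.congr' (hsum.mono fun n hn => hn.symm)

end OneVertex

end WRT

namespace WRT

open MeasureTheory ProbabilityTheory Filter Topology

/-! ### Conditional convergence in distribution -/

section Conditional

variable {Ω : Type*} [mΩ : MeasurableSpace Ω] {μ : Measure Ω}

lemma integral_cond_eq {D : Set Ω} {E : Type*} [NormedAddCommGroup E]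
    [NormedSpace ℝ E] (f : Ω → E) :
    ∫ ω, f ω ∂(cond μ D) = (μ.real D)⁻¹ • ∫ ω in D, f ω ∂μ := by
  rw [ProbabilityTheory.cond, integral_smul_measure, ENNReal.toReal_inv, measureReal_def]

/-- Lévy's continuity theorem for conditional laws: it suffices that the unnormalised characteristic
functions converge after multiplication by some normalising sequence. -/
theorem tendsto_integral_cond_gaussian [IsProbabilityMeasure μ] {k : ℕ} {D : ℕ → Set Ω} {X : ℕ → Ω → Fin k → ℝ}
    (hX : ∀ n, Measurable (X n)) {κ : ℕ → ℂ} {p : ℂ} (hp : p ≠ 0)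
    (h : ∀ t : Fin k → ℝ, Tendsto (fun n => κ n * ∫ ω in D n,
      Complex.exp ((∑ i, t i * X n ω i : ℝ) * Complex.I) ∂μ) atTop
      (𝓝 (p * ∏ i, Complex.exp (-t i ^ 2 / 2)))) :
    (∀ᶠ n in atTop, 0 < μ (D n)) ∧ ∀ f : BoundedContinuousFunction (Fin k → ℝ) ℝ,
      Tendsto (fun n => ∫ ω, f (X n ω) ∂(cond μ (D n))) atTop
        (𝓝 (∫ x, f x ∂(Measure.pi fun _ : Fin k => gaussianReal 0 1))) := by
  -- At t = 0 the hypothesis gives the asymptotics of the probability of D n. Since p ≠ 0, this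
  -- probability is eventually positive, and dividing by it cancels κ.
  have h0 : Tendsto (fun n => κ n * (μ.real (D n) : ℂ)) atTop (𝓝 p) := by
    have h1 := h 0
    simpa [measureReal_restrict_apply] using h1
  have hne := h0.eventually_ne hp
  have hpos : ∀ᶠ n in atTop, μ (D n) ≠ 0 := by
    filter_upwards [hne] with n hn h1
    simp [measureReal_def, h1] at hn
  refine ⟨hpos.mono fun n hn => pos_iff_ne_zero.2 hn, fun f => ?_⟩
  have hY : ∀ n, Measurable fun ω => WithLp.toLp 2 (X n ω) := fun n =>
    (WithLp.measurable_toLp 2 _).comp (hX n)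
  set ν : ProbabilityMeasure (EuclideanSpace ℝ (Fin k)) :=
    ⟨(Measure.pi fun _ : Fin k => gaussianReal 0 1).map (WithLp.toLp 2),
      Measure.isProbabilityMeasure_map (WithLp.measurable_toLp 2 _).aemeasurable⟩ with hν
  classical
  -- The laws are transported to Euclidean space, where characteristic functions use the inner
  -- product. For the finitely many n with a null conditioning event, the limit law serves as a
  -- default value.
  set P : ℕ → ProbabilityMeasure (EuclideanSpace ℝ (Fin k)) := fun n =>
    if hn : μ (D n) ≠ 0 then
      ⟨(cond μ (D n)).map fun ω => WithLp.toLp 2 (X n ω),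
        haveI := cond_isProbabilityMeasure hn
        Measure.isProbabilityMeasure_map (hY n).aemeasurable⟩
    else ν with hP
  have hPn : ∀ n, μ (D n) ≠ 0 → (P n : Measure (EuclideanSpace ℝ (Fin k)))
      = (cond μ (D n)).map fun ω => WithLp.toLp 2 (X n ω) := by
    intro n hn
    simp [hP, hn]
  have hlim : Tendsto P atTop (𝓝 ν) := by
    refine ProbabilityMeasure.tendsto_iff_tendsto_charFun.2 fun t => ?_
    have hνt : charFun (ν : Measure (EuclideanSpace ℝ (Fin k))) t
        = ∏ i, Complex.exp (-t i ^ 2 / 2) := by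
      simp only [hν, ProbabilityMeasure.coe_mk]
      rw [charFun_pi]
      refine Finset.prod_congr rfl fun i _ => ?_
      rw [charFun_gaussianReal]
      congr 1
      push_cast
      ring
    rw [hνt]
    have h2 := (h fun i => t i).div h0 hp
    rw [mul_div_cancel_left₀ _ hp] at h2
    refine h2.congr' ?_
    filter_upwards [hne, hpos] with n hn hn'
    rw [hPn n hn', charFun_apply, integral_map (hY n).aemeasurable (by fun_prop),
      integral_cond_eq, Complex.real_smul]
    have hκ : κ n ≠ 0 := left_ne_zero_of_mul hn
    simp only [Pi.div_apply]
    rw [mul_div_mul_left _ _ hκ, Complex.ofReal_inv, div_eq_inv_mul]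
    simp [PiLp.inner_apply]
  have hf := ProbabilityMeasure.tendsto_iff_forall_integral_tendsto.1 hlim
    (f.compContinuous ⟨WithLp.ofLp, PiLp.continuous_ofLp 2 _⟩)
  have hfν : ∫ x, f.compContinuous ⟨WithLp.ofLp, PiLp.continuous_ofLp 2 _⟩ x
      ∂(ν : Measure (EuclideanSpace ℝ (Fin k)))
      = ∫ x, f x ∂(Measure.pi fun _ : Fin k => gaussianReal 0 1) := by
    simp only [hν, ProbabilityMeasure.coe_mk]
    rw [integral_map (WithLp.measurable_toLp 2 _).aemeasurable
      (BoundedContinuousFunction.continuous _).aestronglyMeasurable]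
    simp
  rw [hfν] at hf
  refine hf.congr' ?_
  filter_upwards [hpos] with n hn
  rw [hPn n hn, integral_map (hY n).aemeasurable
    (BoundedContinuousFunction.continuous _).aestronglyMeasurable]
  simp

end Conditional

/-! ### The joint limit -/

section Joint

variable {Ω : Type*} [mΩ : MeasurableSpace Ω] {μ : Measure Ω} [IsProbabilityMeasure μ]
  {W : ℕ → Ω → ℝ} {parent : ℕ → Ω → ℕ}

lemma measurable_rescaledLabels (θ : ℝ) (n : ℕ) {k : ℕ} (a : Fin k → ℝ) {v : Ω → Fin k → ℕ}
    (hv : Measurable v) : Measurable (rescaledLabels θ n a v) :=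
  (measurable_of_countable fun u : Fin k → ℕ => fun i => rescaledLabel θ (a i) n (u i)).comp hv

/-- The normaliser exchanges the sampling weight 1 / (n)_k for n^(-k) and inserts the tilt θ^(∑
d_i). It does not depend on t, so it cancels on conditioning. What remains is a product of
one-vertex limits. -/
theorem tendsto_mul_setIntegral_degreeEvent (hT : IsWeightedRecursiveTree μ W parent)
    (hW : WeightAssumption μ (W 1)) {b : ℝ} (hb : 0 < b) (hb1 : b ≤ 1)
    (hbW : b = ∫ ω, W 1 ω ∂μ) {k : ℕ} {v : ℕ → Ω → Fin k → ℕ}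
    (hv : ∀ n, IsUniformSample μ n (v n))
    (hvT : ∀ n, Indep (MeasurableSpace.comap (v n) inferInstance) (history W parent n) μ)
    {d : Fin k → ℕ → ℤ} (hd : ∀ i, Tendsto (d i) atTop atTop) {a : Fin k → ℝ}
    (ha0 : ∀ i, 0 < a i) (ha : ∀ i, a i < (1 + b) / b)
    (hda : ∀ i, (fun n : ℕ => (d i n : ℝ) / Real.log n - a i)
      =o[atTop] fun n : ℕ => 1 / Real.sqrt (Real.log n)) (t : Fin k → ℝ) :
    Tendsto (fun n : ℕ => (((n : ℂ) ^ k)⁻¹ * n.descFactorial k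
        * (tilt (fun _ => 1 + b) (fun i => d i n) : ℝ))
        * ∫ ω in degreeEvent parent n (v n) fun i => d i n,
          Complex.exp ((∑ i, t i * rescaledLabels (1 + b) n a (v n) ω i : ℝ) * Complex.I) ∂μ)
      atTop (𝓝 ((μ.real {ω | W 1 ω = 1} : ℂ) ^ k * ∏ i, Complex.exp (-t i ^ 2 / 2))) := by
  obtain ⟨w, hw0, -, hwW⟩ := exists_ae_weight_mem_Icc hT hW
  obtain ⟨ε, r, hε, hε1, hr⟩ := exists_tilting_parameters (w := w) hb ha0 ha
  have hX : ∀ᵐ ω ∂μ, W 1 ω ∈ Set.Icc 0 1 := hwW.mono fun ω hω =>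
    ⟨hw0.le.trans (hω 1 le_rfl).1, (hω 1 le_rfl).2⟩
  have hdl : ∀ i, Tendsto (fun n : ℕ => (d i n : ℝ) / Real.log n) atTop (𝓝 (a i)) := by
    intro i
    have h1 : Tendsto (fun n : ℕ => 1 / Real.sqrt (Real.log n)) atTop (𝓝 0) :=
      (Real.tendsto_sqrt_atTop.comp tendsto_log_natCast_atTop).const_div_atTop 1
    have h2 := ((hda i).trans_tendsto h1).add_const (a i)
    simpa using h2
  have hone : ∀ i, Tendsto (fun n : ℕ => (n : ℂ)⁻¹ * ∑ u ∈ Finset.Icc (labelThreshold ε n) n,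
        Complex.exp (t i * rescaledLabel (1 + b) (a i) n u * Complex.I)
          * (((1 + b) ^ d i n * meanTail μ (W 1) b (d i n) (Real.log (n / u)) : ℝ) : ℂ)) atTop
      (𝓝 (μ.real {ω | W 1 ω = 1} * Complex.exp (-t i ^ 2 / 2))) := by
    intro i
    -- Thresholds tending to infinity are eventually nonnegative, so the one-vertex limit for
    -- natural thresholds applies.
    have hnat : ∀ᶠ n in atTop, (((d i n).toNat : ℕ) : ℤ) = d i n :=
      ((hd i).eventually_ge_atTop 0).mono fun n hn => Int.toNat_of_nonneg hn
    have hcast : ∀ᶠ n in atTop, (((d i n).toNat : ℕ) : ℝ) = d i n :=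
      hnat.mono fun n hn => by exact_mod_cast congrArg (fun z : ℤ => (z : ℝ)) hn
    have htop : Tendsto (fun n => (d i n).toNat) atTop atTop := by
      refine tendsto_atTop.2 fun m => ?_
      filter_upwards [(hd i).eventually_ge_atTop (m : ℤ)] with n hn
      omega
    refine (tendsto_oneVertexSum (hT.measurable_weight 1 le_rfl) hX hb (ha0 i) hw0 hε hε1
      (hr i).1 (hr i).2.1 (hr i).2.2 (d := fun n => (d i n).toNat) htop ?_ ?_ (t i)).congr' ?_
    · refine (hda i).congr' ?_ EventuallyEq.rfl
      filter_upwards [hcast] with n hn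
      rw [hn]
    · refine (hdl i).congr' ?_
      filter_upwards [hcast] with n hn
      rw [hn]
    · filter_upwards [hnat] with n hn
      rw [hn, ← zpow_natCast, hn]
  have hprod := tendsto_finsetProd Finset.univ fun i _ => hone i
  have hφ : ∀ (n : ℕ) (i : Fin k) (u : ℕ),
      ‖Complex.exp (t i * rescaledLabel (1 + b) (a i) n u * Complex.I)‖ ≤ 1 := by
    intro n i u
    have h := Complex.norm_exp_ofReal_mul_I (t i * rescaledLabel (1 + b) (a i) n u)
    rw [Complex.ofReal_mul] at h
    exact h.le
  have hsum := (tendsto_sum_distinctTuples_sub_prod hT hW hb hb1 hbW hw0 hwW hε hε1 hr hdl hφ).add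
    hprod
  simp only [sub_add_cancel, zero_add, Finset.prod_mul_distrib, Finset.prod_const,
    Finset.card_univ, Fintype.card_fin] at hsum
  refine hsum.congr' ?_
  filter_upwards [eventually_ge_atTop k] with n hn
  have hpos : (n.descFactorial k : ℂ) ≠ 0 := by
    rw [Nat.cast_ne_zero, ne_eq, Nat.descFactorial_eq_zero_iff_lt]
    omega
  have hint := setIntegral_degreeEvent_eq hT (hv n) hn (hvT n) (fun i => d i n)
    fun u => ∏ i, Complex.exp (t i * rescaledLabel (1 + b) (a i) n (u i) * Complex.I)
  have hfun : ∀ ω, Complex.exp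
        ((∑ i, t i * rescaledLabels (1 + b) n a (v n) ω i : ℝ) * Complex.I)
      = ∏ i, Complex.exp (t i * rescaledLabel (1 + b) (a i) n (v n ω i) * Complex.I) := by
    intro ω
    rw [← Complex.exp_sum, ← Finset.sum_mul]
    congr 2
    push_cast
    rfl
  simp only [hfun]
  rw [hint, mul_assoc _ (tilt _ _ : ℂ), mul_assoc _ (n.descFactorial k : ℂ), Finset.mul_sum,
    Finset.mul_sum, Finset.mul_sum, Finset.mul_sum, Finset.mul_sum]
  refine Finset.sum_congr rfl fun u _ => ?_
  generalize ∏ i, Complex.exp (t i * rescaledLabel (1 + b) (a i) n (u i) * Complex.I) = z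
  push_cast
  field_simp

end Joint

end WRT

/-! ### Conclusion. -/

theorem mainTheorem8 {Ω : Type*} [MeasurableSpace Ω] (μ : MeasureTheory.Measure Ω)
    [MeasureTheory.IsProbabilityMeasure μ]
    (W : ℕ → Ω → ℝ) (parent : ℕ → Ω → ℕ)
    (hT : WRT.IsWeightedRecursiveTree μ W parent)
    (hW : WRT.WeightAssumption μ (W 1))
    (θ : ℝ) (hθ : θ = 1 + ∫ ω, W 1 ω ∂μ)
    (k : ℕ) (hk : 1 ≤ k)
    -- `v n` are `k` uniform vertices without replacement from `[n]`, independent of the tree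
    (v : ℕ → Ω → Fin k → ℕ)
    (hv : ∀ n, WRT.IsUniformSample μ n (v n))
    (hvT : ∀ n, ProbabilityTheory.Indep (MeasurableSpace.comap (v n) inferInstance)
      (WRT.history W parent n) μ)
    (c : ℝ) (hc : c ∈ Set.Ioo 0 (θ / (θ - 1)))
    (d : Fin k → ℕ → ℤ)
    (hd : ∀ i, Filter.Tendsto (d i) Filter.atTop Filter.atTop)
    (hdc : ∀ i, ∀ᶠ n : ℕ in Filter.atTop, (d i n : ℝ) ≤ c * Real.log n)
    (a : Fin k → ℝ) (ha : ∀ i, a i ∈ Set.Ioo 0 (θ / (θ - 1)))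
    (hda : ∀ i, (fun n : ℕ => (d i n : ℝ) / Real.log n - a i)
      =o[Filter.atTop] fun n : ℕ => 1 / Real.sqrt (Real.log n)) :
    -- the conditioning event eventually has positive probability
    (∀ᶠ n : ℕ in Filter.atTop, 0 < μ (WRT.degreeEvent parent n (v n) fun i => d i n)) ∧
    -- conditional convergence in distribution to `k` independent standard normals
    ∀ f : BoundedContinuousFunction (Fin k → ℝ) ℝ,
      Filter.Tendsto
        (fun n : ℕ => ∫ ω, f (WRT.rescaledLabels θ n a (v n) ω)
          ∂(ProbabilityTheory.cond μ (WRT.degreeEvent parent n (v n) fun i => d i n)))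
        Filter.atTop
        (nhds (∫ x, f x ∂(MeasureTheory.Measure.pi
          fun _ : Fin k => ProbabilityTheory.gaussianReal 0 1))) := by
  obtain ⟨w, hw0, -, hwW⟩ := WRT.exists_ae_weight_mem_Icc hT hW
  have hW1 : ∀ᵐ ω ∂μ, W 1 ω ∈ Set.Icc w 1 := hwW.mono fun ω hω => hω 1 le_rfl
  have hint := WRT.integrable_of_ae_mem_Icc
    (hT.measurable_weight 1 le_rfl).aestronglyMeasurable hW1
  have hwb : w ≤ ∫ ω, W 1 ω ∂μ := by
    have h := MeasureTheory.integral_mono_ae (MeasureTheory.integrable_const w) hint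
      (hW1.mono fun ω hω => hω.1)
    simpa using h
  have hb1 : ∫ ω, W 1 ω ∂μ ≤ 1 := by
    have h := MeasureTheory.integral_mono_ae hint (MeasureTheory.integrable_const 1)
      (hW1.mono fun ω hω => hω.2)
    simpa using h
  have hb : 0 < ∫ ω, W 1 ω ∂μ := hw0.trans_le hwb
  have ha' : ∀ i, a i < (1 + ∫ ω, W 1 ω ∂μ) / ∫ ω, W 1 ω ∂μ := fun i => by
    have h := (ha i).2
    rwa [hθ, add_sub_cancel_left] at h
  -- The atom at one keeps the limiting normalisation nonzero, as the continuity theorem requires.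
  have hp : (μ.real {ω | W 1 ω = 1} : ℂ) ^ k ≠ 0 := by
    refine pow_ne_zero _ (Complex.ofReal_ne_zero.2 ?_)
    exact (ENNReal.toReal_pos hW.atom.ne' (MeasureTheory.measure_ne_top _ _)).ne'
  rw [hθ]
  exact WRT.tendsto_integral_cond_gaussian
    (fun n => WRT.measurable_rescaledLabels _ n a (hv n).measurable) hp
    (WRT.tendsto_mul_setIntegral_degreeEvent hT hW hb hb1 rfl hv hvT hd
      (fun i => (ha i).1) ha' hda)
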